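/- Fix an integer $m\ge 1$, put $n=2m+2$ and $p_j=e^{2\pi i j/n}$ for $0\le j\le n-1$, and fix $\rho>1$. Let $\mathcal W^{\ge0}_{\mathbb R}$ be the real Banach space of series $f(\lambda)=\sum_{k\ge0}f_k\lambda^k$ with $f_k\in\mathbb R$ and $\|f\|_\rho=\sum_k|f_k|\rho^k<\infty$. For $\mathbf x=(r,a,b,c)\in\mathbb R\times(\mathcal W^{\ge0}_{\mathbb R})^3$ and $t\in\mathbb R$ let $$\eta_t^{\mathbf x}=\begin{pmatrix}0&0\\ mrz^{m-1}dz&0\end{pmatrix}+t\sum_{j=0}^{n-1}A_j(\lambda)\frac{dz}{z-p_j},\qquad A_0(\lambda)=\begin{pmatrix}a(\lambda)&\lambda^{-1}b(\lambda)\\ \lambda c(\lambda)&-a(\lambda)\end{pmatrix},$$ $$A_{j+1}(\lambda)=D^{-1}A_j(-\lambda)D,\qquad D=\operatorname{diag}(e^{i\pi m/n},e^{-i\pi m/n}).$$ Let $\Phi_t$ solve $d\Phi_t=\Phi_t\,\eta^{\mathbf x}_t$, $\Phi_t(0)=\mathrm{Id}$. Let $\gamma_j$ be the loop based at $0$ that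 runs once counterclockwise along the circle through $0$ with centre $p_j/(2\cos(\pi/n))$; it encloses $p_j$ and no other $p_i$. Let $M_j(t)(\lambda)$ be the monodromy of $\Phi_t$ along $\gamma_j$, that is, the value at the end point of the continuation of $\Phi_t(\cdot,\lambda)$ along $\gamma_j$. For $t\neq0$ put $\widetilde M(t)=\frac1t\log M_0(t)$, where $\log M=\sum_{k\ge1}\frac{(-1)^{k-1}}{k}(M-\mathrm{Id})^k$. With $f^*(\lambda)=\overline{f(1/\overline\lambda)}$ and $f^0$ the constant coefficient of $f$, consider for $(t,\mathbf x)$ the system $$\tfrac1{2\pi i}\big(\widetilde M_{11}+\widetilde M_{11}^*\big)=0,\quad \tfrac1{2\pi i}\big(\widetilde M_{21}+\widetilde M_{12}^*\big)=0\ \text{ on }\mathbb S^1,\quad \tfrac{1}{2\pi i}\widetilde M_{12}(\lambda=\pm1)=0,\quad (a^0)^2+b^0c^0=1.\qquad(\ast)$$ Let $\mathbf x_0=(1,\ \lambda,\ \tfrac{\lambda^2-1}2,\ -2)$. Then there are $\delta>0$ and $\varepsilon>0$ such that for every real $t$ with $0<|t|<\varepsilon$ there is exactly one $\mathbf x(t)=(r,a,b,c)$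 with $|r-1|<\delta$, $\|a-\lambda\|_\rho<\delta$, $\|b-\tfrac{\lambda^2-1}2\|_\rho<\delta$, $\|c+2\|_\rho<\delta$ that solves $(\ast)$. For this $\mathbf x(t)$, and all $0\le j\le n-1$, the monodromies of the solution $\Phi_t$ for $\eta_t^{\mathbf x(t)}$ satisfy $$M_j(t)(1)=\begin{pmatrix}e^{2\pi it}&0\\0&e^{-2\pi it}\end{pmatrix}^{(-1)^j},\qquad M_j(t)(-1)=\begin{pmatrix}e^{-2\pi it}&0\\0&e^{2\pi it}\end{pmatrix}^{(-1)^j},$$ and $\det A_j(t)(\lambda)=-1$ for all $\lambda\in\mathbb S^1$, where $A_j(t)$ are the matrices $A_j$ formed from $\mathbf x(t)$. -/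

import Mathlib

open Complex Matrix

namespace DPW

/-! ### Loops in the spectral parameter

A real loop `f(lam) = ∑_{k ≥ 0} f_k lam^k` without negative Fourier modes is represented by the
sequence `f : ℕ → ℝ` of its Fourier coefficients. -/

/-- `‖f‖_ρ < ∞`, where `‖f‖_ρ = ∑ |f_k| ρ^k`. -/
def MemLoop (ρ : ℝ) (f : ℕ → ℝ) : Prop :=
  Summable fun k => |f k| * ρ ^ k

/-- The norm `‖f‖_ρ = ∑ |f_k| ρ^k`. -/
noncomputable def loopNorm (ρ : ℝ) (f : ℕ → ℝ) : ℝ :=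
  ∑' k, |f k| * ρ ^ k

/-- The value `f(lam) = ∑ f_k lam^k`. -/
noncomputable def evalLoop (f : ℕ → ℝ) (lam : ℂ) : ℂ :=
  ∑' k, (f k : ℂ) * lam ^ k

/-- The parameter vector `x = (r, a, b, c)`. -/
@[ext]
structure Param where
  r : ℝ
  a : ℕ → ℝ
  b : ℕ → ℝ
  c : ℕ → ℝ

/-- The central value `r = 1`, `a = lam`, `b = (lam^2 - 1) / 2`, `c = -2`. -/
noncomputable def centre : Param where
  r := 1
  a := fun k => if k = 1 then 1 else 0
  b := fun k => if k = 0 then -1 / 2 else if k = 2 then 1 / 2 else 0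
  c := fun k => if k = 0 then -2 else 0

/-- The open ball of radius `δ` about the central value in the Banach space of parameters
(with the maximum of the four norms). -/
def paramBall (ρ δ : ℝ) : Set Param :=
  {x | MemLoop ρ x.a ∧ MemLoop ρ x.b ∧ MemLoop ρ x.c ∧
    |x.r - centre.r| < δ ∧ loopNorm ρ (x.a - centre.a) < δ ∧
    loopNorm ρ (x.b - centre.b) < δ ∧ loopNorm ρ (x.c - centre.c) < δ}

/-! ### The potential -/

/-- The number of finite singularities, `n = 2 m + 2`. -/
def nSing (m : ℕ) : ℕ := 2 * m + 2

/-- The singularities `p_j = exp (2 π i j / n)`. -/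
noncomputable def pole (m j : ℕ) : ℂ :=
  exp (2 * Real.pi * I * j / nSing m)

/-- `D = diag (exp (i π m / n), exp (-i π m / n))`. -/
noncomputable def matD (m : ℕ) : Matrix (Fin 2) (Fin 2) ℂ :=
  !![exp (I * Real.pi * m / nSing m), 0; 0, exp (-(I * Real.pi * m / nSing m))]

/-- The residue matrices `A_j(lam)`: `A_0 = (a, lam⁻¹ b; lam c, -a)` and
`A_{j+1}(lam) = D⁻¹ A_j(-lam) D`. -/
noncomputable def matA (m : ℕ) (x : Param) : ℕ → ℂ → Matrix (Fin 2) (Fin 2) ℂ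
  | 0, lam => !![evalLoop x.a lam, lam⁻¹ * evalLoop x.b lam;
      lam * evalLoop x.c lam, -evalLoop x.a lam]
  | j + 1, lam => (matD m)⁻¹ * matA m x j (-lam) * matD m

/-- The coefficient of `dz` in the potential
`η_t = (0, 0; m r z^(m-1) dz, 0) + t ∑_{j < n} A_j(lam) dz / (z - p_j)`. -/
noncomputable def potential (m : ℕ) (t : ℝ) (x : Param) (lam z : ℂ) :
    Matrix (Fin 2) (Fin 2) ℂ :=
  !![0, 0; (m : ℂ) * x.r * z ^ (m - 1), 0] +
    (t : ℂ) • ∑ j ∈ Finset.range (nSing m), (z - pole m j)⁻¹ • matA m x j lam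

/-! ### Monodromy -/

/-- `X` is the continuation, along the closed curve `γ` (of period 1), of the solution of
`dΦ = Φ η`, `Φ(γ 0) = Id`; here `η z` is the coefficient of `dz`. -/
def IsContinuation (η : ℂ → Matrix (Fin 2) (Fin 2) ℂ) (γ : ℝ → ℂ)
    (X : ℝ → Matrix (Fin 2) (Fin 2) ℂ) : Prop :=
  X 0 = 1 ∧ ∀ (s : ℝ) (i k : Fin 2),
    HasDerivAt (fun u => X u i k) ((deriv γ s • (X s * η (γ s))) i k) s

open Classical in
/-- The monodromy along `γ` of the solution of `dΦ = Φ η`, `Φ(γ 0) = Id`: the value reached after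
continuation once along `γ`. (If `γ` avoids the poles of `η`, the continuation exists and is
unique.) -/
noncomputable def monodromy (η : ℂ → Matrix (Fin 2) (Fin 2) ℂ) (γ : ℝ → ℂ) :
    Matrix (Fin 2) (Fin 2) ℂ :=
  if h : ∃ X, IsContinuation η γ X then h.choose 1 else 0

/-- The loop `γ_j` based at `0`: the circle through `0` with centre `p_j / (2 cos (π / n))`, run
through once counterclockwise. It encloses `p_j` and no other singularity, since `|w - q| < |q|`
holds for `|w| = 1` and `q > 0` exactly when `Re w > 1 / (2 q)`. -/
noncomputable def loopAt (m j : ℕ) (s : ℝ) : ℂ :=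
  pole m j * ((2 * Real.cos (Real.pi / nSing m) : ℝ) : ℂ)⁻¹ * (1 - exp (2 * Real.pi * I * s))

/-- The monodromy `M_j(t)(lam)` of `Φ_t` along `γ_j`. -/
noncomputable def matM (m j : ℕ) (t : ℝ) (x : Param) (lam : ℂ) : Matrix (Fin 2) (Fin 2) ℂ :=
  monodromy (potential m t x lam) (loopAt m j)

/-- The principal logarithm of a matrix near the identity,
`log M = ∑_{k ≥ 1} (-1)^(k-1) (M - Id)^k / k`. -/
noncomputable def matLog (M : Matrix (Fin 2) (Fin 2) ℂ) : Matrix (Fin 2) (Fin 2) ℂ :=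
  ∑' k : ℕ, ((-1 : ℂ) ^ k / ((k : ℂ) + 1)) • (M - 1) ^ (k + 1)

/-- `(1 / t) log M_0(t)`, for `t ≠ 0`. -/
noncomputable def matMtilde (m : ℕ) (t : ℝ) (x : Param) (lam : ℂ) :
    Matrix (Fin 2) (Fin 2) ℂ :=
  (t : ℂ)⁻¹ • matLog (matM m 0 t x lam)

/-! ### The equations determining the parameters

On the unit circle, the involution `f^*(lam) = conj (f (1 / conj lam))` is
complex conjugation of the value. -/

noncomputable def eqF (m : ℕ) (t : ℝ) (x : Param) (lam : ℂ) : ℂ :=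
  (2 * Real.pi * I)⁻¹ *
    (matMtilde m t x lam 0 0 + (starRingEnd ℂ) (matMtilde m t x lam 0 0))

noncomputable def eqG (m : ℕ) (t : ℝ) (x : Param) (lam : ℂ) : ℂ :=
  (2 * Real.pi * I)⁻¹ *
    (matMtilde m t x lam 1 0 + (starRingEnd ℂ) (matMtilde m t x lam 0 1))

noncomputable def eqH (m : ℕ) (t : ℝ) (x : Param) (lam : ℂ) : ℂ :=
  (2 * Real.pi * I)⁻¹ * matMtilde m t x lam 0 1

/-- The constant Fourier coefficient of `-det A_0 = a^2 + b c`. -/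
def eqK (x : Param) : ℝ := x.a 0 ^ 2 + x.b 0 * x.c 0

/-- The system `F = 0`, `G = 0` (as functions on the unit circle), `H_1 = H_2 = 0`, `K = 1`. -/
def SolvesSystem (m : ℕ) (t : ℝ) (x : Param) : Prop :=
  (∀ lam : ℂ, ‖lam‖ = 1 → eqF m t x lam = 0) ∧
  (∀ lam : ℂ, ‖lam‖ = 1 → eqG m t x lam = 0) ∧
  eqH m t x 1 = 0 ∧ eqH m t x (-1) = 0 ∧ eqK x = 1

/-- `diag (exp (2 π i t), exp (-2 π i t))`. -/
noncomputable def diagExp (t : ℝ) : Matrix (Fin 2) (Fin 2) ℂ :=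
  !![exp (2 * Real.pi * I * t), 0; 0, exp (-(2 * Real.pi * I * t))]

end DPW

/-! The theorem follows from the implicit function theorem at `t = 0`, once `(1/t) log M_0(t)` is
known to extend smoothly through `t = 0` with values in a Banach algebra of loops.

Smooth extension. On a disc that contains `γ_0` and no pole besides `p_0 = 1`, write `Φ = Y Φ_0` up
to a constant left factor, where `Φ_0 = (1, 0; r z^m, 1)` solves the equation for `t = 0`. Then `Y'
= t Y (R/(z-1) + h)` with `R = Φ_0(1) A_0 Φ_0(1)⁻¹` and `h` holomorphic. The ansatz `Y = exp(t
log(z-1) R) P`, `P = 1 + (z-1) Q`, leads to the linear equation `Q = t J(QR - RQ + (1 + (z-1)Q) h)`,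
where `J` is radial averaging from `1`. For small `t` it is solved by inverting an operator close to
the identity, so `Q` depends smoothly on `t` and on the parameters (`contDiffAt_gaugeSol`,
`bddHol.hasDerivAt_exp_mul_gauge`). One turn adds `2πi` to the logarithm, whence `M_0 = exp(2πi t
L)` with `L = P(0)⁻¹ R P(0)` (`logMon`, `matM_zero_eq`); thus `(1/t) log M_0 = 2πi L`, and `L = R`
at `t = 0`.

Solving the system. The potential is invariant under simultaneous conjugation of `z`, `λ` and the
values, and conjugation reverses `γ_0`; hence `L` has real Fourier coefficients (`IsSmall.conj_fc`),
and the system becomes an equation between real sequence spaces (`IsSmall.solvesSystem_iff`). At `t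
= 0` it is explicit and polynomial in the parameters. Its linearization at `x_0` is triangular up to
a finite block, hence bijective (`IsLinSys.eq_zero`, `exists_isLinSys`).

Consequences. The first two equations say that the trace-free matrix `L` is Hermitian on the circle,
so `-det L = a² + b c` is real there. A power series that has real coefficients and is real on the
circle is constant, and the last equation makes the constant `1` (`IsSmall.sq_add_mul_eq_one`). At
`λ = ±1` the matrix `L` is then diagonal with entries `±1`, the sign being fixed by closeness to the
value at `x_0` (`IsSmall.matM_zero_eq_diagExp`). The rotation `z ↦ p_1 z`, `λ ↦ -λ` carries this to
the other loops (`matM_of_matM_zero`). -/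

namespace DPW

/-! ### Bounded holomorphic functions with values in a Banach algebra. -/

section BoundedHolomorphic

open BoundedContinuousFunction Metric

variable {E : Type*} [NormedRing E] [NormedAlgebra ℂ E]

/-- The algebra of bounded holomorphic functions on `U`. -/
def bddHol (U : Set ℂ) (E : Type*) [NormedRing E] [NormedAlgebra ℂ E] :
    Subalgebra ℂ (U →ᵇ E) where
  carrier := {f | ∃ g : ℂ → E, DifferentiableOn ℂ g U ∧ ∀ z : U, f z = g z}
  mul_mem' := by
    rintro f₁ f₂ ⟨g₁, h₁, e₁⟩ ⟨g₂, h₂, e₂⟩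
    exact ⟨fun z => g₁ z * g₂ z, h₁.mul h₂, fun z => by simp [e₁, e₂]⟩
  add_mem' := by
    rintro f₁ f₂ ⟨g₁, h₁, e₁⟩ ⟨g₂, h₂, e₂⟩
    exact ⟨fun z => g₁ z + g₂ z, h₁.add h₂, fun z => by simp [e₁, e₂]⟩
  algebraMap_mem' c := ⟨fun _ => algebraMap ℂ E c, differentiableOn_const _, fun _ => rfl⟩

namespace bddHol

variable {U : Set ℂ}

open Classical in
/-- Evaluation at a point of `U` (and zero outside of `U`). -/
noncomputable def fn (f : bddHol U E) (z : ℂ) : E :=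
  if h : z ∈ U then f.1 ⟨z, h⟩ else 0

lemma fn_of_mem (f : bddHol U E) {z : ℂ} (h : z ∈ U) : fn f z = f.1 ⟨z, h⟩ := dif_pos h

lemma fn_add (f g : bddHol U E) (z : ℂ) : fn (f + g) z = fn f z + fn g z := by
  unfold fn; split_ifs <;> simp

lemma fn_sub (f g : bddHol U E) (z : ℂ) : fn (f - g) z = fn f z - fn g z := by
  unfold fn; split_ifs <;> simp

lemma fn_smul (c : ℂ) (f : bddHol U E) (z : ℂ) : fn (c • f) z = c • fn f z := by
  unfold fn; split_ifs <;> simp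

lemma fn_mul (f g : bddHol U E) (z : ℂ) : fn (f * g) z = fn f z * fn g z := by
  unfold fn; split_ifs <;> simp

lemma fn_one {z : ℂ} (h : z ∈ U) : fn (1 : bddHol U E) z = 1 := by
  simp [fn, h]

lemma norm_fn_le (f : bddHol U E) (z : ℂ) : ‖fn f z‖ ≤ ‖f‖ := by
  unfold fn
  split_ifs with h
  · exact f.1.norm_coe_le_norm _
  · simp

lemma ext_fn {f g : bddHol U E} (h : ∀ z ∈ U, fn f z = fn g z) : f = g := by
  ext z
  simpa [fn_of_mem _ z.2] using h z z.2

lemma differentiableOn_fn (f : bddHol U E) : DifferentiableOn ℂ (fn f) U := by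
  obtain ⟨g, hg, e⟩ := f.2
  refine hg.congr fun z hz => ?_
  rw [fn_of_mem f hz, e]

/-- Evaluation as a continuous linear map. -/
noncomputable def evalL (z : ℂ) : bddHol U E →L[ℂ] E :=
  LinearMap.mkContinuous
    { toFun := fun f => fn f z
      map_add' := fun f g => fn_add f g z
      map_smul' := fun c f => fn_smul c f z } 1 (fun f => by simpa using norm_fn_le f z)

/-- A bounded holomorphic function as an element of the algebra. -/
noncomputable def mk (g : ℂ → E) (hg : DifferentiableOn ℂ g U) (C : ℝ)
    (hC : ∀ z ∈ U, ‖g z‖ ≤ C) : bddHol U E :=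
  ⟨BoundedContinuousFunction.ofNormedAddCommGroup (fun z : U => g z)
    (continuousOn_iff_continuous_domRestrict.mp hg.continuousOn) C (fun z => hC z z.2),
    g, hg, fun _ => rfl⟩

lemma fn_mk {g : ℂ → E} {hg : DifferentiableOn ℂ g U} {C : ℝ}
    {hC : ∀ z ∈ U, ‖g z‖ ≤ C} {z : ℂ} (hz : z ∈ U) : fn (mk g hg C hC) z = g z := by
  rw [fn_of_mem _ hz]; rfl

lemma norm_le_of_forall {f : bddHol U E} {C : ℝ} (hC : 0 ≤ C) (h : ∀ z ∈ U, ‖fn f z‖ ≤ C) :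
    ‖f‖ ≤ C :=
  (BoundedContinuousFunction.norm_le hC).mpr fun z => by
    simpa [fn_of_mem _ z.2] using h z z.2

/-- Uniform limits of holomorphic functions are holomorphic. Completeness of the algebra follows,
and with it the smoothness of inversion for operators on it. -/
lemma isClosed [CompleteSpace E] (hU : IsOpen U) :
    IsClosed (bddHol U E : Set (U →ᵇ E)) := by
  classical
  refine isClosed_of_closure_subset fun f hf => ?_
  obtain ⟨u, hu, hlim⟩ := mem_closure_iff_seq_limit.mp hf
  refine ⟨fun z => if h : z ∈ U then f ⟨z, h⟩ else 0, ?_, fun z => by simp⟩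
  refine TendstoLocallyUniformlyOn.differentiableOn (φ := Filter.atTop)
    (F := fun n => fn (⟨u n, hu n⟩ : bddHol U E)) ?_
    (Filter.Eventually.of_forall fun n => differentiableOn_fn _) hU
  refine TendstoUniformlyOn.tendstoLocallyUniformlyOn ?_
  rw [Metric.tendstoUniformlyOn_iff]
  intro ε hε
  filter_upwards [(Metric.tendsto_nhds.mp hlim) ε hε] with n hn z hz
  rw [fn_of_mem _ hz, dif_pos hz, dist_comm]
  exact (BoundedContinuousFunction.dist_coe_le_dist _).trans_lt hn

lemma completeSpace [CompleteSpace E] (hU : IsOpen U) : CompleteSpace (bddHol U E) :=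
  (isClosed hU).completeSpace_coe

/-- The product of a scalar holomorphic function and a constant. -/
noncomputable def smulConst (s : bddHol U ℂ) (e : E) : bddHol U E :=
  mk (fun z => fn s z • e) ((differentiableOn_fn s).smul_const e) (‖s‖ * ‖e‖)
    (fun z _ => (norm_smul_le _ _).trans
      (mul_le_mul_of_nonneg_right (norm_fn_le s z) (norm_nonneg e)))

lemma fn_smulConst (s : bddHol U ℂ) (e : E) {z : ℂ} (hz : z ∈ U) :
    fn (smulConst s e) z = fn s z • e :=
  fn_mk (g := fun z => fn s z • e) hz

/-- Multiplication of constants by a fixed scalar holomorphic function. -/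
noncomputable def scal (s : bddHol U ℂ) : E →L[ℂ] bddHol U E :=
  LinearMap.mkContinuous
    { toFun := smulConst s
      map_add' := fun e₁ e₂ => ext_fn fun z hz => by
        rw [fn_add, fn_smulConst s _ hz, fn_smulConst s _ hz, fn_smulConst s _ hz, smul_add]
      map_smul' := fun c e => ext_fn fun z hz => by
        rw [RingHom.id_apply, fn_smul, fn_smulConst s _ hz, fn_smulConst s _ hz, smul_comm] } ‖s‖
    (fun e => norm_le_of_forall (by positivity) fun z hz => by
      refine (congrArg norm (fn_smulConst s e hz)).trans_le ((norm_smul_le _ _).trans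
          (mul_le_mul_of_nonneg_right (norm_fn_le s z) (norm_nonneg e))))

lemma fn_scal (s : bddHol U ℂ) (e : E) {z : ℂ} (hz : z ∈ U) : fn (scal s e) z = fn s z • e :=
  fn_smulConst s e hz

/-! ### The radial averaging operator on a ball -/

variable {q c : ℂ} {r : ℝ}

lemma segment_mem (hc : c ∈ ball q r) {z : ℂ} (hz : z ∈ ball q r) {s : ℝ}
    (hs : s ∈ Set.Icc (0 : ℝ) 1) : c + (s : ℂ) * (z - c) ∈ ball q r := by
  have := (convex_ball q r).add_smul_sub_mem hc hz hs
  simpa using this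

lemma continuousOn_segment (f : bddHol (ball q r) E) (hc : c ∈ ball q r) {z : ℂ}
    (hz : z ∈ ball q r) :
    ContinuousOn (fun s : ℝ => fn f (c + (s : ℂ) * (z - c))) (Set.uIcc 0 1) := by
  refine (differentiableOn_fn f).continuousOn.comp (by fun_prop) fun s hs => ?_
  rw [Set.uIcc_of_le zero_le_one] at hs
  exact segment_mem hc hz hs

/-- The radial average `∫_0^1 f(c + s (z - c)) ds`. -/
noncomputable def radial (c : ℂ) (f : bddHol (ball q r) E) (z : ℂ) : E :=
  ∫ s in (0 : ℝ)..1, fn f (c + (s : ℂ) * (z - c))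

lemma norm_radial_le (f : bddHol (ball q r) E) (z : ℂ) : ‖radial c f z‖ ≤ ‖f‖ := by
  have := intervalIntegral.norm_integral_le_of_norm_le_const (a := (0 : ℝ)) (b := 1)
    (f := fun s : ℝ => fn f (c + (s : ℂ) * (z - c))) (C := ‖f‖) (fun s _ => norm_fn_le f _)
  simpa [radial] using this

variable [CompleteSpace E]

/-- Integration along the segment from `c` to `z` produces the increment of a primitive, so
questions on radial averages become questions on divided differences. -/
lemma exists_primitive (f : bddHol (ball q r) E) (hc : c ∈ ball q r) :
    ∃ F : ℂ → E, (∀ z ∈ ball q r, HasDerivAt F (fn f z) z) ∧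
      ∀ z ∈ ball q r, (z - c) • radial c f z = F z - F c := by
  obtain ⟨F, hF⟩ := (differentiableOn_fn f).isExactOn_ball
  refine ⟨F, hF, fun z hz => ?_⟩
  have key := intervalIntegral.integral_eq_sub_of_hasDerivAt (a := (0 : ℝ)) (b := 1)
    (f := fun s : ℝ => F (c + (s : ℂ) * (z - c)))
    (f' := fun s : ℝ => (z - c) • fn f (c + (s : ℂ) * (z - c))) ?_ ?_
  · simpa [radial, intervalIntegral.integral_smul] using key
  · intro s hs
    rw [Set.uIcc_of_le zero_le_one] at hs
    have h1 : HasDerivAt (fun s : ℝ => c + (s : ℂ) * (z - c)) (z - c) s := by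
      simpa using ((Complex.ofRealCLM.hasDerivAt (x := s)).mul_const (z - c)).const_add c
    exact (hF _ (segment_mem hc hz hs)).scomp s h1
  · exact ((continuousOn_segment f hc hz).const_smul (z - c)).intervalIntegrable

lemma radial_center (f : bddHol (ball q r) E) : radial c f c = fn f c := by
  simp [radial]

/-- The average is the divided difference at `c` of a primitive; its holomorphy, at `c` included, is
the removable singularity theorem. -/
lemma differentiableOn_radial (f : bddHol (ball q r) E) (hc : c ∈ ball q r) :
    DifferentiableOn ℂ (radial c f) (ball q r) := by
  obtain ⟨F, hF, h⟩ := exists_primitive f hc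
  have hd : DifferentiableOn ℂ (dslope F c) (ball q r) :=
    (Complex.differentiableOn_dslope (isOpen_ball.mem_nhds hc)).mpr
      fun z hz => (hF z hz).differentiableAt.differentiableWithinAt
  refine hd.congr fun z hz => ?_
  rcases eq_or_ne z c with rfl | hne
  · rw [radial_center, dslope_same, (hF z hz).deriv]
  · rw [dslope_of_ne _ hne, slope_def_module, ← h z hz, smul_smul,
      inv_mul_cancel₀ (sub_ne_zero.mpr hne), one_smul]

/-- Radial averaging as a continuous linear operator. -/
noncomputable def radialL (hc : c ∈ ball q r) : bddHol (ball q r) E →L[ℂ] bddHol (ball q r) E :=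
  LinearMap.mkContinuous
    { toFun := fun f => mk (radial c f) (differentiableOn_radial f hc) ‖f‖
        (fun z _ => norm_radial_le f z)
      map_add' := fun f g => ext_fn fun z hz => by
        rw [fn_add, fn_mk hz, fn_mk hz, fn_mk hz, radial, radial, radial,
          ← intervalIntegral.integral_add (continuousOn_segment f hc hz).intervalIntegrable
            (continuousOn_segment g hc hz).intervalIntegrable]
        simp_rw [fn_add]
      map_smul' := fun a f => ext_fn fun z hz => by
        simp only [RingHom.id_apply, fn_smul, fn_mk hz, radial]
        rw [intervalIntegral.integral_smul] } 1
    (fun f => by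
      simpa using norm_le_of_forall (norm_nonneg f) fun z hz => by
        simpa [fn_mk hz] using norm_radial_le f z)

lemma fn_radialL (hc : c ∈ ball q r) (f : bddHol (ball q r) E) {z : ℂ} (hz : z ∈ ball q r) :
    fn (radialL hc f) z = radial c f z :=
  fn_mk (hg := differentiableOn_radial f hc) (hC := fun z _ => norm_radial_le f z) hz

/-- Radial averaging inverts `Q ↦ ((z - c) Q)'`. It turns the differential equation of the gauge
into an equation with a bounded operator. -/
lemma hasDerivAt_sub_smul_radial (hc : c ∈ ball q r) (f : bddHol (ball q r) E) {z : ℂ}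
    (hz : z ∈ ball q r) :
    HasDerivAt (fun w => (w - c) • fn (radialL hc f) w) (fn f z) z := by
  obtain ⟨F, hF, h⟩ := exists_primitive f hc
  refine ((hF z hz).sub_const (F c)).congr_of_eventuallyEq ?_
  filter_upwards [isOpen_ball.mem_nhds hz] with w hw
  rw [fn_radialL hc f hw, h w hw]

end bddHol

end BoundedHolomorphic

end DPW

namespace DPW

/-! ### The gauge equation as a linear equation in a Banach algebra. -/

section GaugeEquation

variable {H : Type*} [NormedRing H] [NormedAlgebra ℂ H]

/-- The linear operator `Q ↦ J (Q R - R Q + s Q h)` as a function of `(R, h)`. -/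
noncomputable def gaugeOp (J : H →L[ℂ] H) (s : H) : (H × H) →L[ℂ] (H →L[ℂ] H) :=
  let M := ContinuousLinearMap.mul ℂ H
  let C := ContinuousLinearMap.compL ℂ H H H
  ((C J).comp (M.flip - M)).coprod ((C J).comp ((C.flip (M s)).comp M.flip))

lemma gaugeOp_apply (J : H →L[ℂ] H) (s : H) (p : H × H) (Q : H) :
    gaugeOp J s p Q = J (Q * p.1 - p.1 * Q + s * Q * p.2) := by
  simp [gaugeOp, map_add, map_sub]

/-- The solution `Q` of `Q = t J (Q R - R Q + (1 + s Q) h)`. -/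
noncomputable def gaugeSol (J : H →L[ℂ] H) (s : H) (p : ℝ × (H × H)) : H :=
  Ring.inverse (1 - (p.1 : ℂ) • gaugeOp J s p.2) ((p.1 : ℂ) • J p.2.2)

lemma gaugeSol_zero (J : H →L[ℂ] H) (s : H) (p : H × H) : gaugeSol J s (0, p) = 0 := by
  simp [gaugeSol]

lemma contDiff_one_sub_gaugeOp (J : H →L[ℂ] H) (s : H) {n : WithTop ℕ∞} :
    ContDiff ℝ n (fun p : ℝ × (H × H) => 1 - (p.1 : ℂ) • gaugeOp J s p.2) := by
  have h1 : ContDiff ℝ n (fun p : ℝ × (H × H) => gaugeOp J s p.2) :=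
    ((gaugeOp J s).restrictScalars ℝ).contDiff.comp contDiff_snd
  have h2 : ContDiff ℝ n (fun p : ℝ × (H × H) => (p.1 : ℂ)) :=
    Complex.ofRealCLM.contDiff.comp contDiff_fst
  exact contDiff_const.sub (h2.smul h1)

lemma one_sub_gaugeOp_zero (J : H →L[ℂ] H) (s : H) (p : H × H) :
    1 - ((0 : ℝ) : ℂ) • gaugeOp J s p = 1 := by
  ext Q
  simp

/-- At `t = 0` the operator to be inverted is the identity, and inversion in a Banach algebra is
smooth at units. -/
lemma contDiffAt_gaugeSol [CompleteSpace H] (J : H →L[ℂ] H) (s : H) {n : WithTop ℕ∞}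
    (p : H × H) : ContDiffAt ℝ n (gaugeSol J s) (0, p) := by
  have h1 : ContDiffAt ℝ n (fun p : ℝ × (H × H) =>
      Ring.inverse (1 - (p.1 : ℂ) • gaugeOp J s p.2)) (0, p) := by
    refine ContDiffAt.comp (g := Ring.inverse) (0, p) ?_ (contDiff_one_sub_gaugeOp J s).contDiffAt
    have : (1 - (((0 : ℝ), p).1 : ℂ) • gaugeOp J s ((0 : ℝ), p).2) =
        ((1 : (H →L[ℂ] H)ˣ) : H →L[ℂ] H) := one_sub_gaugeOp_zero J s p
    rw [this]
    exact contDiffAt_ringInverse ℝ _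
  have h2 : ContDiff ℝ n (fun p : ℝ × (H × H) => (p.1 : ℂ) • J p.2.2) :=
    (Complex.ofRealCLM.contDiff.comp contDiff_fst).smul
      ((J.restrictScalars ℝ).contDiff.comp (contDiff_snd.comp contDiff_snd))
  -- Smoothness is over the reals because `t` is real, so the complex linear inverse is regarded as
  -- a real linear operator before it is applied.
  have h3 : ContDiffAt ℝ n (fun p : ℝ × (H × H) =>
      (Ring.inverse (1 - (p.1 : ℂ) • gaugeOp J s p.2)).restrictScalars ℝ) (0, p) :=
    (ContinuousLinearMap.restrictScalarsL ℂ H H ℝ ℝ).contDiff.contDiffAt.comp _ h1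
  exact h3.clm_apply h2.contDiffAt

lemma eventually_isUnit_gaugeOp [CompleteSpace H] (J : H →L[ℂ] H) (s : H) (p : H × H) :
    ∀ᶠ p' in nhds ((0 : ℝ), p), IsUnit (1 - (p'.1 : ℂ) • gaugeOp J s p'.2) := by
  have hcont := (contDiff_one_sub_gaugeOp J s (n := 0)).continuous.continuousAt
    (x := ((0 : ℝ), p))
  refine hcont.eventually (p := IsUnit) (Units.isOpen.mem_nhds ?_)
  have h := one_sub_gaugeOp_zero J s p
  rw [Set.mem_ofPred_eq]
  exact (congrArg IsUnit h).mpr isUnit_one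

lemma gaugeSol_eq (J : H →L[ℂ] H) (s : H) {p : ℝ × (H × H)}
    (hp : IsUnit (1 - (p.1 : ℂ) • gaugeOp J s p.2)) :
    gaugeSol J s p = (p.1 : ℂ) • J (gaugeSol J s p * p.2.1 - p.2.1 * gaugeSol J s p +
      s * gaugeSol J s p * p.2.2 + p.2.2) := by
  have h : (1 - (p.1 : ℂ) • gaugeOp J s p.2) (gaugeSol J s p) = (p.1 : ℂ) • J p.2.2 := by
    rw [gaugeSol, ← mul_apply_eq_comp, Ring.mul_inverse_cancel _ hp]
    rfl
  rw [_root_.sub_apply, sub_eq_iff_eq_add] at h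
  rw [map_add, smul_add, add_comm, ← gaugeOp_apply]
  exact h

end GaugeEquation

/-! ### The gauge on a ball and the local solution near a simple pole. -/

namespace bddHol

open Metric

variable {E : Type*} [NormedRing E] [NormedAlgebra ℂ E] {q c : ℂ} {r : ℝ}

/-- The function `z ↦ z - c` on a ball. -/
noncomputable def subConst (q c : ℂ) (r : ℝ) (E : Type*) [NormedRing E] [NormedAlgebra ℂ E] :
    bddHol (ball q r) E :=
  mk (fun z => (z - c) • (1 : E)) (by fun_prop) ((r + ‖q - c‖) * ‖(1 : E)‖) fun z hz => by
    refine (norm_smul_le _ _).trans (mul_le_mul_of_nonneg_right ?_ (norm_nonneg _))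
    calc ‖z - c‖ = ‖(z - q) + (q - c)‖ := by ring_nf
      _ ≤ ‖z - q‖ + ‖q - c‖ := norm_add_le _ _
      _ ≤ r + ‖q - c‖ := by
        gcongr
        exact (mem_ball_iff_norm.mp hz).le

lemma fn_subConst {z : ℂ} (hz : z ∈ ball q r) : fn (subConst q c r E) z = (z - c) • (1 : E) :=
  fn_mk (g := fun z => (z - c) • (1 : E)) hz

/-- The gauge `P = 1 + (z - c) Q`. -/
noncomputable def gaugeFn (c : ℂ) (Q : bddHol (ball q r) E) (z : ℂ) : E := 1 + (z - c) • fn Q z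

variable [CompleteSpace E]

/-- The condition that `Q` solves `Q = t J (Q R - R Q + (1 + (z - c) Q) h)` for radial averaging
`J` with centre `c`. -/
def IsGaugeSol (hc : c ∈ ball q r) (t : ℂ) (R : E) (h Q : bddHol (ball q r) E) : Prop :=
  ∃ R' : bddHol (ball q r) E, (∀ z ∈ ball q r, fn R' z = R) ∧
    Q = t • radialL hc (Q * R' - R' * Q + subConst q c r E * Q * h + h)

/-- For `P = 1 + (z - c) Q` one has `PR - RP = (z - c)(QR - RQ)`, so the equation `P' = t ((PR -
RP)/(z - c) + P h)` has no singular term left. -/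
lemma hasDerivAt_gauge {hc : c ∈ ball q r} {t : ℂ} {R : E} {h Q : bddHol (ball q r) E}
    (hQ : IsGaugeSol hc t R h Q) {z : ℂ} (hz : z ∈ ball q r) :
    HasDerivAt (gaugeFn c Q) (t • (fn Q z * R - R * fn Q z + gaugeFn c Q z * fn h z)) z := by
  obtain ⟨R', hR, h1⟩ := hQ
  set f := Q * R' - R' * Q + subConst q c r E * Q * h + h with hf
  have h2 := ((hasDerivAt_sub_smul_radial hc f hz).const_smul t).const_add (1 : E)
  have h3 : (fun w => (1 : E) + t • (w - c) • fn (radialL hc f) w) = gaugeFn c Q := by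
    funext w
    rw [gaugeFn, h1, fn_smul, smul_comm]
  have h4 : fn f z = fn Q z * R - R * fn Q z + gaugeFn c Q z * fn h z := by
    rw [hf, fn_add, fn_add, fn_sub, fn_mul, fn_mul, fn_mul, fn_mul, fn_subConst hz, gaugeFn,
      hR z hz]
    simp only [smul_mul_assoc, one_mul, add_mul]
    abel
  rw [← h4, ← h3]
  exact h2

/-- In the gauge `P`, the equation `Y' = t Y (R / (z - c) + h)` is solved by
`exp (t log (z - c) R) P`. -/
lemma hasDerivAt_exp_mul_gauge {hc : c ∈ ball q r} {t : ℂ} {R : E} {h Q : bddHol (ball q r) E}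
    (hQ : IsGaugeSol hc t R h Q) {γ ℓ : ℝ → ℂ} {γ' : ℂ} {u : ℝ}
    (hγ : HasDerivAt γ γ' u) (hu : γ u ∈ ball q r) (hne : γ u ≠ c)
    (hℓ : HasDerivAt ℓ (γ' / (γ u - c)) u) :
    HasDerivAt (fun v => NormedSpace.exp ((t * ℓ v) • R) * gaugeFn c Q (γ v))
      (γ' • ((NormedSpace.exp ((t * ℓ u) • R) * gaugeFn c Q (γ u)) *
        (t • ((γ u - c)⁻¹ • R + fn h (γ u))))) u := by
  have h1 := (hasDerivAt_exp_smul_const (𝕂 := ℂ) R (t * ℓ u)).scomp u (hℓ.const_mul t)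
  have h2 := (hasDerivAt_gauge hQ hu).scomp u hγ
  have hne' : γ u - c ≠ 0 := sub_ne_zero.mpr hne
  convert! h1.mul h2 using 1
  simp only [Function.comp_apply]
  generalize NormedSpace.exp ((t * ℓ u) • R) = e
  unfold gaugeFn
  generalize fn Q (γ u) = Q
  generalize fn h (γ u) = h
  generalize γ u - c = w at hne'
  have e1 : t * (γ' / w) = γ' * t * w⁻¹ := by field_simp
  have e4 : γ' * t * w⁻¹ * w = γ' * t := by field_simp
  simp only [smul_mul_assoc, mul_smul_comm, mul_add, mul_sub, mul_assoc, smul_add, smul_sub,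
    add_mul, one_mul, mul_one, smul_smul]
  simp only [← mul_assoc, e1, e4]
  have e5 : w * γ' * t * w⁻¹ = γ' * t := by field_simp
  rw [e5]
  abel

end bddHol

end DPW

namespace DPW

/-! ### Bounded operators on absolutely summable families. -/

section WeightedSums

/-- The space of absolutely summable families. -/
abbrev L1 (ι 𝕜 : Type*) [NormedAddCommGroup 𝕜] := lp (fun _ : ι => 𝕜) 1

variable {ι 𝕜 F : Type*} [NontriviallyNormedField 𝕜] [NormedAddCommGroup F] [NormedSpace 𝕜 F]

lemma L1.summable {𝕜 : Type*} [NormedAddCommGroup 𝕜] (f : L1 ι 𝕜) :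
    Summable fun i => ‖f i‖ := by
  simpa using (lp.memℓp f).summable (by simp)

lemma L1.norm_eq {𝕜 : Type*} [NormedAddCommGroup 𝕜] (f : L1 ι 𝕜) : ‖f‖ = ∑' i, ‖f i‖ := by
  rw [lp.norm_eq_tsum_rpow (by simp)]
  simp

/-- An absolutely summable family as an element of `L1`. -/
def L1.mk {𝕜 : Type*} [NormedAddCommGroup 𝕜] (f : ι → 𝕜) (hf : Summable fun i => ‖f i‖) :
    L1 ι 𝕜 :=
  ⟨f, memℓp_gen (by simpa using hf)⟩

@[simp] lemma L1.mk_apply {𝕜 : Type*} [NormedAddCommGroup 𝕜] (f : ι → 𝕜)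
    (hf : Summable fun i => ‖f i‖) (i : ι) : L1.mk f hf i = f i := rfl

lemma summable_wsum [CompleteSpace F] (T : ι → F) {C : ℝ} (hT : ∀ i, ‖T i‖ ≤ C) (f : L1 ι 𝕜) :
    Summable fun i => f i • T i :=
  .of_norm_bounded (g := fun i => ‖f i‖ * C) ((L1.summable f).mul_right C) fun i =>
    (norm_smul_le _ _).trans (mul_le_mul_of_nonneg_left (hT i) (norm_nonneg _))

/-- The map `f ↦ ∑ f i • T i` for a bounded family `T`. -/
noncomputable def wsum [CompleteSpace F] (T : ι → F) (C : ℝ) (hT : ∀ i, ‖T i‖ ≤ C) :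
    L1 ι 𝕜 →L[𝕜] F :=
  LinearMap.mkContinuous
    { toFun := fun f => ∑' i, f i • T i
      map_add' := fun f g => by
        rw [← (summable_wsum T hT f).tsum_add (summable_wsum T hT g)]
        exact tsum_congr fun i => by simp [add_smul]
      map_smul' := fun c f => by
        rw [RingHom.id_apply, ← (summable_wsum T hT f).tsum_const_smul]
        exact tsum_congr fun i => by simp [mul_smul] } C
    (fun f => by
      have h := (L1.summable f).mul_right C
      rw [L1.norm_eq, mul_comm, ← tsum_mul_right]
      exact tsum_of_norm_bounded h.hasSum fun i =>
        (norm_smul_le _ _).trans (mul_le_mul_of_nonneg_left (hT i) (norm_nonneg _)))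

/-- Each family is the norm convergent sum of its coordinate pieces. -/
lemma L1.clm_ext [DecidableEq ι] {A B : L1 ι 𝕜 →L[𝕜] F}
    (h : ∀ i, A (lp.single 1 i 1) = B (lp.single 1 i 1)) : A = B := by
  ext f
  have hs := lp.hasSum_single (p := 1) (by simp) f
  have hi : ∀ i, A (lp.single 1 i (f i)) = B (lp.single 1 i (f i)) := fun i => by
    have : (lp.single 1 i (f i) : L1 ι 𝕜) = f i • lp.single 1 i 1 := by
      rw [← lp.single_smul]; simp
    rw [this, map_smul, map_smul, h]
  have hA := hs.mapL A
  have hB := hs.mapL B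
  simp only [hi] at hA
  exact hA.unique hB

variable [CompleteSpace F]

lemma wsum_apply (T : ι → F) (C : ℝ) (hT : ∀ i, ‖T i‖ ≤ C) (f : L1 ι 𝕜) :
    wsum T C hT f = ∑' i, f i • T i := rfl

lemma norm_wsum_le (T : ι → F) {C : ℝ} (hC : 0 ≤ C) (hT : ∀ i, ‖T i‖ ≤ C) :
    ‖wsum (𝕜 := 𝕜) T C hT‖ ≤ C := by
  unfold wsum
  exact LinearMap.mkContinuous_norm_le _ hC _

lemma hasSum_wsum (T : ι → F) (C : ℝ) (hT : ∀ i, ‖T i‖ ≤ C) (f : L1 ι 𝕜) :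
    HasSum (fun i => f i • T i) (wsum T C hT f) := (summable_wsum T hT f).hasSum

lemma wsum_single [DecidableEq ι] (T : ι → F) (C : ℝ) (hT : ∀ i, ‖T i‖ ≤ C) (i : ι) (c : 𝕜) :
    wsum T C hT (lp.single 1 i c) = c • T i := by
  rw [wsum_apply, tsum_eq_single i]
  · simp
  · intro j hj
    rw [lp.single_apply_ne _ _ _ hj, zero_smul]

end WeightedSums

/-! ### The algebra of Laurent series with weights `ρ^|k|` -/

section LoopAlgebra

variable {ρ : ℝ} [Fact (1 < ρ)]

/-- The weight `ρ^|k|`. -/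
noncomputable def weight (ρ : ℝ) (k : ℤ) : ℝ := ρ ^ k.natAbs

lemma weight_pos (k : ℤ) : 0 < weight ρ k :=
  pow_pos (zero_lt_one.trans (Fact.out : 1 < ρ)) _

lemma one_le_weight (k : ℤ) : 1 ≤ weight ρ k := one_le_pow₀ (Fact.out : 1 < ρ).le

lemma weight_add_le (k j : ℤ) : weight ρ (k + j) ≤ weight ρ k * weight ρ j := by
  unfold weight
  rw [← pow_add]
  exact pow_le_pow_right₀ (Fact.out : 1 < ρ).le (Int.natAbs_add_le k j)

lemma norm_shift_single_le (j k : ℤ) :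
    ‖(lp.single 1 (k + j) ((weight ρ (k + j) / weight ρ k : ℝ) : ℂ) : L1 ℤ ℂ)‖ ≤ weight ρ j := by
  rw [lp.norm_single (by simp), Complex.norm_real, Real.norm_of_nonneg
    (div_nonneg (weight_pos _).le (weight_pos _).le), div_le_iff₀ (weight_pos _), mul_comm]
  exact weight_add_le k j

/-- The weighted shift by `j`. -/
noncomputable def shiftOp (ρ : ℝ) [Fact (1 < ρ)] (j : ℤ) : L1 ℤ ℂ →L[ℂ] L1 ℤ ℂ :=
  wsum (fun k => lp.single 1 (k + j) ((weight ρ (k + j) / weight ρ k : ℝ) : ℂ)) (weight ρ j)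
    (norm_shift_single_le j)

lemma norm_shiftOp_le (j : ℤ) : ‖shiftOp ρ j‖ ≤ weight ρ j :=
  norm_wsum_le _ (weight_pos j).le _

lemma shiftOp_single (j k : ℤ) (c : ℂ) :
    shiftOp ρ j (lp.single 1 k c) =
      lp.single 1 (k + j) (c * ((weight ρ (k + j) / weight ρ k : ℝ) : ℂ)) := by
  rw [shiftOp, wsum_single, ← lp.single_smul]
  rfl

/-- The default value `0` off the unit circle makes evaluation a bounded functional for every `lam`.
-/
lemma norm_evalFun_coeff_le (ρ : ℝ) [Fact (1 < ρ)] (lam : ℂ) (k : ℤ) :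
    ‖if ‖lam‖ = 1 then lam ^ k / (weight ρ k : ℂ) else 0‖ ≤ 1 := by
  split_ifs with h
  · rw [norm_div, norm_zpow, h, _root_.one_zpow, Complex.norm_real,
      Real.norm_of_nonneg (weight_pos _).le]
    exact (div_le_one (weight_pos _)).mpr (one_le_weight _)
  · simp

/-- The evaluation functional `f ↦ ∑ f_k λ^k` for `λ` on the unit circle. -/
noncomputable def evalFun (ρ : ℝ) [Fact (1 < ρ)] (lam : ℂ) : L1 ℤ ℂ →L[ℂ] ℂ :=
  wsum (fun k => if ‖lam‖ = 1 then lam ^ k / (weight ρ k : ℂ) else 0) 1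
    (norm_evalFun_coeff_le ρ lam)

lemma evalFun_single {lam : ℂ} (h : ‖lam‖ = 1) (k : ℤ) (c : ℂ) :
    evalFun ρ lam (lp.single 1 k c) = c * (lam ^ k / (weight ρ k : ℂ)) := by
  rw [evalFun, wsum_single, if_pos h, smul_eq_mul]

/-- The unit of the convolution algebra. -/
noncomputable def deltaZero : L1 ℤ ℂ := lp.single 1 0 1

/-- The operators on `L1` that act through multiplication of functions on the unit circle. -/
noncomputable def loopSubalgebra (ρ : ℝ) [Fact (1 < ρ)] :
    Subalgebra ℂ (L1 ℤ ℂ →L[ℂ] L1 ℤ ℂ) where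
  carrier := {T | ∀ lam : ℂ, ‖lam‖ = 1 → ∀ f,
    evalFun ρ lam (T f) = evalFun ρ lam (T deltaZero) * evalFun ρ lam f}
  mul_mem' := by
    intro S T hS hT lam h f
    simp only [mul_apply_eq_comp]
    rw [hS lam h, hT lam h, hS lam h (T deltaZero), mul_assoc]
  add_mem' := by
    intro S T hS hT lam h f
    simp only [_root_.add_apply, map_add]
    rw [hS lam h f, hT lam h f, add_mul]
  algebraMap_mem' := by
    intro c lam h f
    simp only [Algebra.algebraMap_eq_smul_one, _root_.smul_apply, map_smul,
      one_apply_eq_self, smul_eq_mul]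
    rw [deltaZero, evalFun_single h]
    simp [weight]

/-- The defining relations are equalities of continuous functions of `T`. Realizing Laurent series
as operators supplies an associative product and a submultiplicative norm for free; closedness
supplies completeness. -/
lemma isClosed_loopSubalgebra (ρ : ℝ) [Fact (1 < ρ)] :
    IsClosed (loopSubalgebra ρ : Set (L1 ℤ ℂ →L[ℂ] L1 ℤ ℂ)) := by
  have : (loopSubalgebra ρ : Set (L1 ℤ ℂ →L[ℂ] L1 ℤ ℂ)) =
      ⋂ (lam : ℂ) (_ : ‖lam‖ = 1) (f : L1 ℤ ℂ), {T | evalFun ρ lam (T f) =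
        evalFun ρ lam (T deltaZero) * evalFun ρ lam f} := by
    ext T
    simp [loopSubalgebra]
  rw [this]
  refine isClosed_iInter fun lam => isClosed_iInter fun _ => isClosed_iInter fun f => ?_
  have hc : ∀ g : L1 ℤ ℂ, Continuous fun T : L1 ℤ ℂ →L[ℂ] L1 ℤ ℂ => evalFun ρ lam (T g) :=
    fun g => (evalFun ρ lam).continuous.comp (ContinuousLinearMap.apply ℂ (L1 ℤ ℂ) g).continuous
  exact isClosed_eq (hc f) ((hc deltaZero).mul continuous_const)

/-- The Banach algebra of Laurent series with weights `ρ^|k|`, as an algebra of operators. -/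
def LoopAlg (ρ : ℝ) [Fact (1 < ρ)] : Type := loopSubalgebra ρ

namespace LoopAlg

noncomputable instance : NormedRing (LoopAlg ρ) := inferInstanceAs (NormedRing (loopSubalgebra ρ))

noncomputable instance : NormedAlgebra ℂ (LoopAlg ρ) :=
  inferInstanceAs (NormedAlgebra ℂ (loopSubalgebra ρ))

instance : CompleteSpace (LoopAlg ρ) := (isClosed_loopSubalgebra ρ).completeSpace_coe

/-- The inclusion into the bounded operators. -/
noncomputable def toOp : LoopAlg ρ →L[ℂ] (L1 ℤ ℂ →L[ℂ] L1 ℤ ℂ) :=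
  LinearMap.mkContinuous
    { toFun := fun T => T.1
      map_add' := fun _ _ => rfl
      map_smul' := fun _ _ => rfl } 1 (fun T => (one_mul ‖T‖).ge)

/-- The weighted Fourier coefficients. -/
noncomputable def coeff : LoopAlg ρ →L[ℂ] L1 ℤ ℂ :=
  (ContinuousLinearMap.apply ℂ (L1 ℤ ℂ) deltaZero).comp toOp

/-- The Fourier coefficient of index `k`. -/
noncomputable def fc (T : LoopAlg ρ) (k : ℤ) : ℂ := coeff T k / (weight ρ k : ℂ)

/-- Evaluation at a point of the unit circle. -/
noncomputable def ev (lam : ℂ) : LoopAlg ρ →L[ℂ] ℂ := (evalFun ρ lam).comp coeff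

lemma ev_mul {lam : ℂ} (h : ‖lam‖ = 1) (S T : LoopAlg ρ) : ev lam (S * T) = ev lam S * ev lam T :=
  S.2 lam h (toOp T deltaZero)

lemma ev_one {lam : ℂ} (h : ‖lam‖ = 1) : ev lam (1 : LoopAlg ρ) = 1 := by
  change evalFun ρ lam deltaZero = 1
  rw [deltaZero, evalFun_single h]
  simp [weight]

lemma summable_fc (T : LoopAlg ρ) : Summable fun k => ‖fc T k‖ := by
  refine .of_nonneg_of_le (fun _ => norm_nonneg _) (fun k => ?_) (L1.summable (coeff T))
  rw [fc, norm_div, Complex.norm_real, Real.norm_of_nonneg (weight_pos _).le]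
  exact div_le_self (norm_nonneg _) (one_le_weight k)

lemma hasSum_ev {lam : ℂ} (h : ‖lam‖ = 1) (T : LoopAlg ρ) :
    HasSum (fun k => fc T k * lam ^ k) (ev lam T) := by
  have := hasSum_wsum (𝕜 := ℂ) _ 1 (norm_evalFun_coeff_le ρ lam) (coeff T)
  convert! this using 2 with k
  rw [if_pos h, fc, smul_eq_mul]
  ring

/-- The function `λ^j`. -/
noncomputable def shift (ρ : ℝ) [Fact (1 < ρ)] (j : ℤ) : LoopAlg ρ :=
  ⟨shiftOp ρ j, fun lam h f => by
    have hlam : lam ≠ 0 := norm_ne_zero_iff.mp (by rw [h]; exact one_ne_zero)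
    have key : (evalFun ρ lam).comp (shiftOp ρ j) = lam ^ j • evalFun ρ lam := by
      refine L1.clm_ext fun k => ?_
      have h1 : (weight ρ k : ℂ) ≠ 0 := by exact_mod_cast (weight_pos k).ne'
      have h2 : (weight ρ (k + j) : ℂ) ≠ 0 := by exact_mod_cast (weight_pos (k + j)).ne'
      simp only [ContinuousLinearMap.comp_apply, shiftOp_single, evalFun_single h,
        _root_.smul_apply, smul_eq_mul, zpow_add₀ hlam]
      push_cast
      field_simp
    have h3 : ∀ g, evalFun ρ lam (shiftOp ρ j g) = lam ^ j * evalFun ρ lam g := fun g =>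
      DFunLike.congr_fun key g
    rw [h3, h3, deltaZero, evalFun_single h]
    simp [weight]⟩

lemma coeff_shift (j : ℤ) : coeff (shift ρ j) = lp.single 1 j (weight ρ j : ℂ) := by
  change shiftOp ρ j (lp.single 1 0 1) = _
  rw [shiftOp_single]
  simp [weight]

lemma fc_shift (j k : ℤ) : fc (shift ρ j) k = if k = j then 1 else 0 := by
  have h1 : (weight ρ k : ℂ) ≠ 0 := by exact_mod_cast (weight_pos k).ne'
  rw [fc, coeff_shift]
  split_ifs with h
  · subst h
    rw [lp.single_apply_self, div_self h1]
  · rw [lp.single_apply_ne _ _ _ h, zero_div]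

lemma ev_shift {lam : ℂ} (h : ‖lam‖ = 1) (j : ℤ) : ev lam (shift ρ j) = lam ^ j := by
  have h2 : (weight ρ j : ℂ) ≠ 0 := by exact_mod_cast (weight_pos j).ne'
  change evalFun ρ lam (coeff (shift ρ j)) = _
  rw [coeff_shift, evalFun_single h]
  field_simp

lemma norm_shift_le (j : ℤ) : ‖shift ρ j‖ ≤ weight ρ j :=
  norm_shiftOp_le j

lemma shiftOp_apply (j : ℤ) (f : L1 ℤ ℂ) (k : ℤ) :
    shiftOp ρ j f k = f (k - j) * ((weight ρ k / weight ρ (k - j) : ℝ) : ℂ) := by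
  let e : L1 ℤ ℂ →L[ℂ] ℂ := lp.evalCLM ℂ (fun _ : ℤ => ℂ) 1 k
  let e' : L1 ℤ ℂ →L[ℂ] ℂ := lp.evalCLM ℂ (fun _ : ℤ => ℂ) 1 (k - j)
  have : e.comp (shiftOp ρ j) = ((weight ρ k / weight ρ (k - j) : ℝ) : ℂ) • e' := by
    refine L1.clm_ext fun i => ?_
    simp only [ContinuousLinearMap.comp_apply, shiftOp_single, _root_.smul_apply]
    change (lp.single 1 (i + j) _ : L1 ℤ ℂ) k = _ • (lp.single 1 i 1 : L1 ℤ ℂ) (k - j)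
    by_cases hk : k = i + j
    · subst hk
      simp
    · rw [lp.single_apply_ne _ _ _ hk, lp.single_apply_ne _ _ _ (fun h => hk (by omega)), smul_zero]
  have h2 := DFunLike.congr_fun this f
  rw [mul_comm]
  exact h2

lemma fc_shift_mul (j : ℤ) (T : LoopAlg ρ) (k : ℤ) : fc (shift ρ j * T) k = fc T (k - j) := by
  have h1 : (weight ρ k : ℂ) ≠ 0 := by exact_mod_cast (weight_pos k).ne'
  have h2 : (weight ρ (k - j) : ℂ) ≠ 0 := by exact_mod_cast (weight_pos (k - j)).ne'
  have : coeff (shift ρ j * T) = shiftOp ρ j (coeff T) := rfl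
  rw [fc, fc, this, shiftOp_apply]
  push_cast
  field_simp

/-- The Fourier coefficient as a continuous linear functional. -/
noncomputable def fcL (k : ℤ) : LoopAlg ρ →L[ℂ] ℂ :=
  (weight ρ k : ℂ)⁻¹ • (lp.evalCLM ℂ (fun _ : ℤ => ℂ) 1 k).comp coeff

lemma fcL_apply (k : ℤ) (T : LoopAlg ρ) : fcL k T = fc T k := by
  rw [fc, div_eq_inv_mul]; rfl

lemma norm_ofSeq_coeff_le (ρ : ℝ) [Fact (1 < ρ)] (ε : ℤˣ) (k : ℕ) :
    ‖(((ε : ℤ) : ℝ) ^ k * (ρ ^ k)⁻¹ : ℝ) • shift ρ k‖ ≤ 1 := by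
  have hρ : 0 < ρ ^ k := pow_pos (zero_lt_one.trans (Fact.out : 1 < ρ)) _
  have hε : |((ε : ℤ) : ℝ)| = 1 := by
    rcases Int.units_eq_one_or ε with rfl | rfl <;> simp
  refine (norm_smul_le _ _).trans ?_
  rw [norm_mul, norm_pow, Real.norm_eq_abs, hε, one_pow, one_mul, norm_inv,
    Real.norm_of_nonneg hρ.le, inv_mul_le_iff₀ hρ, mul_one]
  simpa [weight] using norm_shift_le (ρ := ρ) (k : ℤ)

/-- The power series `∑ v_k ρ^(-k) (ε λ)^k`, where `ε = ±1`. -/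
noncomputable def ofSeq (ε : ℤˣ) : L1 ℕ ℝ →L[ℝ] LoopAlg ρ :=
  wsum (fun k => (((ε : ℤ) : ℝ) ^ k * (ρ ^ k)⁻¹ : ℝ) • shift ρ k) 1 (norm_ofSeq_coeff_le ρ ε)

/-- The functional `L` is left arbitrary so that values and Fourier coefficients both come out of
the same series. -/
lemma hasSum_ofSeq (ε : ℤˣ) (v : L1 ℕ ℝ) (L : LoopAlg ρ →L[ℂ] ℂ) :
    HasSum (fun k : ℕ => ((v k / ρ ^ k : ℝ) : ℂ) * (((ε : ℤ) : ℂ) ^ k * L (shift ρ k)))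
      (L (ofSeq ε v)) := by
  have h := (hasSum_wsum (𝕜 := ℝ) _ 1 (norm_ofSeq_coeff_le ρ ε) v).mapL (L.restrictScalars ℝ)
  convert! h using 2 with k
  rw [map_smul, map_smul]
  simp only [ContinuousLinearMap.coe_restrictScalars', Complex.real_smul]
  push_cast
  ring

lemma ev_ofSeq {lam : ℂ} (h : ‖lam‖ = 1) (ε : ℤˣ) (v : L1 ℕ ℝ) :
    ev lam (ofSeq (ρ := ρ) ε v) = evalLoop (fun k => v k / ρ ^ k) (((ε : ℤ) : ℂ) * lam) := by
  rw [← (hasSum_ofSeq ε v (ev lam)).tsum_eq, evalLoop]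
  refine tsum_congr fun k => ?_
  rw [ev_shift h, zpow_natCast, mul_pow]

lemma fc_ofSeq (v : L1 ℕ ℝ) (k : ℤ) :
    fc (ofSeq (ρ := ρ) 1 v) k = if 0 ≤ k then ((v k.toNat / ρ ^ k.toNat : ℝ) : ℂ) else 0 := by
  rw [← fcL_apply, ← (hasSum_ofSeq 1 v (fcL k)).tsum_eq]
  simp only [fcL_apply, fc_shift, Units.val_one, Int.cast_one, one_pow, one_mul]
  split_ifs with h
  · obtain ⟨n, rfl⟩ := Int.eq_ofNat_of_zero_le h
    rw [tsum_eq_single n]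
    · simp
    · intro j hj
      rw [if_neg (by exact_mod_cast hj.symm), mul_zero]
  · refine (tsum_congr fun j => ?_).trans tsum_zero
    rw [if_neg (by omega), mul_zero]

end LoopAlg

end LoopAlgebra

end DPW

namespace DPW

/-! ### The logarithm series of a `2 × 2` matrix. -/

section MatrixLog

open scoped Matrix.Norms.Operator

/-- The bound serves twice: `|e^l - 1| ≤ 2|l| < 1` gives convergence, and `|Im l| < π` gives `log
e^l = l`. -/
lemma hasSum_log_exp {l : ℂ} (hl : ‖l‖ < 1 / 2) :
    HasSum (fun k : ℕ => (-1 : ℂ) ^ k / ((k : ℂ) + 1) * (Complex.exp l - 1) ^ (k + 1)) l := by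
  have h1 : ‖Complex.exp l - 1‖ < 1 := by
    have := Complex.norm_exp_sub_one_le (x := l) (by linarith)
    linarith
  have h2 := Complex.hasSum_taylorSeries_log h1
  rw [add_sub_cancel, Complex.log_exp, ← hasSum_nat_add_iff' 1] at h2
  · simp only [Finset.range_one, Finset.sum_singleton, Nat.cast_zero, div_zero, sub_zero] at h2
    convert! h2 using 2 with k
    push_cast
    ring
  · have := (Complex.abs_im_le_norm l).trans_lt hl
    rw [abs_lt] at this
    linarith [Real.pi_gt_three]
  · have := (Complex.abs_im_le_norm l).trans_lt hl
    rw [abs_lt] at this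
    linarith [Real.pi_gt_three]

/-- The logarithm series inverts the exponential on matrices with small scalar square. -/
lemma matLog_exp {Y : Matrix (Fin 2) (Fin 2) ℂ} {w : ℂ} (hY : Y * Y = w • 1)
    (hw : ‖w‖ < 1 / 4) : matLog (NormedSpace.exp Y) = Y := by
  have hexp : HasSum (fun n : ℕ => ((n.factorial : ℂ)⁻¹) • Y ^ n) (NormedSpace.exp Y) :=
    NormedSpace.exp_series_hasSum_exp' (𝕂 := ℂ) Y
  -- If `Y² = 0`, both series stop after the linear term. Otherwise `Y = l p - l m` with
  -- complementary projections `p`, `m` and `l² = w`, and the scalar identity is applied to `l` and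
  -- to `-l`.
  rcases eq_or_ne w 0 with rfl | hw0
  · rw [zero_smul] at hY
    have hz : ∀ n, Y ^ (n + 2) = 0 := fun n => by rw [pow_add, pow_two, hY, mul_zero]
    have h1 : NormedSpace.exp Y = 1 + Y := by
      refine hexp.unique ?_
      have := hasSum_sum_of_ne_finset_zero (L := SummationFilter.unconditional ℕ)
        (f := fun n : ℕ => ((n.factorial : ℂ)⁻¹) • Y ^ n)
        (s := Finset.range 2) (fun n hn => by
          obtain ⟨k, rfl⟩ : ∃ k, n = k + 2 := ⟨n - 2, by simp at hn; omega⟩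
          simp only [hz, smul_zero])
      simpa [Finset.sum_range_succ] using this
    rw [matLog, tsum_eq_single 0]
    · simp [h1]
    · intro k hk
      obtain ⟨j, rfl⟩ := Nat.exists_eq_succ_of_ne_zero hk
      rw [h1, add_sub_cancel_left, hz j, smul_zero]
  · obtain ⟨l, hl⟩ := IsAlgClosed.exists_pow_nat_eq w (n := 2) (by norm_num)
    have hl0 : l ≠ 0 := by rintro rfl; exact hw0 (by simpa using hl.symm)
    have hln : ‖l‖ < 1 / 2 := by
      rw [← hl, norm_pow] at hw
      nlinarith [norm_nonneg l]
    obtain ⟨p, hp⟩ : ∃ p : Matrix (Fin 2) (Fin 2) ℂ, p = (1 / 2 : ℂ) • (1 + l⁻¹ • Y) := ⟨_, rfl⟩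
    obtain ⟨m, hm⟩ : ∃ m : Matrix (Fin 2) (Fin 2) ℂ, m = (1 / 2 : ℂ) • (1 - l⁻¹ • Y) := ⟨_, rfl⟩
    have hll : l⁻¹ * l⁻¹ * w = 1 := by rw [← hl]; field_simp
    have hYY : (l⁻¹ • Y) * (l⁻¹ • Y) = 1 := by
      rw [smul_mul_assoc, mul_smul_comm, hY, smul_smul, smul_smul, hll, one_smul]
    have hadd : p + m = 1 := by rw [hp, hm]; module
    have hpp : p * p = p := by
      rw [hp, smul_mul_assoc, mul_smul_comm, add_mul, mul_add, mul_add, hYY]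
      simp only [mul_one, one_mul]; module
    have hmm : m * m = m := by
      rw [hm, smul_mul_assoc, mul_smul_comm, sub_mul, mul_sub, mul_sub, hYY]
      simp only [mul_one, one_mul]; module
    have hpm : p * m = 0 := by
      rw [hp, hm, smul_mul_assoc, mul_smul_comm, add_mul, mul_sub, mul_sub, hYY]
      simp only [mul_one, one_mul]; module
    have hmp : m * p = 0 := by
      rw [hp, hm, smul_mul_assoc, mul_smul_comm, sub_mul, mul_add, mul_add, hYY]
      simp only [mul_one, one_mul]; module
    have hYd : Y = l • p + (-l) • m := by
      rw [hp, hm]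
      simp only [smul_add, smul_sub, smul_smul]
      have e : l * (1 / 2 * l⁻¹) = 1 / 2 := by field_simp
      have e' : -l * (1 / 2 * l⁻¹) = -(1 / 2) := by field_simp
      rw [e, e']; module
    have hpow : ∀ (a b : ℂ) (n : ℕ), (a • p + b • m) ^ n = a ^ n • p + b ^ n • m := by
      intro a b n
      induction n with
      | zero => simp [hadd]
      | succ n ih =>
        rw [pow_succ, ih, add_mul, mul_add, mul_add]
        simp only [smul_mul_assoc, mul_smul_comm, hpp, hmm, hpm, hmp, smul_zero, add_zero,
          zero_add, smul_smul, ← pow_succ']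
    have hE : NormedSpace.exp Y = Complex.exp l • p + Complex.exp (-l) • m := by
      refine hexp.unique ?_
      have hc : ∀ a : ℂ, HasSum (fun n : ℕ => ((n.factorial : ℂ)⁻¹) * a ^ n) (Complex.exp a) :=
        fun a => by
          rw [Complex.exp_eq_exp_ℂ]
          simpa using NormedSpace.exp_series_hasSum_exp' (𝕂 := ℂ) a
      have h := ((hc l).smul_const p).add ((hc (-l)).smul_const m)
      convert! h using 2 with n
      rw [hYd, hpow, smul_add, smul_smul, smul_smul]
    have hE1 : NormedSpace.exp Y - 1 = (Complex.exp l - 1) • p + (Complex.exp (-l) - 1) • m := by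
      rw [hE, ← hadd]; module
    have h := ((hasSum_log_exp hln).smul_const p).add
      ((hasSum_log_exp (l := -l) (by simpa using hln)).smul_const m)
    rw [← hYd] at h
    rw [matLog]
    refine (HasSum.tsum_eq ?_)
    convert! h using 2 with k
    rw [hE1, hpow, smul_add, smul_smul, smul_smul]

end MatrixLog

/-! ### Uniqueness of Fourier coefficients. -/

section FourierUniqueness

/-- An absolutely convergent Laurent series that vanishes on the unit circle is zero. -/
lemma eq_zero_of_forall_hasSum_circle {f : ℤ → ℂ} (hf : Summable fun k => ‖f k‖)
    (h : ∀ lam : ℂ, ‖lam‖ = 1 → HasSum (fun k => f k * lam ^ k) 0) (n : ℤ) : f n = 0 := by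
  have : Fact (0 < 2 * Real.pi) := ⟨Real.two_pi_pos⟩
  have hs : Summable fun k : ℤ => f k • fourier (T := 2 * Real.pi) k := by
    refine .of_norm ?_
    simpa [norm_smul, fourier_norm] using hf
  have h0 : ∑' k : ℤ, f k • fourier (T := 2 * Real.pi) k = 0 := by
    ext x
    have h1 := hs.hasSum.mapL (ContinuousMap.evalCLM ℂ x)
    have h2 := h (fourier 1 x) (by rw [fourier_one]; exact Circle.norm_coe _)
    refine h1.unique ?_
    convert! h2 using 2 with k
    simp [fourier_apply, AddCircle.toCircle_zsmul]
  -- In `L²` the monomials are orthonormal, so the inner product with the `n`-th one isolates `f n`.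
  have h3 := hs.hasSum.mapL (ContinuousMap.toLp (E := ℂ) 2 (AddCircle.haarAddCircle (T := 2 * Real.pi)) ℂ)
  rw [h0, map_zero] at h3
  have h4 := h3.mapL (innerSL ℂ (fourierLp (T := 2 * Real.pi) 2 n))
  rw [map_zero] at h4
  have ho := orthonormal_iff_ite.mp (orthonormal_fourier (T := 2 * Real.pi))
  have h5 : HasSum (fun k : ℤ => if n = k then f k else 0) 0 := by
    convert! h4 using 2 with k
    rw [map_smul, map_smul]
    change _ = f k • inner ℂ (fourierLp 2 n) (fourierLp 2 k)
    rw [ho n k]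
    simp
  have h6 := hasSum_ite_eq n (f n)
  have h7 : (fun k : ℤ => if n = k then f k else 0) = fun k => if k = n then f n else 0 := by
    funext k
    by_cases hk : k = n
    · subst hk; simp
    · rw [if_neg hk, if_neg (Ne.symm hk)]
  rw [h7] at h5
  exact h6.unique h5

end FourierUniqueness

end DPW

namespace DPW

/-! ### The loop around `1`, its distance to the other poles, and a logarithm along it. -/

section Geometry

/-- The radius of the loops. -/
noncomputable def loopRadius (m : ℕ) : ℝ := (2 * Real.cos (Real.pi / nSing m))⁻¹

lemma nSing_pos (m : ℕ) : (0 : ℝ) < nSing m := by simp [nSing]; positivity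

lemma four_le_nSing {m : ℕ} (hm : 1 ≤ m) : (4 : ℝ) ≤ nSing m := by
  have : 4 ≤ nSing m := by unfold nSing; omega
  exact_mod_cast this

lemma cos_pi_div_bounds {m : ℕ} (hm : 1 ≤ m) :
    1 / 2 < Real.cos (Real.pi / nSing m) ∧ Real.cos (Real.pi / nSing m) < 1 := by
  have h4 := four_le_nSing hm
  have hpos : 0 < Real.pi / nSing m := div_pos Real.pi_pos (nSing_pos m)
  have hle : Real.pi / nSing m ≤ Real.pi / 4 :=
    div_le_div_of_nonneg_left Real.pi_pos.le (by norm_num) h4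
  constructor
  · rw [← Real.cos_pi_div_three]
    exact Real.cos_lt_cos_of_nonneg_of_le_pi hpos.le (by linarith [Real.pi_pos])
      (by linarith [Real.pi_pos])
  · rw [← Real.cos_zero]
    exact Real.cos_lt_cos_of_nonneg_of_le_pi le_rfl (by linarith [Real.pi_pos]) hpos

lemma loopRadius_bounds {m : ℕ} (hm : 1 ≤ m) : 1 / 2 < loopRadius m ∧ loopRadius m < 1 := by
  obtain ⟨h1, h2⟩ := cos_pi_div_bounds hm
  unfold loopRadius
  constructor
  · rw [lt_inv_comm₀ (by norm_num) (by linarith)]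
    linarith
  · exact inv_lt_one_of_one_lt₀ (by linarith)

lemma pole_zero (m : ℕ) : pole m 0 = 1 := by simp [pole]

lemma pole_eq (m j : ℕ) : pole m j = pole m 1 ^ j := by
  unfold pole
  rw [← Complex.exp_nat_mul]
  congr 1
  push_cast
  ring

lemma pole_succ (m j : ℕ) : pole m (j + 1) = pole m 1 * pole m j := by
  rw [pole_eq m (j + 1), pole_eq m j, pow_succ']

lemma pole_ne_zero (m j : ℕ) : pole m j ≠ 0 := Complex.exp_ne_zero _

lemma pole_nSing (m : ℕ) : pole m (nSing m) = 1 := by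
  unfold pole
  have : (nSing m : ℂ) ≠ 0 := by exact_mod_cast (nSing_pos m).ne'
  rw [mul_div_assoc, div_self this, mul_one, Complex.exp_two_pi_mul_I]

/-- The angle `2πj/n` lies strictly between `π/n` and `2π - π/n`; after reflection at `π` the
monotonicity of the cosine applies. -/
lemma cos_angle_lt {m : ℕ} (hm : 1 ≤ m) {j : ℕ} (h0 : 0 < j) (hj : j < nSing m) :
    Real.cos (2 * Real.pi * j / nSing m) < Real.cos (Real.pi / nSing m) := by
  have hn := nSing_pos m
  have h4 := four_le_nSing hm
  have hpi := Real.pi_pos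
  have h1 : (1 : ℝ) ≤ j := by exact_mod_cast h0
  have h2 : (j : ℝ) + 1 ≤ nSing m := by exact_mod_cast hj
  have hlow : Real.pi / nSing m < 2 * Real.pi * j / nSing m :=
    div_lt_div_of_pos_right (by nlinarith) hn
  have hup : 2 * Real.pi * j / nSing m < 2 * Real.pi - Real.pi / nSing m := by
    rw [lt_sub_iff_add_lt, ← add_div, div_lt_iff₀ hn]
    nlinarith
  have hpos : 0 < Real.pi / nSing m := div_pos hpi hn
  rcases le_total (2 * Real.pi * j / nSing m) Real.pi with h | h
  · exact Real.cos_lt_cos_of_nonneg_of_le_pi hpos.le h hlow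
  · rw [← Real.cos_two_pi_sub]
    exact Real.cos_lt_cos_of_nonneg_of_le_pi hpos.le (by linarith) (by linarith)

/-- With `q` the radius, `|e^{iθ} - q|² - q² = 1 - 2q cos θ`, which is positive exactly when `cos θ
< 1/(2q) = cos(π/n)`. -/
lemma loopRadius_lt_norm_pole_sub {m : ℕ} (hm : 1 ≤ m) {j : ℕ} (h0 : 0 < j) (hj : j < nSing m) :
    loopRadius m < ‖pole m j - (loopRadius m : ℂ)‖ := by
  obtain ⟨h1, -⟩ := loopRadius_bounds hm
  obtain ⟨h3, -⟩ := cos_pi_div_bounds hm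
  have hlt := cos_angle_lt hm h0 hj
  have hp : pole m j = Complex.exp ((2 * Real.pi * j / nSing m : ℝ) * I) := by
    unfold pole
    congr 1
    push_cast
    ring
  have hq : loopRadius m * (2 * Real.cos (Real.pi / nSing m)) = 1 := by
    unfold loopRadius
    exact inv_mul_cancel₀ (by linarith)
  refine lt_of_pow_lt_pow_left₀ 2 (norm_nonneg _) ?_
  rw [Complex.sq_norm, Complex.normSq_apply, hp]
  simp only [Complex.sub_re, Complex.sub_im, Complex.exp_ofReal_mul_I_re,
    Complex.exp_ofReal_mul_I_im, Complex.ofReal_re, Complex.ofReal_im]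
  generalize 2 * Real.pi * j / nSing m = θ at *
  have := Real.sin_sq_add_cos_sq θ
  nlinarith

/-- The loop around `1` stays in a disc that keeps a positive distance to the other poles. -/
lemma exists_disc {m : ℕ} (hm : 1 ≤ m) : ∃ r d : ℝ, loopRadius m < r ∧ 0 < d ∧
    ∀ j : ℕ, 0 < j → j < nSing m → r + d ≤ ‖pole m j - (loopRadius m : ℂ)‖ := by
  obtain ⟨s, hs, h⟩ : ∃ s, loopRadius m < s ∧
      ∀ j ∈ Finset.Ico 1 (nSing m), s ≤ ‖pole m j - (loopRadius m : ℂ)‖ := by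
    have hne : (Finset.Ico 1 (nSing m)).Nonempty := ⟨1, by simp [nSing]⟩
    obtain ⟨j, hj, hmin⟩ := Finset.exists_min_image _
      (fun j => ‖pole m j - (loopRadius m : ℂ)‖) hne
    rw [Finset.mem_Ico] at hj
    exact ⟨_, loopRadius_lt_norm_pole_sub hm hj.1 hj.2, hmin⟩
  refine ⟨(loopRadius m + s) / 2, (s - loopRadius m) / 2, by linarith, by linarith,
    fun j h0 hj => ?_⟩
  have := h j (Finset.mem_Ico.mpr ⟨h0, hj⟩)
  linarith

lemma loopAt_zero (m : ℕ) (s : ℝ) :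
    loopAt m 0 s = (loopRadius m : ℂ) * (1 - Complex.exp (2 * Real.pi * I * s)) := by
  rw [loopAt, pole_zero, one_mul, loopRadius, Complex.ofReal_inv]

lemma norm_exp_circle (s : ℝ) : ‖Complex.exp (2 * Real.pi * I * s)‖ = 1 := by
  have : (2 * Real.pi * I * s : ℂ) = ((2 * Real.pi * s : ℝ) : ℂ) * I := by push_cast; ring
  rw [this, Complex.norm_exp_ofReal_mul_I]

lemma norm_loopAt_sub {m : ℕ} (hm : 1 ≤ m) (s : ℝ) :
    ‖loopAt m 0 s - (loopRadius m : ℂ)‖ = loopRadius m := by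
  obtain ⟨h1, -⟩ := loopRadius_bounds hm
  have : loopAt m 0 s - (loopRadius m : ℂ) =
      -((loopRadius m : ℂ) * Complex.exp (2 * Real.pi * I * s)) := by
    rw [loopAt_zero]; ring
  rw [this, norm_neg, norm_mul, norm_exp_circle, mul_one, Complex.norm_real,
    Real.norm_of_nonneg (by linarith)]

lemma hasDerivAt_exp_circle (s : ℝ) : HasDerivAt (fun s : ℝ => Complex.exp (2 * Real.pi * I * s))
    (2 * Real.pi * I * Complex.exp (2 * Real.pi * I * s)) s := by
  have h := (((Complex.ofRealCLM.hasDerivAt (x := s)).const_mul (2 * Real.pi * I : ℂ))).cexp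
  convert! h using 1
  simp [mul_comm]

lemma hasDerivAt_loopAt (m j : ℕ) (s : ℝ) :
    HasDerivAt (loopAt m j) (pole m j * ((2 * Real.cos (Real.pi / nSing m) : ℝ) : ℂ)⁻¹ *
      (-(2 * Real.pi * I * Complex.exp (2 * Real.pi * I * s)))) s :=
  ((hasDerivAt_exp_circle s).const_sub 1).const_mul _

lemma loopAt_ne_one {m : ℕ} (hm : 1 ≤ m) (s : ℝ) : loopAt m 0 s ≠ 1 := by
  intro h
  obtain ⟨h1, h2⟩ := loopRadius_bounds hm
  have h3 := norm_loopAt_sub hm s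
  rw [h, ← Complex.ofReal_one, ← Complex.ofReal_sub, Complex.norm_real,
    Real.norm_of_nonneg (by linarith)] at h3
  linarith

/-- The parameter `1 - 1 / q` of the loop. -/
noncomputable def loopKappa (m : ℕ) : ℝ := 1 - (loopRadius m)⁻¹

lemma abs_loopKappa_lt {m : ℕ} (hm : 1 ≤ m) : |loopKappa m| < 1 := by
  obtain ⟨h1, h2⟩ := loopRadius_bounds hm
  have h3 : 1 < (loopRadius m)⁻¹ := (one_lt_inv₀ (by linarith)).mpr h2
  have h4 : (loopRadius m)⁻¹ < 2 := by
    rw [inv_lt_comm₀ (by linarith) (by norm_num)]; linarith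
  unfold loopKappa
  rw [abs_lt]
  constructor <;> linarith

/-- A continuous branch of `log (z - 1)` along the loop around `1`, normalized at `0`. -/
noncomputable def loopLog (m : ℕ) (s : ℝ) : ℂ :=
  2 * Real.pi * I * s + Complex.log (1 - loopKappa m * (Complex.exp (2 * Real.pi * I * s))⁻¹) -
    Complex.log (1 - loopKappa m)

lemma loopLog_zero (m : ℕ) : loopLog m 0 = 0 := by simp [loopLog]

lemma loopLog_one (m : ℕ) : loopLog m 1 = 2 * Real.pi * I := by
  simp [loopLog, Complex.exp_two_pi_mul_I]

lemma loopLog_neg_one (m : ℕ) : loopLog m (-1) = -(2 * Real.pi * I) := by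
  simp [loopLog, Complex.exp_neg, Complex.exp_two_pi_mul_I]

/-- On the loop, `z - 1 = -q e (1 - κ/e)` with `e = e^{2πis}` and `κ = 1 - 1/q`. As `|κ| < 1`, the
last factor stays in the right half-plane, where the principal logarithm is differentiable; all the
winding sits in `e`. -/
lemma hasDerivAt_loopLog {m : ℕ} (hm : 1 ≤ m) (s : ℝ) :
    HasDerivAt (loopLog m) (deriv (loopAt m 0) s / (loopAt m 0 s - 1)) s := by
  obtain ⟨h1, h2⟩ := loopRadius_bounds hm
  have he := norm_exp_circle s
  have hE : HasDerivAt (fun s : ℝ => 2 * Real.pi * I * (s : ℂ)) (2 * Real.pi * I) s := by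
    simpa using (Complex.ofRealCLM.hasDerivAt (x := s)).const_mul (2 * Real.pi * I : ℂ)
  have hne : Complex.exp (2 * Real.pi * I * s) ≠ 0 := Complex.exp_ne_zero _
  have hmem : 1 - loopKappa m * (Complex.exp (2 * Real.pi * I * s))⁻¹ ∈ Complex.slitPlane := by
    left
    have hlt : ‖(loopKappa m : ℂ) * (Complex.exp (2 * Real.pi * I * s))⁻¹‖ < 1 := by
      rw [norm_mul, norm_inv, he, inv_one, mul_one, Complex.norm_real]
      exact abs_loopKappa_lt hm
    have := (Complex.re_le_norm _).trans_lt hlt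
    rw [Complex.sub_re, Complex.one_re]
    linarith
  have h := (hE.add ((((hasDerivAt_exp_circle s).inv hne).const_mul
    (loopKappa m : ℂ)).const_sub 1 |>.clog_real hmem)).sub_const (Complex.log (1 - loopKappa m))
  convert! h using 1
  simp only [Pi.inv_apply]
  rw [(hasDerivAt_loopAt m 0 s).deriv, loopAt_zero, pole_zero]
  have hnz := Complex.slitPlane_ne_zero hmem
  have hq : (loopRadius m : ℂ) ≠ 0 := by
    have : loopRadius m ≠ 0 := by linarith
    exact_mod_cast this
  have hk : (loopKappa m : ℂ) = 1 - (loopRadius m : ℂ)⁻¹ := by simp [loopKappa]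
  have hr : ((2 * Real.cos (Real.pi / nSing m) : ℝ) : ℂ)⁻¹ = loopRadius m := by
    rw [loopRadius, Complex.ofReal_inv]
  rw [hr]
  rw [hk] at hnz ⊢
  generalize (loopRadius m : ℂ) = q at *
  generalize Complex.exp (2 * Real.pi * I * s) = e at *
  have h5 : q * (1 - e) - 1 = -(q * e) * (1 - (1 - q⁻¹) * e⁻¹) := by
    field_simp; ring
  rw [h5]
  have h6 : 1 - (1 - q⁻¹) * e⁻¹ = (e * q - (q - 1)) / (e * q) := by field_simp
  have h7 : e * q - (q - 1) ≠ 0 := by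
    intro h0
    rw [h6, h0, zero_div] at hnz
    exact hnz rfl
  rw [h6]
  generalize hW : e * q - (q - 1) = W at *
  field_simp
  linear_combination hW

end Geometry

/-! ### Uniqueness of the continuation. -/

section Continuation

variable {η : ℂ → Matrix (Fin 2) (Fin 2) ℂ} {γ : ℝ → ℂ} {X Z : ℝ → Matrix (Fin 2) (Fin 2) ℂ}

/-- For trace-free `η` the adjugate satisfies `(adj X)' = -γ' η (adj X)`, so the product has
derivative zero. Uniqueness follows without any bound on `η`. -/
lemma IsContinuation.mul_adjugate (htr : ∀ z, (η z).trace = 0) (hX : IsContinuation η γ X)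
    (hZ : IsContinuation η γ Z) (s : ℝ) : Z s * (X s).adjugate = 1 := by
  have key : ∀ i k : Fin 2, ∀ s : ℝ, HasDerivAt (fun u => (Z u * (X u).adjugate) i k) 0 s := by
    intro i k s
    have ht := htr (γ s)
    rw [Matrix.trace_fin_two] at ht
    have h11 : η (γ s) 1 1 = -η (γ s) 0 0 := by linear_combination ht
    have hX' := hX.2 s
    have hZ' := hZ.2 s
    simp only [Matrix.adjugate_fin_two, Matrix.mul_apply, Fin.sum_univ_two]
    have e00 := hX' 0 0
    have e01 := hX' 0 1
    have e10 := hX' 1 0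
    have e11 := hX' 1 1
    fin_cases k
    · have h := ((hZ' i 0).mul e11).sub ((hZ' i 1).mul e10)
      simp only [Matrix.smul_apply, Matrix.mul_apply, Fin.sum_univ_two, h11, smul_eq_mul] at h
      convert! h using 1
      · funext u
        simp [sub_eq_add_neg]
      · ring
    · have h := ((hZ' i 1).mul e00).sub ((hZ' i 0).mul e01)
      simp only [Matrix.smul_apply, Matrix.mul_apply, Fin.sum_univ_two, h11, smul_eq_mul] at h
      convert! h using 1
      · funext u
        simp [sub_eq_add_neg, add_comm]
      · ring
  ext i k
  have hconst := is_const_of_deriv_eq_zero (𝕜 := ℝ)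
    (fun s => (key i k s).differentiableAt) (fun s => (key i k s).deriv) s 0
  rw [hconst, hX.1, hZ.1]
  simp

lemma IsContinuation.unique (htr : ∀ z, (η z).trace = 0) (hX : IsContinuation η γ X)
    (hZ : IsContinuation η γ Z) : Z = X := by
  funext s
  have h1 := IsContinuation.mul_adjugate htr hX hX s
  have h2 := IsContinuation.mul_adjugate htr hX hZ s
  have h3 : (X s).adjugate * X s = 1 := mul_eq_one_comm.mp h1
  calc Z s = Z s * ((X s).adjugate * X s) := by rw [h3, mul_one]
    _ = X s := by rw [← mul_assoc, h2, one_mul]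

lemma IsContinuation.monodromy_eq (htr : ∀ z, (η z).trace = 0) (hX : IsContinuation η γ X) :
    monodromy η γ = X 1 := by
  have h : ∃ X, IsContinuation η γ X := ⟨X, hX⟩
  rw [monodromy, dif_pos h, IsContinuation.unique htr hX h.choose_spec]

end Continuation

/-! ### The rotational symmetry of the potential. -/

section Symmetry

variable (m : ℕ) (x : Param)

/-- The diagonal entry of `D`. -/
noncomputable def dEntry (m : ℕ) : ℂ := Complex.exp (I * Real.pi * m / nSing m)

lemma dEntry_ne_zero : dEntry m ≠ 0 := Complex.exp_ne_zero _

lemma matD_eq : matD m = !![dEntry m, 0; 0, (dEntry m)⁻¹] := by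
  rw [matD, dEntry, Complex.exp_neg]

lemma matD_inv : (matD m)⁻¹ = !![(dEntry m)⁻¹, 0; 0, dEntry m] := by
  have h := dEntry_ne_zero m
  refine Matrix.inv_eq_right_inv ?_
  rw [matD_eq]
  ext i j
  fin_cases i <;> fin_cases j <;> simp [h]

lemma matD_mul_inv : matD m * (matD m)⁻¹ = 1 := by
  have h := dEntry_ne_zero m
  rw [matD_inv, matD_eq]
  ext i j
  fin_cases i <;> fin_cases j <;> simp [h]

lemma matD_inv_mul : (matD m)⁻¹ * matD m = 1 := mul_eq_one_comm.mp (matD_mul_inv m)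

lemma dEntry_sq_pow : (dEntry m ^ 2) ^ nSing m = 1 := by
  rw [dEntry, ← Complex.exp_nat_mul, ← Complex.exp_nat_mul]
  have : (nSing m : ℂ) ≠ 0 := by exact_mod_cast (nSing_pos m).ne'
  rw [Complex.exp_eq_one_iff]
  refine ⟨m, ?_⟩
  push_cast
  field_simp

/-- The rotation multiplies `z^(m-1) dz` by `p_1^m`, and conjugation by `D` multiplies the lower
left entry by the square of its diagonal entry; here the two agree. -/
lemma pole_one_pow : pole m 1 ^ m = dEntry m ^ 2 := by
  rw [pole, dEntry, ← Complex.exp_nat_mul, ← Complex.exp_nat_mul]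
  congr 1
  push_cast
  ring

lemma matA_eq (j : ℕ) (lam : ℂ) : matA m x j lam =
    !![evalLoop x.a ((-1) ^ j * lam),
      ((dEntry m ^ 2) ^ j)⁻¹ * (((-1) ^ j * lam)⁻¹ * evalLoop x.b ((-1) ^ j * lam));
      (dEntry m ^ 2) ^ j * (((-1) ^ j * lam) * evalLoop x.c ((-1) ^ j * lam)),
      -evalLoop x.a ((-1) ^ j * lam)] := by
  induction j generalizing lam with
  | zero => simp [matA]
  | succ j ih =>
    have h := dEntry_ne_zero m
    have hs : (-1 : ℂ) ^ j * -lam = (-1) ^ (j + 1) * lam := by ring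
    rw [matA, ih (-lam), hs, matD_inv, matD_eq]
    ext i k
    fin_cases i <;> fin_cases k <;> simp <;> field_simp <;> ring

lemma trace_matA (j : ℕ) (lam : ℂ) : (matA m x j lam).trace = 0 := by
  rw [matA_eq]; simp [Matrix.trace_fin_two]

lemma det_matA (j : ℕ) (lam : ℂ) (h : lam ≠ 0) : (matA m x j lam).det =
    -(evalLoop x.a ((-1) ^ j * lam) ^ 2 +
      evalLoop x.b ((-1) ^ j * lam) * evalLoop x.c ((-1) ^ j * lam)) := by
  have hd := dEntry_ne_zero m
  rw [matA_eq, Matrix.det_fin_two_of]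
  have hj : (-1 : ℂ) ^ j * lam ≠ 0 := mul_ne_zero (pow_ne_zero _ (by norm_num)) h
  field_simp
  ring

/-- The recursion closes up after `n` steps, because `n` is even and the off-diagonal factors are
`n`-th roots of unity. -/
lemma matA_nSing (lam : ℂ) : matA m x (nSing m) lam = matA m x 0 lam := by
  have h : (-1 : ℂ) ^ nSing m = 1 := by
    rw [nSing, show 2 * m + 2 = 2 * (m + 1) by ring, pow_mul]; simp
  rw [matA_eq, matA_eq, dEntry_sq_pow, h, pow_zero, pow_zero]

lemma trace_potential (t : ℝ) (lam z : ℂ) : (potential m t x lam z).trace = 0 := by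
  rw [potential, Matrix.trace_add, Matrix.trace_smul, Matrix.trace_sum]
  simp only [Matrix.trace_smul, trace_matA, smul_zero, Finset.sum_const_zero, add_zero]
  simp [Matrix.trace_fin_two]

/-- The rotation permutes the poles cyclically, and the recursion for the residues absorbs the shift
of the index into `λ ↦ -λ` and conjugation by `D`. -/
lemma potential_rotate (hm : 1 ≤ m) (t : ℝ) (lam z : ℂ) :
    pole m 1 • potential m t x lam (pole m 1 * z) =
      (matD m)⁻¹ * potential m t x (-lam) z * matD m := by
  have hp := pole_ne_zero m 1
  have hshift : ∑ j ∈ Finset.range (nSing m), (pole m 1 * z - pole m j)⁻¹ • matA m x j lam =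
      ∑ j ∈ Finset.range (nSing m),
        (pole m 1 * z - pole m (j + 1))⁻¹ • matA m x (j + 1) lam := by
    have h1 := Finset.sum_range_succ
      (fun j => (pole m 1 * z - pole m j)⁻¹ • matA m x j lam) (nSing m)
    have h2 := Finset.sum_range_succ'
      (fun j => (pole m 1 * z - pole m j)⁻¹ • matA m x j lam) (nSing m)
    rw [h1, pole_nSing, matA_nSing, pole_zero] at h2
    exact add_right_cancel h2
  rw [potential, potential, hshift, smul_add, mul_add, add_mul]
  congr 1
  · have h := dEntry_ne_zero m
    have hpow := pole_one_pow m
    obtain ⟨k, rfl⟩ : ∃ k, m = k + 1 := ⟨m - 1, by omega⟩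
    rw [pow_succ] at hpow
    rw [matD_inv, matD_eq]
    ext i j
    fin_cases i <;> fin_cases j <;> simp
    rw [mul_pow]
    linear_combination ((k : ℂ) + 1) * x.r * z ^ k * hpow
  · rw [mul_smul_comm, smul_mul_assoc, smul_comm, Finset.mul_sum, Finset.sum_mul,
      Finset.smul_sum]
    congr 1
    refine Finset.sum_congr rfl fun j _ => ?_
    rw [pole_succ m j, ← mul_sub, mul_inv, mul_smul, smul_inv_smul₀ hp, matA, mul_smul_comm,
      smul_mul_assoc]

lemma loopAt_succ (j : ℕ) (s : ℝ) : loopAt m (j + 1) s = pole m 1 * loopAt m j s := by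
  rw [loopAt, loopAt, pole_succ]; ring

lemma IsContinuation.rotate (hm : 1 ≤ m) {t : ℝ} {lam : ℂ} {j : ℕ}
    {X : ℝ → Matrix (Fin 2) (Fin 2) ℂ}
    (hX : IsContinuation (potential m t x (-lam)) (loopAt m j) X) :
    IsContinuation (potential m t x lam) (loopAt m (j + 1))
      (fun s => (matD m)⁻¹ * X s * matD m) := by
  refine ⟨?_, fun s i k => ?_⟩
  · simp only [hX.1, mul_one, matD_inv_mul]
  · have hd : deriv (loopAt m (j + 1)) s = pole m 1 * deriv (loopAt m j) s := by
      have h : loopAt m (j + 1) = fun s => pole m 1 * loopAt m j s := funext (loopAt_succ m j)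
      rw [h, deriv_const_mul_field]
    have hC : deriv (loopAt m (j + 1)) s • ((matD m)⁻¹ * X s * matD m *
        potential m t x lam (loopAt m (j + 1) s)) =
        (matD m)⁻¹ * (deriv (loopAt m j) s • (X s * potential m t x (-lam) (loopAt m j s))) *
          matD m := by
      rw [hd, mul_comm, mul_smul, loopAt_succ, ← mul_smul_comm (pole m 1), potential_rotate m x hm]
      have e := matD_mul_inv m
      simp only [mul_smul_comm, smul_mul_assoc, mul_assoc]
      rw [← mul_assoc (matD m) (matD m)⁻¹, e, one_mul]
    rw [hC]
    have hent : ∀ Y : Matrix (Fin 2) (Fin 2) ℂ, ((matD m)⁻¹ * Y * matD m) i k =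
        ∑ a, ∑ b, (matD m)⁻¹ i a * Y a b * matD m b k := fun Y => by
      simp only [Matrix.mul_apply, Finset.sum_mul]
      rw [Finset.sum_comm]
    simp only [hent]
    exact HasDerivAt.fun_sum fun a _ => HasDerivAt.fun_sum fun b _ =>
      ((hX.2 s a b).const_mul _).mul_const _

lemma diagExp_mul_matD (t : ℝ) : (matD m)⁻¹ * diagExp t * matD m = diagExp t := by
  have h := dEntry_ne_zero m
  rw [matD_inv, matD_eq, diagExp]
  ext i j
  fin_cases i <;> fin_cases j <;> simp <;> field_simp

lemma diagExp_zpow_neg_one_pow (t : ℝ) (j : ℕ) :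
    diagExp t ^ ((-1 : ℤ) ^ j) = diagExp (if Even j then t else -t) := by
  split_ifs with h
  · rw [h.neg_one_pow, _root_.zpow_one]
  · rw [(Nat.not_even_iff_odd.mp h).neg_one_pow, Matrix.zpow_neg_one]
    refine Matrix.inv_eq_right_inv ?_
    ext i j
    fin_cases i <;> fin_cases j <;> simp [diagExp, ← Complex.exp_add]

/-- The monodromies at `λ = ± 1` are determined by the one around `p_0 = 1`. -/
lemma matM_of_matM_zero (hm : 1 ≤ m) {t : ℝ}
    (hex : ∀ lam : ℂ, ‖lam‖ = 1 →
      ∃ X, IsContinuation (potential m t x lam) (loopAt m 0) X)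
    (h1 : matM m 0 t x 1 = diagExp t) (h2 : matM m 0 t x (-1) = diagExp (-t)) (j : ℕ) :
    matM m j t x 1 = diagExp t ^ ((-1 : ℤ) ^ j) ∧
      matM m j t x (-1) = diagExp (-t) ^ ((-1 : ℤ) ^ j) := by
  have hexj : ∀ j : ℕ, ∀ lam : ℂ, ‖lam‖ = 1 →
      ∃ X, IsContinuation (potential m t x lam) (loopAt m j) X := by
    intro j
    induction j with
    | zero => exact hex
    | succ j ih =>
      intro lam hl
      obtain ⟨X, hX⟩ := ih (-lam) (by rwa [norm_neg])
      exact ⟨_, hX.rotate m x hm⟩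
  have step : ∀ j : ℕ, ∀ lam : ℂ, ‖lam‖ = 1 →
      matM m (j + 1) t x lam = (matD m)⁻¹ * matM m j t x (-lam) * matD m := by
    intro j lam hl
    obtain ⟨X, hX⟩ := hexj j (-lam) (by rwa [norm_neg])
    rw [matM, matM, hX.monodromy_eq (trace_potential m x t _),
      (hX.rotate m x hm).monodromy_eq (trace_potential m x t _)]
  simp only [diagExp_zpow_neg_one_pow]
  induction j with
  | zero => simp [h1, h2]
  | succ j ih =>
    -- `D` commutes with diagonal matrices, so passing to the next loop merely exchanges the values
    -- at `1` and `-1`.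
    rw [step j 1 (by simp), step j (-1) (by simp), neg_neg, ih.1, ih.2, diagExp_mul_matD,
      diagExp_mul_matD]
    by_cases hj : Even j <;> simp [hj, Nat.even_add_one]

end Symmetry

end DPW

namespace DPW

/-! ### Matrices with entries in the loop algebra -/

section LoopMatrices

open scoped Matrix.Norms.Operator

variable {ρ : ℝ} [Fact (1 < ρ)]

/-- The Banach algebra of `2 × 2` matrices over the loop algebra. -/
def LoopMat (ρ : ℝ) [Fact (1 < ρ)] : Type := Matrix (Fin 2) (Fin 2) (LoopAlg ρ)

namespace LoopMat

noncomputable instance : NormedRing (LoopMat ρ) :=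
  inferInstanceAs (NormedRing (Matrix (Fin 2) (Fin 2) (LoopAlg ρ)))

noncomputable instance : NormedAlgebra ℂ (LoopMat ρ) :=
  inferInstanceAs (NormedAlgebra ℂ (Matrix (Fin 2) (Fin 2) (LoopAlg ρ)))

instance : CompleteSpace (LoopMat ρ) :=
  inferInstanceAs (CompleteSpace (Matrix (Fin 2) (Fin 2) (LoopAlg ρ)))

/-- The entries, as continuous linear maps. -/
noncomputable def entry (i k : Fin 2) : LoopMat ρ →L[ℂ] LoopAlg ρ where
  toFun := fun M => M i k
  map_add' _ _ := rfl
  map_smul' _ _ := rfl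
  cont := (continuous_apply k).comp (continuous_apply i)

/-- The matrix with a single entry, as a continuous linear map. -/
noncomputable def single (i k : Fin 2) : LoopAlg ρ →L[ℂ] LoopMat ρ where
  toFun := fun a => Matrix.single i k a
  map_add' a b := Matrix.single_add i k a b
  map_smul' c a := (Matrix.smul_single c i k a).symm
  cont := by
    refine continuous_pi fun i' => continuous_pi fun k' => ?_
    by_cases h : i = i' ∧ k = k'
    · simp only [Matrix.single_apply, h, and_self, if_true]; exact continuous_id
    · simp only [Matrix.single_apply, h, if_false]; exact continuous_const

lemma entry_single (i k i' k' : Fin 2) (a : LoopAlg ρ) :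
    entry i' k' (single i k a) = if i = i' ∧ k = k' then a else 0 :=
  Matrix.single_apply ..

lemma entry_mul (i k : Fin 2) (S T : LoopMat ρ) :
    entry i k (S * T) = entry i 0 S * entry 0 k T + entry i 1 S * entry 1 k T := by
  change (Matrix.of fun _ _ => _ : Matrix (Fin 2) (Fin 2) (LoopAlg ρ)) i k = _
  exact (Matrix.mul_apply (M := (S : Matrix (Fin 2) (Fin 2) (LoopAlg ρ)))).trans
    (Fin.sum_univ_two _)

lemma entry_one (i k : Fin 2) : entry i k (1 : LoopMat ρ) = if i = k then 1 else 0 :=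
  Matrix.one_apply (i := i) (j := k)

lemma ext_entry {S T : LoopMat ρ} (h : ∀ i k, entry i k S = entry i k T) : S = T :=
  Matrix.ext h

/-- Evaluation at a point of the unit circle, as a ring homomorphism. -/
noncomputable def evalHom {lam : ℂ} (h : ‖lam‖ = 1) : LoopMat ρ →+* Matrix (Fin 2) (Fin 2) ℂ where
  toFun M := Matrix.of fun i k => LoopAlg.ev lam (entry i k M)
  map_one' := by
    ext i k
    simp only [Matrix.of_apply, entry_one, Matrix.one_apply]
    split_ifs <;> simp [LoopAlg.ev_one h]
  map_zero' := by ext i k; simp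
  map_add' S T := by ext i k; simp
  map_mul' S T := by
    ext i k
    simp only [Matrix.of_apply, entry_mul, map_add, LoopAlg.ev_mul h, Matrix.mul_apply,
      Fin.sum_univ_two]

lemma evalHom_apply {lam : ℂ} (h : ‖lam‖ = 1) (M : LoopMat ρ) (i k : Fin 2) :
    evalHom h M i k = LoopAlg.ev lam (entry i k M) := rfl

lemma evalHom_smul {lam : ℂ} (h : ‖lam‖ = 1) (c : ℂ) (M : LoopMat ρ) :
    evalHom h (c • M) = c • evalHom h M := by
  ext i k
  simp [evalHom_apply]

lemma continuous_evalHom {lam : ℂ} (h : ‖lam‖ = 1) : Continuous (evalHom (ρ := ρ) h) :=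
  continuous_pi fun i => continuous_pi fun k =>
    (LoopAlg.ev lam).continuous.comp (entry i k).continuous

lemma evalHom_exp {lam : ℂ} (h : ‖lam‖ = 1) (M : LoopMat ρ) :
    evalHom h (NormedSpace.exp M) = NormedSpace.exp (evalHom h M) :=
  letI : NormedAlgebra ℚ (LoopMat ρ) := NormedAlgebra.restrictScalars ℚ ℂ _
  NormedSpace.map_exp (evalHom h) (continuous_evalHom h) M

end LoopMat

end LoopMatrices

/-! ### The potential over the loop algebra -/

section LoopPotential

variable {ρ : ℝ} [Fact (1 < ρ)]

/-- The Banach space of parameters, in weighted coordinates. -/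
abbrev ParamSpace := ℝ × L1 ℕ ℝ × L1 ℕ ℝ × L1 ℕ ℝ

/-- The parameter with given weighted coordinates. -/
noncomputable def toParam (ρ : ℝ) (v : ParamSpace) : Param where
  r := v.1
  a := fun k => v.2.1 k / ρ ^ k
  b := fun k => v.2.2.1 k / ρ ^ k
  c := fun k => v.2.2.2 k / ρ ^ k

open LoopMat LoopAlg

/-- The residue matrices over the loop algebra. -/
noncomputable def loopA (ρ : ℝ) [Fact (1 < ρ)] (m j : ℕ) : ParamSpace →L[ℝ] LoopMat ρ :=
  let ε : ℤˣ := (-1) ^ j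
  let d : ℂ := (dEntry m ^ 2) ^ j
  let mulS (k : ℤ) : LoopAlg ρ →L[ℂ] LoopAlg ρ :=
    ((ε : ℤ) : ℂ) • ContinuousLinearMap.mul ℂ (LoopAlg ρ) (shift ρ k)
  let a : ParamSpace →L[ℝ] LoopAlg ρ := (ofSeq ε).comp
    ((ContinuousLinearMap.fst ℝ _ _).comp (ContinuousLinearMap.snd ℝ _ _))
  let b : ParamSpace →L[ℝ] LoopAlg ρ := (ofSeq ε).comp ((ContinuousLinearMap.fst ℝ _ _).comp
    ((ContinuousLinearMap.snd ℝ _ _).comp (ContinuousLinearMap.snd ℝ _ _)))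
  let c : ParamSpace →L[ℝ] LoopAlg ρ := (ofSeq ε).comp ((ContinuousLinearMap.snd ℝ _ _).comp
    ((ContinuousLinearMap.snd ℝ _ _).comp (ContinuousLinearMap.snd ℝ _ _)))
  ((LoopMat.single 0 0 - LoopMat.single 1 1).restrictScalars ℝ).comp a +
    ((d⁻¹ • (LoopMat.single 0 1).comp (mulS (-1))).restrictScalars ℝ).comp b +
    ((d • (LoopMat.single 1 0).comp (mulS 1)).restrictScalars ℝ).comp c

lemma loopA_apply (m j : ℕ) (v : ParamSpace) : loopA ρ m j v =
    LoopMat.single 0 0 (ofSeq ((-1) ^ j) v.2.1) - LoopMat.single 1 1 (ofSeq ((-1) ^ j) v.2.1) +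
    ((dEntry m ^ 2) ^ j)⁻¹ • LoopMat.single 0 1
      ((-1 : ℂ) ^ j • (shift ρ (-1) * ofSeq ((-1) ^ j) v.2.2.1)) +
    (dEntry m ^ 2) ^ j • LoopMat.single 1 0
      ((-1 : ℂ) ^ j • (shift ρ 1 * ofSeq ((-1) ^ j) v.2.2.2)) := by
  simp [loopA]

lemma evalHom_loopA {lam : ℂ} (h : ‖lam‖ = 1) (m j : ℕ) (v : ParamSpace) :
    evalHom h (loopA ρ m j v) = matA m (toParam ρ v) j lam := by
  have hj : (((((-1 : ℤˣ)) ^ j : ℤˣ) : ℤ) : ℂ) = (-1) ^ j := by push_cast; rfl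
  have hi : ((-1 : ℂ) ^ j)⁻¹ = (-1) ^ j := by rw [← inv_pow, inv_neg, inv_one]
  ext i k
  rw [evalHom_apply, loopA_apply, matA_eq]
  fin_cases i <;> fin_cases k <;>
    simp [entry_single, ev_ofSeq h, ev_mul h, ev_shift h, toParam, hi] <;>
    exact Or.inl (by ring)

/-- The nilpotent matrix `(0, 0; 1, 0)`. -/
noncomputable def nil (ρ : ℝ) [Fact (1 < ρ)] : LoopMat ρ := LoopMat.single 1 0 1

lemma nil_mul_nil : nil ρ * nil ρ = 0 := by
  refine ext_entry fun i k => ?_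
  simp [nil, entry_mul, entry_single]

/-- `Φ_0(z) = (1, 0; r z^m, 1)`. -/
noncomputable def phiZero (ρ : ℝ) [Fact (1 < ρ)] (m : ℕ) (r : ℝ) (z : ℂ) : LoopMat ρ :=
  1 + ((r : ℂ) * z ^ m) • nil ρ

lemma hasDerivAt_phiZero (m : ℕ) (r : ℝ) (z : ℂ) : HasDerivAt (phiZero ρ m r)
    (phiZero ρ m r z * ((m * r * z ^ (m - 1) : ℂ) • nil ρ)) z := by
  have h := (((hasDerivAt_pow m z).const_mul (r : ℂ)).smul_const (nil ρ)).const_add 1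
  convert! h using 1
  rw [phiZero, add_mul, one_mul, smul_mul_smul_comm, nil_mul_nil, smul_zero, add_zero]
  congr 1
  ring

/-- `B + s₁ r (N B - B N) - s₂ r² N B N`. -/
noncomputable def conjNil (r : ℝ) (s₁ s₂ : ℂ) (B : LoopMat ρ) : LoopMat ρ :=
  B + s₁ • (r : ℂ) • (nil ρ * B - B * nil ρ) - s₂ • (r : ℂ) ^ 2 • (nil ρ * B * nil ρ)

/-- As `N² = 0`, one has `Φ_0 B Φ_0⁻¹ = (1 + r z^m N) B (1 - r z^m N)`. The expansion has the scalar
coefficients `1`, `z^m`, `z^(2m)` in front of constants, which is why `conjNil` carries two separate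
scalars. -/
lemma conjNil_mul_phiZero (m : ℕ) (r : ℝ) (z : ℂ) (B : LoopMat ρ) :
    conjNil r (z ^ m) (z ^ (2 * m)) B * phiZero ρ m r z = phiZero ρ m r z * B := by
  have h := nil_mul_nil (ρ := ρ)
  simp only [conjNil, phiZero, mul_add, add_mul, sub_mul, mul_one, one_mul, mul_smul_comm,
    smul_mul_assoc, smul_add, smul_sub, mul_assoc, h, mul_zero, smul_zero, sub_zero, smul_smul]
  rw [two_mul, pow_add]
  module

/-- The residue `R = Φ_0(1) A_0 Φ_0(1)⁻¹`. -/
noncomputable def loopR (ρ : ℝ) [Fact (1 < ρ)] (m : ℕ) (v : ParamSpace) : LoopMat ρ :=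
  conjNil v.1 1 1 (loopA ρ m 0 v)

end LoopPotential

/-! ### The regular part of the gauged potential -/

section Regular

open bddHol Metric

variable {ρ : ℝ} [Fact (1 < ρ)] {m : ℕ} {r d : ℝ}

lemma bddHol.fn_pow {E : Type*} [NormedRing E] [NormedAlgebra ℂ E] {U : Set ℂ} (f : bddHol U E)
    {z : ℂ} (hz : z ∈ U) (k : ℕ) : fn (f ^ k) z = fn f z ^ k := by
  induction k with
  | zero => rw [pow_zero, pow_zero, fn_one hz]
  | succ k ih => rw [pow_succ, fn_mul, ih, pow_succ]

lemma bddHol.fn_sum {E ι : Type*} [NormedRing E] [NormedAlgebra ℂ E] {U : Set ℂ} (s : Finset ι)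
    (f : ι → bddHol U E) (z : ℂ) : fn (∑ i ∈ s, f i) z = ∑ i ∈ s, fn (f i) z :=
  map_sum (evalL z) f s

/-- The disc data: a disc of radius `r` about the centre of the loop that keeps distance `d` to
all poles but `1`. -/
structure IsDisc (m : ℕ) (r d : ℝ) : Prop where
  lt : loopRadius m < r
  pos : 0 < d
  le : ∀ j : ℕ, 0 < j → j < nSing m → r + d ≤ ‖pole m j - (loopRadius m : ℂ)‖

/-- The disc. -/
abbrev disc (m : ℕ) (r : ℝ) : Set ℂ := ball (loopRadius m : ℂ) r

lemma IsDisc.le_norm_sub (hD : IsDisc m r d) {j : ℕ} (h0 : 0 < j) (hj : j < nSing m) {z : ℂ}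
    (hz : z ∈ disc m r) : d ≤ ‖z - pole m j‖ := by
  have h1 := hD.le j h0 hj
  have h2 := norm_sub_le_norm_sub_add_norm_sub (pole m j) z (loopRadius m : ℂ)
  have h3 := mem_ball_iff_norm.mp hz
  rw [norm_sub_rev z]
  linarith

lemma IsDisc.one_mem (hm : 1 ≤ m) (hD : IsDisc m r d) : (1 : ℂ) ∈ disc m r := by
  obtain ⟨h1, h2⟩ := loopRadius_bounds hm
  rw [mem_ball_iff_norm, ← Complex.ofReal_one, ← Complex.ofReal_sub, Complex.norm_real,
    Real.norm_of_nonneg (by linarith)]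
  linarith [hD.lt]

lemma IsDisc.loopAt_mem (hm : 1 ≤ m) (hD : IsDisc m r d) (s : ℝ) : loopAt m 0 s ∈ disc m r := by
  rw [mem_ball_iff_norm, norm_loopAt_sub hm]
  exact hD.lt

/-- The coordinate function on the disc. -/
noncomputable def coord (m : ℕ) (r : ℝ) : bddHol (disc m r) ℂ :=
  bddHol.mk (fun z => z) differentiableOn_id (‖(loopRadius m : ℂ)‖ + r) fun z hz => by
    have := norm_le_norm_add_norm_sub' z (loopRadius m : ℂ)
    have := mem_ball_iff_norm.mp hz
    linarith

/-- `1 / (z - p_j)` on the disc. -/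
noncomputable def invSub (hD : IsDisc m r d) {j : ℕ} (h : 0 < j ∧ j < nSing m) :
    bddHol (disc m r) ℂ :=
  bddHol.mk (fun z => (z - pole m j)⁻¹)
    ((differentiableOn_id.sub_const _).inv fun z hz => norm_pos_iff.mp
      (hD.pos.trans_le (hD.le_norm_sub h.1 h.2 hz))) d⁻¹ fun z hz => by
    rw [norm_inv]
    exact inv_anti₀ hD.pos (hD.le_norm_sub h.1 h.2 hz)

open Classical in
/-- The regular part at `p_0 = 1` of `z^k / (z - p_j)`. -/
noncomputable def regPart (hD : IsDisc m r d) (j k : ℕ) : bddHol (disc m r) ℂ :=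
  if h : 0 < j ∧ j < nSing m then invSub hD h * coord m r ^ k
  else ∑ i ∈ Finset.range k, coord m r ^ i

/-- For the pole `1`, the regular part `(z^k - 1)/(z - 1)` is a geometric sum; the other terms are
regular already. -/
lemma fn_regPart (hD : IsDisc m r d) {j : ℕ} (hj : j < nSing m) (k : ℕ) {z : ℂ}
    (hz : z ∈ disc m r) (h1 : z ≠ 1) :
    fn (regPart hD j k) z = (z - pole m j)⁻¹ * z ^ k - if j = 0 then (z - 1)⁻¹ else 0 := by
  have hc : fn (coord m r) z = z := fn_mk (g := fun z => z) hz
  unfold regPart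
  split_ifs with h h0 h0
  · omega
  · have : fn (invSub hD h) z = (z - pole m j)⁻¹ := fn_mk (g := fun z => (z - pole m j)⁻¹) hz
    rw [fn_mul, fn_pow _ hz, hc, this, sub_zero]
  · have h2 : z - 1 ≠ 0 := sub_ne_zero.mpr h1
    rw [fn_sum, h0, pole_zero]
    simp only [fn_pow _ hz, hc]
    rw [geom_sum_eq h1]
    field_simp
  · omega

/-- The holomorphic part of the gauged potential on the disc. -/
noncomputable def loopH (hD : IsDisc m r d) (v : ParamSpace) :
    bddHol (disc m r) (LoopMat ρ) :=
  ∑ j ∈ Finset.range (nSing m), (scal (regPart hD j 0) (loopA ρ m j v) +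
    (v.1 : ℂ) • scal (regPart hD j m) (nil ρ * loopA ρ m j v - loopA ρ m j v * nil ρ) -
    (v.1 : ℂ) ^ 2 • scal (regPart hD j (2 * m)) (nil ρ * loopA ρ m j v * nil ρ))

/-- The potential over the loop algebra. -/
noncomputable def loopPotential (ρ : ℝ) [Fact (1 < ρ)] (m : ℕ) (t : ℝ) (v : ParamSpace) (z : ℂ) :
    LoopMat ρ :=
  ((m : ℂ) * v.1 * z ^ (m - 1)) • nil ρ +
    (t : ℂ) • ∑ j ∈ Finset.range (nSing m), (z - pole m j)⁻¹ • loopA ρ m j v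

lemma evalHom_loopPotential {lam : ℂ} (h : ‖lam‖ = 1) (t : ℝ) (v : ParamSpace) (z : ℂ) :
    LoopMat.evalHom h (loopPotential ρ m t v z) = potential m t (toParam ρ v) lam z := by
  rw [loopPotential, potential, map_add, LoopMat.evalHom_smul, LoopMat.evalHom_smul, map_sum]
  congr 1
  · ext i k
    fin_cases i <;> fin_cases k <;>
      simp [LoopMat.evalHom_apply, nil, LoopMat.entry_single, LoopAlg.ev_one h, toParam]
  · simp only [LoopMat.evalHom_smul, evalHom_loopA]

/-- If `Y' = Y ω` and `Φ_0' = Φ_0 η_0`, then `(Y Φ_0)' = Y (ω Φ_0 + Φ_0 η_0)`. The identity makes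
this `Y Φ_0 η`. -/
lemma gauged_potential (hD : IsDisc m r d) (t : ℝ) (v : ParamSpace) {z : ℂ}
    (hz : z ∈ disc m r) (h1 : z ≠ 1) :
    (t : ℂ) • ((z - 1)⁻¹ • loopR ρ m v + fn (loopH hD v) z) * phiZero ρ m v.1 z +
      phiZero ρ m v.1 z * (((m : ℂ) * v.1 * z ^ (m - 1)) • nil ρ) =
    phiZero ρ m v.1 z * loopPotential ρ m t v z := by
  have key : (z - 1)⁻¹ • loopR ρ m v + fn (loopH hD v) z =
      ∑ j ∈ Finset.range (nSing m), (z - pole m j)⁻¹ •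
        conjNil v.1 (z ^ m) (z ^ (2 * m)) (loopA ρ m j v) := by
    have hR : (z - 1)⁻¹ • loopR ρ m v = ∑ j ∈ Finset.range (nSing m),
        (if j = 0 then (z - 1)⁻¹ else 0) • conjNil v.1 1 1 (loopA ρ m j v) := by
      rw [Finset.sum_eq_single 0]
      · rw [if_pos rfl]; rfl
      · intro j _ hj
        rw [if_neg hj, zero_smul]
      · intro h
        exact absurd (Finset.mem_range.mpr (by unfold nSing; omega)) h
    rw [hR, loopH, fn_sum, ← Finset.sum_add_distrib]
    refine Finset.sum_congr rfl fun j hj => ?_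
    have hj' := Finset.mem_range.mp hj
    simp only [fn_sub, fn_add, fn_smul, fn_scal _ _ hz, fn_regPart hD hj' _ hz h1, conjNil]
    generalize (if j = 0 then (z - 1)⁻¹ else 0) = w
    generalize nil ρ * loopA ρ m j v * nil ρ = B₂
    generalize nil ρ * loopA ρ m j v - loopA ρ m j v * nil ρ = B₁
    simp only [pow_zero, mul_one]
    module
  rw [key, loopPotential, mul_add, add_comm (phiZero ρ m v.1 z * _)]
  congr 1
  rw [smul_mul_assoc, mul_smul_comm, Finset.sum_mul, Finset.mul_sum]
  congr 1
  refine Finset.sum_congr rfl fun j _ => ?_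
  rw [smul_mul_assoc, conjNil_mul_phiZero, mul_smul_comm]

end Regular

end DPW

namespace DPW

open bddHol Metric

/-! ### The solution along the loop and its smooth dependence on `t` and the parameters. -/

section Solution

variable {ρ : ℝ} [Fact (1 < ρ)] {m : ℕ} {r d : ℝ}

lemma contDiff_real_smul {F G : Type*} [NormedAddCommGroup F] [NormedSpace ℝ F]
    [NormedAddCommGroup G] [NormedSpace ℂ G] {n : WithTop ℕ∞} {f : F → ℝ} {g : F → G}
    (hf : ContDiff ℝ n f) (hg : ContDiff ℝ n g) (k : ℕ) :
    ContDiff ℝ n (fun x => (f x : ℂ) ^ k • g x) :=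
  ((Complex.ofRealCLM.contDiff.comp hf).pow k).smul hg

lemma contDiff_loopA (j : ℕ) {n : WithTop ℕ∞} : ContDiff ℝ n (loopA ρ m j) :=
  (loopA ρ m j).contDiff

lemma contDiff_loopR {n : WithTop ℕ∞} : ContDiff ℝ n (loopR ρ m) := by
  have hA := contDiff_loopA (ρ := ρ) (m := m) 0 (n := n)
  have hN : ContDiff ℝ n (fun _ : ParamSpace => nil ρ) := contDiff_const
  have h1 := contDiff_real_smul (n := n) contDiff_fst ((hN.mul hA).sub (hA.mul hN)) 1
  have h2 := contDiff_real_smul (n := n) contDiff_fst ((hN.mul hA).mul hN) 2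
  have h3 := (hA.add h1).sub h2
  convert! h3 using 2 with v
  simp [loopR, conjNil]

lemma contDiff_scal {F : Type*} [NormedAddCommGroup F] [NormedSpace ℝ F]
    {U : Set ℂ} (s : bddHol U ℂ) {n : WithTop ℕ∞} {f : F → LoopMat ρ} (hf : ContDiff ℝ n f) :
    ContDiff ℝ n (fun x => scal s (f x)) :=
  ((scal (E := LoopMat ρ) s).restrictScalars ℝ).contDiff.comp hf

lemma contDiff_loopH (hD : IsDisc m r d) {n : WithTop ℕ∞} :
    ContDiff ℝ n (loopH (ρ := ρ) hD) := by
  refine ContDiff.sum fun j _ => ?_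
  have hA := contDiff_loopA (ρ := ρ) (m := m) j (n := n)
  have hN : ContDiff ℝ n (fun _ : ParamSpace => nil ρ) := contDiff_const
  have h1 := contDiff_real_smul (n := n) contDiff_fst
    (contDiff_scal (regPart hD j m) ((hN.mul hA).sub (hA.mul hN))) 1
  have h2 := contDiff_real_smul (n := n) contDiff_fst
    (contDiff_scal (regPart hD j (2 * m)) ((hN.mul hA).mul hN)) 2
  have h3 := ((contDiff_scal (regPart hD j 0) hA).add h1).sub h2
  simpa only [pow_one] using h3

/-- The pair `(R, h)` for the parameter `v`. -/
noncomputable def gaugeData (ρ : ℝ) [Fact (1 < ρ)] (hD : IsDisc m r d) (v : ParamSpace) :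
    bddHol (disc m r) (LoopMat ρ) × bddHol (disc m r) (LoopMat ρ) :=
  (scal 1 (loopR ρ m v), loopH hD v)

lemma contDiff_gaugeData (hD : IsDisc m r d) {n : WithTop ℕ∞} :
    ContDiff ℝ n (gaugeData ρ hD) :=
  (contDiff_scal 1 contDiff_loopR).prodMk (contDiff_loopH hD)

/-- The gauge equation is uniquely solvable for the parameter `p = (t, v)`. -/
def IsRegular (ρ : ℝ) [Fact (1 < ρ)] (hm : 1 ≤ m) (hD : IsDisc m r d) (p : ℝ × ParamSpace) :
    Prop :=
  IsUnit (1 - (p.1 : ℂ) • gaugeOp (radialL (E := LoopMat ρ) (hD.one_mem hm))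
    (subConst (loopRadius m : ℂ) 1 r (LoopMat ρ)) (gaugeData ρ hD p.2))

/-- The solution of the gauge equation for the parameter `p = (t, v)`. -/
noncomputable def solQ (ρ : ℝ) [Fact (1 < ρ)] (hm : 1 ≤ m) (hD : IsDisc m r d)
    (p : ℝ × ParamSpace) : bddHol (disc m r) (LoopMat ρ) :=
  gaugeSol (radialL (hD.one_mem hm)) (subConst (loopRadius m : ℂ) 1 r (LoopMat ρ))
    (p.1, gaugeData ρ hD p.2)

/-- The value of the gauge at the base point `0`. -/
noncomputable def gaugeZero (ρ : ℝ) [Fact (1 < ρ)] (hm : 1 ≤ m) (hD : IsDisc m r d)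
    (p : ℝ × ParamSpace) : LoopMat ρ :=
  gaugeFn 1 (solQ ρ hm hD p) 0

/-- The logarithm of the monodromy around `p_0`, divided by `2 π i t`. -/
noncomputable def logMon (ρ : ℝ) [Fact (1 < ρ)] (hm : 1 ≤ m) (hD : IsDisc m r d)
    (p : ℝ × ParamSpace) : LoopMat ρ :=
  Ring.inverse (gaugeZero ρ hm hD p) * loopR ρ m p.2 * gaugeZero ρ hm hD p

variable (hm : 1 ≤ m) (hD : IsDisc m r d)

lemma solQ_zero (v : ParamSpace) : solQ ρ hm hD (0, v) = 0 :=
  gaugeSol_zero _ _ _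

lemma gaugeZero_zero (v : ParamSpace) : gaugeZero ρ hm hD (0, v) = 1 := by
  have : fn (0 : bddHol (disc m r) (LoopMat ρ)) 0 = 0 := map_zero (evalL 0)
  rw [gaugeZero, solQ_zero, gaugeFn, this, smul_zero, add_zero]

lemma logMon_zero (v : ParamSpace) : logMon ρ hm hD (0, v) = loopR ρ m v := by
  rw [logMon, gaugeZero_zero, Ring.inverse_one, one_mul, mul_one]

lemma contDiffAt_gaugeZero {n : WithTop ℕ∞} (v : ParamSpace) :
    ContDiffAt ℝ n (gaugeZero ρ hm hD) (0, v) := by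
  have hc : CompleteSpace (bddHol (disc m r) (LoopMat ρ)) := bddHol.completeSpace isOpen_ball
  have h1 : ContDiffAt ℝ n (solQ ρ hm hD) (0, v) := by
    refine ContDiffAt.comp (g := gaugeSol (radialL (hD.one_mem hm))
      (subConst (loopRadius m : ℂ) 1 r (LoopMat ρ)))
      (f := fun p : ℝ × ParamSpace => (p.1, gaugeData ρ hD p.2)) (0, v)
      (contDiffAt_gaugeSol _ _ _) ?_
    exact (contDiff_fst.prodMk ((contDiff_gaugeData hD).comp contDiff_snd)).contDiffAt
  have h2 := (((evalL (U := disc m r) (E := LoopMat ρ) 0).restrictScalars ℝ).contDiff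
    (n := n)).contDiffAt.comp (0, v) h1
  have h3 : ContDiffAt ℝ n (fun _ : ℝ × ParamSpace => (0 - 1 : ℂ)) (0, v) := contDiffAt_const
  exact contDiffAt_const.add (h3.smul h2)

/-- The quotient `(1/t) log M_0` makes sense only for `t ≠ 0`; `logMon` is its replacement across `t
= 0`, to which the implicit function theorem can be applied. -/
lemma contDiffAt_logMon {n : WithTop ℕ∞} (v : ParamSpace) :
    ContDiffAt ℝ n (logMon ρ hm hD) (0, v) := by
  have h1 := contDiffAt_gaugeZero (ρ := ρ) hm hD (n := n) v
  have h2 : ContDiffAt ℝ n (fun p => Ring.inverse (gaugeZero ρ hm hD p)) (0, v) := by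
    refine ContDiffAt.comp (g := Ring.inverse) (0, v) ?_ h1
    have : gaugeZero ρ hm hD (0, v) = ((1 : (LoopMat ρ)ˣ) : LoopMat ρ) := gaugeZero_zero hm hD v
    rw [this]
    exact contDiffAt_ringInverse ℝ _
  have h3 : ContDiffAt ℝ n (fun p : ℝ × ParamSpace => loopR ρ m p.2) (0, v) :=
    (contDiff_loopR.comp contDiff_snd).contDiffAt
  exact (h2.mul h3).mul h1

lemma eventually_isRegular (v : ParamSpace) : ∀ᶠ p in nhds ((0 : ℝ), v), IsRegular ρ hm hD p := by
  have hc : CompleteSpace (bddHol (disc m r) (LoopMat ρ)) := bddHol.completeSpace isOpen_ball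
  have h := eventually_isUnit_gaugeOp (radialL (E := LoopMat ρ) (hD.one_mem hm))
    (subConst (loopRadius m : ℂ) 1 r (LoopMat ρ)) (gaugeData ρ hD v)
  have hcont : ContinuousAt (fun p : ℝ × ParamSpace => (p.1, gaugeData ρ hD p.2)) (0, v) :=
    (continuous_fst.prodMk ((contDiff_gaugeData (n := 0) hD).continuous.comp
      continuous_snd)).continuousAt
  exact hcont.eventually h

lemma eventually_isUnit_gaugeZero (v : ParamSpace) :
    ∀ᶠ p in nhds ((0 : ℝ), v), IsUnit (gaugeZero ρ hm hD p) := by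
  have hcont := (contDiffAt_gaugeZero (ρ := ρ) hm hD (n := 0) v).continuousAt
  refine hcont.eventually (p := IsUnit) (Units.isOpen.mem_nhds ?_)
  rw [gaugeZero_zero]
  exact isUnit_one

variable {hm hD} {p : ℝ × ParamSpace}

lemma IsRegular.isGaugeSol (hp : IsRegular ρ hm hD p) :
    IsGaugeSol (hD.one_mem hm) (p.1 : ℂ) (loopR ρ m p.2) (loopH hD p.2) (solQ ρ hm hD p) := by
  refine ⟨scal 1 (loopR ρ m p.2), fun z hz => ?_, gaugeSol_eq _ _ (p := (p.1, gaugeData ρ hD p.2)) hp⟩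
  rw [fn_scal _ _ hz, fn_one hz, one_smul]

/-- The solution of `dΦ = Φ η` along the loop around `p_0`. -/
noncomputable def loopSol (ρ : ℝ) [Fact (1 < ρ)] (hm : 1 ≤ m) (hD : IsDisc m r d)
    (p : ℝ × ParamSpace) (s : ℝ) : LoopMat ρ :=
  Ring.inverse (gaugeZero ρ hm hD p) *
    (NormedSpace.exp (((p.1 : ℂ) * loopLog m s) • loopR ρ m p.2) *
      gaugeFn 1 (solQ ρ hm hD p) (loopAt m 0 s)) * phiZero ρ m p.2.1 (loopAt m 0 s)

lemma phiZero_base (hm : 1 ≤ m) (r : ℝ) : phiZero ρ m r 0 = 1 := by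
  simp [phiZero, zero_pow (show m ≠ 0 by omega)]

lemma loopAt_int (m : ℕ) (k : ℤ) : loopAt m 0 (k : ℝ) = 0 := by
  have : (2 * Real.pi * I * ((k : ℝ) : ℂ)) = k * (2 * Real.pi * I) := by push_cast; ring
  rw [loopAt_zero, this, Complex.exp_int_mul_two_pi_mul_I, sub_self, mul_zero]

/-- At integer times the loop is back at `0`, where `Φ_0 = 1`, and the gauge value conjugates the
exponential. The case `k = -1` serves the reality argument. -/
lemma loopSol_int (hu : IsUnit (gaugeZero ρ hm hD p)) (k : ℤ) : loopSol ρ hm hD p k =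
    NormedSpace.exp (((p.1 : ℂ) * loopLog m k) • logMon ρ hm hD p) := by
  let _ : NormedAlgebra ℚ (LoopMat ρ) := NormedAlgebra.restrictScalars ℚ ℂ _
  obtain ⟨u, hu⟩ := hu
  have h1 : gaugeFn 1 (solQ ρ hm hD p) 0 = u := hu.symm
  rw [loopSol, loopAt_int, phiZero_base hm, mul_one, h1, logMon, ← hu, Ring.inverse_unit,
    ← mul_assoc, ← smul_mul_assoc, ← mul_smul_comm, NormedSpace.exp_units_conj']

lemma hasDerivAt_loopSol (hp : IsRegular ρ hm hD p) (s : ℝ) :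
    HasDerivAt (loopSol ρ hm hD p)
      (deriv (loopAt m 0) s • (loopSol ρ hm hD p s * loopPotential ρ m p.1 p.2 (loopAt m 0 s))) s := by
  have hγ : HasDerivAt (loopAt m 0) (deriv (loopAt m 0) s) s :=
    (hasDerivAt_loopAt m 0 s).differentiableAt.hasDerivAt
  have hmem := hD.loopAt_mem hm s
  have hne := loopAt_ne_one hm s
  have h1 := hasDerivAt_exp_mul_gauge hp.isGaugeSol hγ hmem hne (hasDerivAt_loopLog hm s)
  have h2 := (hasDerivAt_phiZero (ρ := ρ) m p.2.1 (loopAt m 0 s)).scomp s hγ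
  have h3 := (h1.const_mul (Ring.inverse (gaugeZero ρ hm hD p))).mul h2
  convert! h3 using 1
  have h4 := gauged_potential (ρ := ρ) hD p.1 p.2 hmem hne
  rw [loopSol]
  generalize (loopAt m 0 s - 1)⁻¹ • loopR ρ m p.2 + fn (loopH hD p.2) (loopAt m 0 s) = B at h4 ⊢
  simp only [Function.comp_apply, mul_smul_comm, smul_mul_assoc, ← smul_add] at h4 ⊢
  congr 1
  rw [mul_assoc _ _ (loopPotential ρ m p.1 p.2 (loopAt m 0 s)), ← h4]
  simp only [mul_add, mul_assoc, mul_smul_comm]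

lemma isContinuation_loopSol (hp : IsRegular ρ hm hD p) (hu : IsUnit (gaugeZero ρ hm hD p))
    {lam : ℂ} (h : ‖lam‖ = 1) :
    IsContinuation (potential m p.1 (toParam ρ p.2) lam) (loopAt m 0)
      (fun s => LoopMat.evalHom h (loopSol ρ hm hD p s)) := by
  constructor
  · have := loopSol_int (ρ := ρ) hu 0
    simp only [Int.cast_zero, loopLog_zero, mul_zero, zero_smul, NormedSpace.exp_zero] at this
    simp only [this, map_one]
  · intro s i k
    have h1 := (((LoopAlg.ev lam).comp (LoopMat.entry i k)).restrictScalars ℝ).hasFDerivAt.comp_hasDerivAt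
      s (hasDerivAt_loopSol hp s)
    convert! h1 using 1
    rw [← evalHom_loopPotential h, ← map_mul, ← LoopMat.evalHom_smul]
    rfl

lemma matM_zero_eq (hp : IsRegular ρ hm hD p) (hu : IsUnit (gaugeZero ρ hm hD p))
    {lam : ℂ} (h : ‖lam‖ = 1) : matM m 0 p.1 (toParam ρ p.2) lam =
      NormedSpace.exp ((2 * Real.pi * I * p.1 : ℂ) • LoopMat.evalHom h (logMon ρ hm hD p)) := by
  have h1 := loopSol_int (ρ := ρ) hu 1
  rw [Int.cast_one, loopLog_one] at h1
  rw [matM, (isContinuation_loopSol hp hu h).monodromy_eq (trace_potential m _ _ _), h1,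
    LoopMat.evalHom_exp, LoopMat.evalHom_smul]
  congr 2
  ring

end Solution

end DPW

namespace DPW

open scoped ComplexConjugate

/-! ### Invariance under complex conjugation. -/

section Conjugation

lemma conj_evalLoop (f : ℕ → ℝ) (lam : ℂ) : conj (evalLoop f lam) = evalLoop f (conj lam) := by
  rw [evalLoop, evalLoop, Complex.conj_tsum]
  simp

lemma conj_eq_inv {w : ℂ} (h : ‖w‖ = 1) : conj w = w⁻¹ := by
  rw [Complex.inv_def, Complex.normSq_eq_norm_sq, h]; simp

lemma norm_pole (m j : ℕ) : ‖pole m j‖ = 1 := by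
  have : (2 * Real.pi * I * j / nSing m : ℂ) = ((2 * Real.pi * j / nSing m : ℝ) : ℂ) * I := by
    push_cast; ring
  rw [pole, this, Complex.norm_exp_ofReal_mul_I]

lemma norm_dEntry (m : ℕ) : ‖dEntry m‖ = 1 := by
  have : (I * Real.pi * m / nSing m : ℂ) = ((Real.pi * m / nSing m : ℝ) : ℂ) * I := by
    push_cast; ring
  rw [dEntry, this, Complex.norm_exp_ofReal_mul_I]

variable (m : ℕ) (x : Param)

lemma conj_pole {j : ℕ} (hj : j ≤ nSing m) : conj (pole m j) = pole m (nSing m - j) := by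
  rw [conj_eq_inv (norm_pole m j)]
  refine inv_eq_of_mul_eq_one_right ?_
  rw [pole_eq m j, pole_eq m (nSing m - j), ← pow_add, Nat.add_sub_cancel' hj, ← pole_eq,
    pole_nSing]

lemma conj_matA {j : ℕ} (hj : j ≤ nSing m) (lam : ℂ) (i k : Fin 2) :
    conj (matA m x j (conj lam) i k) = matA m x (nSing m - j) lam i k := by
  have h1 : (-1 : ℂ) ^ (nSing m - j) = (-1) ^ j := by
    have hn : (-1 : ℂ) ^ nSing m = 1 := by
      rw [nSing, show 2 * m + 2 = 2 * (m + 1) by ring, pow_mul]; simp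
    have hjj : (-1 : ℂ) ^ j * (-1) ^ j = 1 := by rw [← mul_pow]; simp
    have : (-1 : ℂ) ^ (nSing m - j) * (-1) ^ j = 1 := by
      rw [← pow_add, Nat.sub_add_cancel hj, hn]
    calc (-1 : ℂ) ^ (nSing m - j) = (-1 : ℂ) ^ (nSing m - j) * ((-1) ^ j * (-1) ^ j) := by
          rw [hjj, mul_one]
      _ = (-1) ^ j := by rw [← mul_assoc, this, one_mul]
  have h2 : (dEntry m ^ 2) ^ (nSing m - j) = ((dEntry m ^ 2) ^ j)⁻¹ := by
    refine (inv_eq_of_mul_eq_one_right ?_).symm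
    rw [← pow_add, Nat.add_sub_cancel' hj, dEntry_sq_pow]
  have h3 : conj ((dEntry m ^ 2) ^ j) = ((dEntry m ^ 2) ^ j)⁻¹ :=
    conj_eq_inv (by rw [norm_pow, norm_pow, norm_dEntry]; simp)
  have h4 : conj ((-1 : ℂ) ^ j * conj lam) = (-1) ^ j * lam := by simp
  rw [matA_eq, matA_eq, h1, h2]
  fin_cases i <;> fin_cases k <;>
    simp only [Fin.mk_one, Fin.zero_eta, Matrix.of_apply, Matrix.cons_val', Matrix.cons_val_zero,
      Matrix.cons_val_one, Matrix.cons_val_fin_one, map_mul, map_inv₀, map_neg, conj_evalLoop,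
      h3, h4, inv_inv]

/-- The loops have real coefficients, and conjugation replaces the index `j` by `n - j` both in the
poles and in the residues, so it only permutes the summands. -/
lemma conj_potential (t : ℝ) (lam z : ℂ) (i k : Fin 2) :
    conj (potential m t x (conj lam) (conj z) i k) = potential m t x lam z i k := by
  have hsum : ∑ j ∈ Finset.range (nSing m), conj ((conj z - pole m j)⁻¹ * matA m x j (conj lam) i k)
      = ∑ j ∈ Finset.range (nSing m), (z - pole m j)⁻¹ * matA m x j lam i k := by
    have hshift := Finset.sum_range_succ
      (fun j => (z - pole m j)⁻¹ * matA m x j lam i k) (nSing m)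
    rw [Finset.sum_range_succ', pole_nSing, matA_nSing, pole_zero] at hshift
    rw [← add_right_cancel hshift, ← Finset.sum_range_reflect]
    refine Finset.sum_congr rfl fun j hj => ?_
    have hj' := Finset.mem_range.mp hj
    have e : nSing m - (nSing m - 1 - j) = j + 1 := by omega
    have hle : nSing m - 1 - j ≤ nSing m := by omega
    rw [map_mul, map_inv₀, map_sub, Complex.conj_conj, conj_pole m hle,
      conj_matA m x hle, e]
  have h0 : conj ((!![0, 0; (m : ℂ) * x.r * conj z ^ (m - 1), 0] : Matrix (Fin 2) (Fin 2) ℂ) i k) =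
      (!![0, 0; (m : ℂ) * x.r * z ^ (m - 1), 0] : Matrix (Fin 2) (Fin 2) ℂ) i k := by
    fin_cases i <;> fin_cases k <;> simp
  simp only [potential, Matrix.add_apply, Matrix.smul_apply, Matrix.sum_apply, smul_eq_mul,
    map_add, map_mul, Complex.conj_ofReal, h0]
  rw [← hsum, map_sum]

lemma loopAt_zero_neg (s : ℝ) : loopAt m 0 (-s) = conj (loopAt m 0 s) := by
  rw [loopAt_zero, loopAt_zero, map_mul, map_sub, map_one, Complex.conj_ofReal, ← Complex.exp_conj]
  simp [map_ofNat]

/-- Conjugation runs the loop backwards; reversing time restores its direction. -/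
lemma IsContinuation.conj_neg {t : ℝ} {lam : ℂ} {X : ℝ → Matrix (Fin 2) (Fin 2) ℂ}
    (hX : IsContinuation (potential m t x (conj lam)) (loopAt m 0) X) :
    IsContinuation (potential m t x lam) (loopAt m 0) (fun s => (X (-s)).map conj) := by
  refine ⟨?_, fun s i k => ?_⟩
  · ext i k
    simp only [neg_zero, hX.1, Matrix.map_apply, Matrix.one_apply]
    split_ifs <;> simp
  · have hd : -conj (deriv (loopAt m 0) (-s)) = deriv (loopAt m 0) s := by
      have h1 := ((hasDerivAt_loopAt m 0 (-s)).differentiableAt.hasDerivAt.scomp s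
        (hasDerivAt_neg s))
      have h2 : loopAt m 0 ∘ (fun s => -s) = fun s => conj (loopAt m 0 s) :=
        funext fun s => loopAt_zero_neg m s
      have h3 := (Complex.conjCLE.toContinuousLinearMap.hasFDerivAt.comp_hasDerivAt s h1)
      have h4 : (Complex.conjCLE.toContinuousLinearMap ∘ loopAt m 0 ∘ fun s => -s) = loopAt m 0 := by
        rw [h2]; funext s; simp
      rw [h4] at h3
      rw [h3.deriv]
      simp
    have h1 := (hX.2 (-s) i k).scomp s (hasDerivAt_neg s)
    have h2 := Complex.conjCLE.toContinuousLinearMap.hasFDerivAt.comp_hasDerivAt s h1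
    convert! h2 using 1
    rw [← hd]
    simp only [Matrix.smul_apply, Matrix.mul_apply, Fin.sum_univ_two, Matrix.map_apply,
      ContinuousLinearEquiv.coe_coe, Complex.conjCLE_apply, smul_eq_mul, map_mul, map_add,
      loopAt_zero_neg, conj_potential, neg_smul, one_smul, map_neg]
    ring

end Conjugation

/-! ### The logarithm of the monodromy: size, invariants, reality. -/

section Monodromy

open bddHol

variable {ρ : ℝ} [Fact (1 < ρ)] {m : ℕ} {r d : ℝ}

lemma LoopAlg.norm_ev_le (lam : ℂ) (T : LoopAlg ρ) : ‖ev lam T‖ ≤ ‖coeff T‖ := by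
  refine ((evalFun ρ lam).le_opNorm (coeff T)).trans ?_
  exact mul_le_of_le_one_left (norm_nonneg _) (norm_wsum_le _ zero_le_one _)

/-- The parameters `p = (t, v)` for which the gauge is defined and the logarithm of the monodromy
is small. -/
structure IsSmall (ρ : ℝ) [Fact (1 < ρ)] (hm : 1 ≤ m) (hD : IsDisc m r d) (p : ℝ × ParamSpace) :
    Prop where
  regular : IsRegular ρ hm hD p
  unit : IsUnit (gaugeZero ρ hm hD p)
  small : ∀ i k, 2 * Real.pi * |p.1| * ‖LoopAlg.coeff (LoopMat.entry i k (logMon ρ hm hD p))‖ < 1 / 4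

lemma continuousAt_coeff_entry_logMon (hm : 1 ≤ m) (hD : IsDisc m r d) (v : ParamSpace)
    (i k : Fin 2) : ContinuousAt (fun p : ℝ × ParamSpace =>
      LoopAlg.coeff (LoopMat.entry i k (logMon ρ hm hD p))) (0, v) :=
  ContinuousAt.comp (g := fun M => LoopAlg.coeff (LoopMat.entry i k M))
    ((LoopAlg.coeff (ρ := ρ)).continuous.comp (LoopMat.entry i k).continuous).continuousAt
    (contDiffAt_logMon (ρ := ρ) hm hD (n := 0) v).continuousAt

lemma eventually_small (hm : 1 ≤ m) (hD : IsDisc m r d) (v : ParamSpace) (i k : Fin 2) :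
    ∀ᶠ p in nhds ((0 : ℝ), v),
      2 * Real.pi * |p.1| * ‖LoopAlg.coeff (LoopMat.entry i k (logMon ρ hm hD p))‖ < 1 / 4 := by
  have h1 := (continuous_const (y := 2 * Real.pi) |>.mul
    (continuous_fst (X := ℝ) (Y := ParamSpace)).abs).continuousAt.mul
    (continuousAt_coeff_entry_logMon (ρ := ρ) hm hD v i k).norm
  refine Filter.Tendsto.eventually_lt_const (v := 2 * Real.pi * |(0 : ℝ)| *
    ‖LoopAlg.coeff (LoopMat.entry i k (logMon ρ hm hD (0, v)))‖) ?_ h1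
  rw [abs_zero, mul_zero, zero_mul]
  norm_num

lemma eventually_isSmall (hm : 1 ≤ m) (hD : IsDisc m r d) (v : ParamSpace) :
    ∀ᶠ p in nhds ((0 : ℝ), v), IsSmall ρ hm hD p := by
  have h3 : ∀ᶠ p in nhds ((0 : ℝ), v), ∀ i k,
      2 * Real.pi * |p.1| * ‖LoopAlg.coeff (LoopMat.entry i k (logMon ρ hm hD p))‖ < 1 / 4 :=
    Filter.eventually_all.mpr fun i => Filter.eventually_all.mpr fun k =>
      eventually_small hm hD v i k
  exact ((eventually_isRegular (ρ := ρ) hm hD v).and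
    ((eventually_isUnit_gaugeZero (ρ := ρ) hm hD v).and h3)).mono
    fun p h => ⟨h.1, h.2.1, h.2.2⟩

/-- Cayley–Hamilton; it provides the scalar square required by `matLog_exp`. -/
lemma mul_self_of_trace_eq_zero {A : Matrix (Fin 2) (Fin 2) ℂ} (h : A.trace = 0) :
    A * A = (-A.det) • (1 : Matrix (Fin 2) (Fin 2) ℂ) := by
  rw [Matrix.trace_fin_two] at h
  rw [Matrix.det_fin_two]
  have h1 : A 1 1 = -A 0 0 := by linear_combination h
  ext i k
  fin_cases i <;> fin_cases k <;>
    simp [Matrix.mul_apply, Fin.sum_univ_two, h1] <;> ring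

variable {hm : 1 ≤ m} {hD : IsDisc m r d} {p : ℝ × ParamSpace} {lam : ℂ}

/-- `R` is conjugate to `A_0` through `Φ_0(1)`, and `logMon` to `R` through the gauge. Trace and
determinant are therefore those of `A_0`. -/
lemma exists_conj_eq_logMon (hu : IsUnit (gaugeZero ρ hm hD p)) (h : ‖lam‖ = 1) :
    ∃ U : (Matrix (Fin 2) (Fin 2) ℂ)ˣ, LoopMat.evalHom h (logMon ρ hm hD p) =
      (U⁻¹ : (Matrix (Fin 2) (Fin 2) ℂ)ˣ) * matA m (toParam ρ p.2) 0 lam * U := by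
  obtain ⟨u, hu⟩ := hu
  have hg : (1 + (p.2.1 : ℂ) • nil ρ) * (1 - (p.2.1 : ℂ) • nil ρ) = 1 := by
    simp only [add_mul, mul_sub, one_mul, mul_one, mul_smul_comm, smul_mul_assoc, nil_mul_nil,
      smul_zero]
    module
  have hg' : (1 - (p.2.1 : ℂ) • nil ρ) * (1 + (p.2.1 : ℂ) • nil ρ) = 1 := by
    simp only [sub_mul, mul_add, one_mul, mul_one, mul_smul_comm, smul_mul_assoc, nil_mul_nil,
      smul_zero]
    module
  let g : (LoopMat ρ)ˣ := ⟨_, _, hg, hg'⟩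
  have hR : loopR ρ m p.2 = g * loopA ρ m 0 p.2 * (g⁻¹ : (LoopMat ρ)ˣ) := by
    have h1 := conjNil_mul_phiZero (ρ := ρ) m p.2.1 1 (loopA ρ m 0 p.2)
    have h2 : phiZero ρ m p.2.1 1 = g := by simp [phiZero, g]
    rw [h2, one_pow, one_pow] at h1
    rw [← h1, mul_assoc, Units.mul_inv, mul_one]
    rfl
  refine ⟨Units.map (LoopMat.evalHom h).toMonoidHom (g⁻¹ * u), ?_⟩
  rw [← evalHom_loopA h, logMon, hR, ← hu, Ring.inverse_unit]
  simp only [← map_inv, Units.coe_map, RingHom.toMonoidHom_eq_coe, MonoidHom.coe_coe, ← map_mul,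
    _root_.mul_inv_rev, inv_inv, Units.val_mul]
  simp only [mul_assoc]

lemma trace_logMon (hu : IsUnit (gaugeZero ρ hm hD p)) (h : ‖lam‖ = 1) :
    (LoopMat.evalHom h (logMon ρ hm hD p)).trace = 0 := by
  obtain ⟨U, hU⟩ := exists_conj_eq_logMon hu h
  rw [hU, Matrix.trace_mul_comm, ← mul_assoc, Units.mul_inv, one_mul, trace_matA]

lemma det_logMon (hu : IsUnit (gaugeZero ρ hm hD p)) (h : ‖lam‖ = 1) :
    (LoopMat.evalHom h (logMon ρ hm hD p)).det = (matA m (toParam ρ p.2) 0 lam).det := by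
  obtain ⟨U, hU⟩ := exists_conj_eq_logMon hu h
  rw [hU, Matrix.det_mul, Matrix.det_mul, mul_right_comm, ← Matrix.det_mul, Units.inv_mul,
    Matrix.det_one, one_mul]

/-- All entries of `2πi t L` are below `1/4` in modulus, so its determinant is at most `1/8`, within
the range of `matLog_exp`. -/
lemma IsSmall.norm_lt (hp : IsSmall ρ hm hD p) (h : ‖lam‖ = 1) :
    ‖(2 * Real.pi * I * p.1 : ℂ) ^ 2 * -(LoopMat.evalHom h (logMon ρ hm hD p)).det‖ < 1 / 4 := by
  have hb : ∀ i k, ‖(2 * Real.pi * I * p.1 : ℂ) * LoopMat.evalHom h (logMon ρ hm hD p) i k‖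
      < 1 / 4 := by
    intro i k
    refine lt_of_le_of_lt ?_ (hp.small i k)
    rw [norm_mul, LoopMat.evalHom_apply]
    have : ‖(2 * Real.pi * I * p.1 : ℂ)‖ = 2 * Real.pi * |p.1| := by
      simp [abs_of_pos Real.pi_pos]
    rw [this]
    exact mul_le_mul_of_nonneg_left (LoopAlg.norm_ev_le _ _) (by positivity)
  rw [Matrix.det_fin_two]
  generalize (2 * Real.pi * I * p.1 : ℂ) = c at *
  generalize LoopMat.evalHom h (logMon ρ hm hD p) = M at *
  have e : c ^ 2 * -(M 0 0 * M 1 1 - M 0 1 * M 1 0) =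
      (c * M 0 1) * (c * M 1 0) - (c * M 0 0) * (c * M 1 1) := by ring
  rw [e]
  have h1 := norm_sub_le ((c * M 0 1) * (c * M 1 0)) ((c * M 0 0) * (c * M 1 1))
  rw [norm_mul (c * M 0 1), norm_mul (c * M 0 0)] at h1
  have h2 := mul_le_mul (hb 0 1).le (hb 1 0).le (norm_nonneg _) (by norm_num)
  have h3 := mul_le_mul (hb 0 0).le (hb 1 1).le (norm_nonneg _) (by norm_num)
  linarith

lemma smul_logMon_mul_self (hu : IsUnit (gaugeZero ρ hm hD p)) (h : ‖lam‖ = 1) (c : ℂ) :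
    (c • LoopMat.evalHom h (logMon ρ hm hD p)) * (c • LoopMat.evalHom h (logMon ρ hm hD p)) =
      (c ^ 2 * -(LoopMat.evalHom h (logMon ρ hm hD p)).det) • 1 := by
  rw [smul_mul_smul_comm, mul_self_of_trace_eq_zero (trace_logMon hu h), smul_smul, pow_two]

lemma IsSmall.matMtilde_eq (hp : IsSmall ρ hm hD p) (ht : p.1 ≠ 0) (h : ‖lam‖ = 1) :
    matMtilde m p.1 (toParam ρ p.2) lam =
      (2 * Real.pi * I : ℂ) • LoopMat.evalHom h (logMon ρ hm hD p) := by
  have ht' : (p.1 : ℂ) ≠ 0 := by exact_mod_cast ht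
  rw [matMtilde, matM_zero_eq hp.regular hp.unit h,
    matLog_exp (smul_logMon_mul_self hp.unit h _) (hp.norm_lt h), smul_smul]
  congr 1
  field_simp

/-- The continuation once backwards at `conj λ` is `exp(-2πi t L(conj λ))`, and its conjugate is the
forward monodromy at `λ`. Thus `exp(2πi t L(λ)) = exp(2πi t conj L(conj λ))`; both exponents are
small enough for the logarithm series to recover them. -/
lemma IsSmall.conj_logMon (hp : IsSmall ρ hm hD p) (ht : p.1 ≠ 0) (h : ‖lam‖ = 1)
    (h' : ‖conj lam‖ = 1) (i k : Fin 2) :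
    conj (LoopMat.evalHom h' (logMon ρ hm hD p) i k) =
      LoopMat.evalHom h (logMon ρ hm hD p) i k := by
  set M := LoopMat.evalHom h (logMon ρ hm hD p) with hM
  set M' := LoopMat.evalHom h' (logMon ρ hm hD p) with hM'
  set c : ℂ := 2 * Real.pi * I * p.1 with hc
  have hc0 : c ≠ 0 := by
    simp [hc, ht, Real.pi_ne_zero]
  have hcc : conj c = -c := by simp [hc, map_ofNat]
  have h1 : matM m 0 p.1 (toParam ρ p.2) lam =
      (LoopMat.evalHom h' (loopSol ρ hm hD p (-1))).map conj :=
    ((isContinuation_loopSol hp.regular hp.unit h').conj_neg m _).monodromy_eq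
      (trace_potential m _ _ _)
  have h2 := loopSol_int (ρ := ρ) hp.unit (-1)
  have hcast : (((-1 : ℤ)) : ℝ) = -1 := by norm_num
  rw [hcast, loopLog_neg_one] at h2
  have h3 : (p.1 : ℂ) * -(2 * Real.pi * I) = -c := by rw [hc]; ring
  rw [matM_zero_eq hp.regular hp.unit h, h2, LoopMat.evalHom_exp, LoopMat.evalHom_smul, ← hM,
    ← hM', ← hc, h3] at h1
  have hmap : ∀ Y : Matrix (Fin 2) (Fin 2) ℂ,
      (NormedSpace.exp Y).map conj = NormedSpace.exp (Y.map conj) := fun Y => by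
    open scoped Matrix.Norms.Operator in
    exact NormedSpace.map_exp ((starRingEnd ℂ).mapMatrix (m := Fin 2))
      (continuous_id.matrix_map Complex.continuous_conj) Y
  rw [hmap] at h1
  have h4 : (-c • M').map conj = c • M'.map conj := by
    ext i k
    simp only [Matrix.map_apply, Matrix.smul_apply, smul_eq_mul, map_mul, map_neg, hcc, neg_neg]
  rw [h4] at h1
  have h5 : (c • M'.map conj) * (c • M'.map conj) = (c ^ 2 * -(conj M'.det)) • 1 := by
    have e := mul_self_of_trace_eq_zero (A := M'.map conj) (by
      have := trace_logMon (ρ := ρ) hp.unit h'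
      rw [Matrix.trace_fin_two] at this ⊢
      rw [Matrix.map_apply, Matrix.map_apply, ← map_add, this, map_zero])
    have hdet : (M'.map conj).det = conj M'.det := ((starRingEnd ℂ).map_det M').symm
    rw [smul_mul_smul_comm, e, smul_smul, pow_two, hdet]
  have h6 : ‖c ^ 2 * -(conj M'.det)‖ < 1 / 4 := by
    have := hp.norm_lt h'
    rw [← hc, ← hM'] at this
    rw [← map_neg, norm_mul, RCLike.norm_conj, ← norm_mul]
    exact this
  have h7 := congrArg matLog h1
  rw [matLog_exp (smul_logMon_mul_self hp.unit h c) (hp.norm_lt h), matLog_exp h5 h6] at h7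
  have h8 := congrFun (congrFun h7 i) k
  simp only [Matrix.smul_apply, Matrix.map_apply, smul_eq_mul] at h8
  exact (mul_left_cancel₀ hc0 h8).symm

lemma norm_conj_eq_one (h : ‖lam‖ = 1) : ‖conj lam‖ = 1 := by rwa [RCLike.norm_conj]

/-- The Fourier coefficients of the logarithm of the monodromy are real. -/
lemma IsSmall.conj_fc (hp : IsSmall ρ hm hD p) (ht : p.1 ≠ 0) (i k : Fin 2) (n : ℤ) :
    conj (LoopAlg.fc (LoopMat.entry i k (logMon ρ hm hD p)) n) =
      LoopAlg.fc (LoopMat.entry i k (logMon ρ hm hD p)) n := by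
  set T := LoopMat.entry i k (logMon ρ hm hD p) with hT
  have hs : Summable fun n => ‖conj (LoopAlg.fc T n) - LoopAlg.fc T n‖ := by
    refine .of_nonneg_of_le (fun _ => norm_nonneg _) (fun n => norm_sub_le _ _) ?_
    simp only [RCLike.norm_conj]
    exact (LoopAlg.summable_fc T).add (LoopAlg.summable_fc T)
  refine sub_eq_zero.mp (eq_zero_of_forall_hasSum_circle hs (fun lam h => ?_) n)
  have h' := norm_conj_eq_one h
  have h1 := LoopAlg.hasSum_ev h T
  have h2 := (LoopAlg.hasSum_ev h' T).mapL (Complex.conjCLE.toContinuousLinearMap)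
  have h3 := hp.conj_logMon ht h h' i k
  rw [LoopMat.evalHom_apply, LoopMat.evalHom_apply, ← hT] at h3
  have h4 := h2.sub h1
  simp only [ContinuousLinearEquiv.coe_coe, Complex.conjCLE_apply] at h4
  rw [h3, sub_self] at h4
  convert! h4 using 2 with n
  simp only [map_mul, map_zpow₀, Complex.conj_conj]
  ring

end Monodromy

end DPW

namespace DPW

open scoped ComplexConjugate

/-! ### Translation of the system into Fourier coefficients. -/

section System

open LoopAlg LoopMat

variable {ρ : ℝ} [Fact (1 < ρ)] {m : ℕ} {r d : ℝ} {hm : 1 ≤ m} {hD : IsDisc m r d}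
  {p : ℝ × ParamSpace}

lemma LoopAlg.hasSum_conj_ev {lam : ℂ} (h : ‖lam‖ = 1) {T : LoopAlg ρ}
    (hT : ∀ n, conj (fc T n) = fc T n) :
    HasSum (fun k => fc T (-k) * lam ^ k) (conj (ev lam T)) := by
  have h1 := (LoopAlg.hasSum_ev h T).mapL (Complex.conjCLE.toContinuousLinearMap)
  rw [← (Equiv.neg ℤ).hasSum_iff] at h1
  convert! h1 using 2 with k
  simp only [Function.comp_apply, Equiv.neg_apply, ContinuousLinearEquiv.coe_coe,
    Complex.conjCLE_apply, map_mul, hT, map_zpow₀, conj_eq_inv h, _root_.inv_zpow, _root_.zpow_neg, inv_inv]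

/-- An element `S` of the loop algebra agrees with `T^*` if and only if the Fourier coefficients
match. -/
lemma LoopAlg.forall_sub_conj_ev_eq_zero_iff {S T : LoopAlg ρ}
    (hT : ∀ n, conj (fc T n) = fc T n) :
    (∀ lam : ℂ, ‖lam‖ = 1 → ev lam S - conj (ev lam T) = 0) ↔ ∀ k, fc S k = fc T (-k) := by
  have hsum : ∀ lam : ℂ, ‖lam‖ = 1 →
      HasSum (fun k => (fc S k - fc T (-k)) * lam ^ k) (ev lam S - conj (ev lam T)) := by
    intro lam h
    have := (LoopAlg.hasSum_ev h S).sub (LoopAlg.hasSum_conj_ev h hT)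
    simpa only [sub_mul] using this
  constructor
  · intro h k
    have hs : Summable fun k => ‖fc S k - fc T (-k)‖ := by
      refine .of_nonneg_of_le (fun _ => norm_nonneg _) (fun n => norm_sub_le _ _) ?_
      exact (summable_fc S).add ((Equiv.neg ℤ).summable_iff.mpr (summable_fc T))
    refine sub_eq_zero.mp (eq_zero_of_forall_hasSum_circle hs (fun lam hl => ?_) k)
    rw [← h lam hl]
    exact hsum lam hl
  · intro h lam hl
    refine (hsum lam hl).unique ?_
    simp only [h, sub_self, zero_mul]
    exact hasSum_zero

/-- Since `2πi` is purely imaginary, removing this factor turns the sum with the conjugate into a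
difference. -/
lemma IsSmall.eqF_eq (hp : IsSmall ρ hm hD p) (ht : p.1 ≠ 0) {lam : ℂ} (h : ‖lam‖ = 1) :
    eqF m p.1 (toParam ρ p.2) lam = ev lam (entry 0 0 (logMon ρ hm hD p)) -
      conj (ev lam (entry 0 0 (logMon ρ hm hD p))) := by
  have h2 : (2 * Real.pi * I : ℂ) ≠ 0 := Complex.two_pi_I_ne_zero
  have hc : conj (2 * Real.pi * I : ℂ) = -(2 * Real.pi * I) := by simp [map_ofNat]
  rw [eqF, hp.matMtilde_eq ht h, Matrix.smul_apply, evalHom_apply, smul_eq_mul, map_mul, hc]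
  field_simp
  ring

lemma IsSmall.eqG_eq (hp : IsSmall ρ hm hD p) (ht : p.1 ≠ 0) {lam : ℂ} (h : ‖lam‖ = 1) :
    eqG m p.1 (toParam ρ p.2) lam = ev lam (entry 1 0 (logMon ρ hm hD p)) -
      conj (ev lam (entry 0 1 (logMon ρ hm hD p))) := by
  have h2 : (2 * Real.pi * I : ℂ) ≠ 0 := Complex.two_pi_I_ne_zero
  have hc : conj (2 * Real.pi * I : ℂ) = -(2 * Real.pi * I) := by simp [map_ofNat]
  rw [eqG, hp.matMtilde_eq ht h, Matrix.smul_apply, Matrix.smul_apply, evalHom_apply,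
    evalHom_apply, smul_eq_mul, smul_eq_mul, map_mul, hc]
  field_simp
  ring

lemma IsSmall.eqH_eq (hp : IsSmall ρ hm hD p) (ht : p.1 ≠ 0) {lam : ℂ} (h : ‖lam‖ = 1) :
    eqH m p.1 (toParam ρ p.2) lam = ev lam (entry 0 1 (logMon ρ hm hD p)) := by
  have h2 : (2 * Real.pi * I : ℂ) ≠ 0 := Complex.two_pi_I_ne_zero
  rw [eqH, hp.matMtilde_eq ht h, Matrix.smul_apply, evalHom_apply, smul_eq_mul,
    inv_mul_cancel_left₀ h2]

/-! ### The system as an equation in a Banach space -/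

/-- The real parts of the members of a summable family along an injective map. -/
noncomputable def reIdx (φ : ℕ → ℤ) (hφ : Function.Injective φ) : L1 ℤ ℂ →L[ℝ] L1 ℕ ℝ :=
  have hs : ∀ f : L1 ℤ ℂ, Summable fun k => ‖(f (φ k)).re‖ := fun f =>
    .of_nonneg_of_le (fun _ => norm_nonneg _) (fun k => Complex.abs_re_le_norm (f (φ k)))
      ((L1.summable f).comp_injective hφ)
  LinearMap.mkContinuous
    { toFun := fun f => L1.mk (fun k => (f (φ k)).re) (hs f)
      map_add' := fun f g => by ext k; simp
      map_smul' := fun c f => by ext k; simp } 1 (fun f => by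
        rw [one_mul, L1.norm_eq, L1.norm_eq f]
        calc ∑' k, ‖(f (φ k)).re‖ ≤ ∑' k, ‖f (φ k)‖ := (hs f).tsum_le_tsum
              (fun k => Complex.abs_re_le_norm (f (φ k))) ((L1.summable f).comp_injective hφ)
          _ ≤ ∑' k, ‖f k‖ := tsum_comp_le_tsum_of_inj (L1.summable f) (fun _ => norm_nonneg _) hφ)

lemma injective_natCast_add (j : ℤ) : Function.Injective fun k : ℕ => (k : ℤ) + j :=
  fun a b h => by simpa using h

lemma injective_neg_natCast_add (j : ℤ) : Function.Injective fun k : ℕ => -((k : ℤ) + j) :=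
  fun a b h => by simpa using h

/-- The real parts of the weighted Fourier coefficients of index `k + j`. -/
noncomputable def posC (ρ : ℝ) [Fact (1 < ρ)] (j : ℤ) (i k : Fin 2) : LoopMat ρ →L[ℝ] L1 ℕ ℝ :=
  (reIdx _ (injective_natCast_add j)).comp (((coeff (ρ := ρ)).comp (entry i k)).restrictScalars ℝ)

/-- The real parts of the weighted Fourier coefficients of index `-(k + j)`. -/
noncomputable def negC (ρ : ℝ) [Fact (1 < ρ)] (j : ℤ) (i k : Fin 2) : LoopMat ρ →L[ℝ] L1 ℕ ℝ :=
  (reIdx _ (injective_neg_natCast_add j)).comp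
    (((coeff (ρ := ρ)).comp (entry i k)).restrictScalars ℝ)

lemma coeff_eq (T : LoopAlg ρ) (k : ℤ) : coeff T k = fc T k * (weight ρ k : ℂ) := by
  have h : (weight ρ k : ℂ) ≠ 0 := by exact_mod_cast (weight_pos k).ne'
  rw [fc, div_mul_cancel₀ _ h]

lemma posC_apply (j : ℤ) (i k : Fin 2) (M : LoopMat ρ) (n : ℕ) :
    posC ρ j i k M n = (fc (entry i k M) (n + j)).re * weight ρ (n + j) := by
  have : posC ρ j i k M n = (coeff (entry i k M) (n + j)).re := rfl
  rw [this, coeff_eq, Complex.re_mul_ofReal]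

lemma negC_apply (j : ℤ) (i k : Fin 2) (M : LoopMat ρ) (n : ℕ) :
    negC ρ j i k M n = (fc (entry i k M) (-(n + j))).re * weight ρ (n + j) := by
  have : negC ρ j i k M n = (coeff (entry i k M) (-(n + j))).re := rfl
  rw [this, coeff_eq, Complex.re_mul_ofReal, weight, weight, Int.natAbs_neg]

/-- The target of the system. -/
abbrev SysSpace := L1 ℕ ℝ × L1 ℕ ℝ × L1 ℕ ℝ × ℝ × ℝ

/-- The linear part of the system, as a function of the logarithm of the monodromy. -/
noncomputable def sysL (ρ : ℝ) [Fact (1 < ρ)] : LoopMat ρ →L[ℝ] SysSpace :=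
  -- The diagonal entry is compared with its own star, so index `0` is void and negative indices
  -- repeat positive ones. The off-diagonal comparison involves two entries and needs every index,
  -- split into `k ≥ 0` and `k ≤ -1`.
  (posC ρ 1 0 0 - negC ρ 1 0 0).prod <| (posC ρ 0 1 0 - negC ρ 0 0 1).prod <|
    (negC ρ 1 1 0 - posC ρ 1 0 1).prod <|
    (Complex.reCLM.comp (((ev (ρ := ρ) 1).comp (entry 0 1)).restrictScalars ℝ)).prod
    (Complex.reCLM.comp (((ev (ρ := ρ) (-1)).comp (entry 0 1)).restrictScalars ℝ))

/-- The constant coefficient of `a^2 + b c - 1`. -/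
noncomputable def sysK (v : ParamSpace) : ℝ := v.2.1 0 ^ 2 + v.2.2.1 0 * v.2.2.2 0 - 1

/-- The system as a map between Banach spaces. -/
noncomputable def sys (ρ : ℝ) [Fact (1 < ρ)] (hm : 1 ≤ m) (hD : IsDisc m r d)
    (p : ℝ × ParamSpace) : SysSpace × ℝ :=
  (sysL ρ (logMon ρ hm hD p), sysK p.2)

lemma L1.ext_iff {f g : L1 ℕ ℝ} : f = g ↔ ∀ n, f n = g n :=
  ⟨fun h n => by rw [h], fun h => lp.ext (funext h)⟩

lemma IsSmall.im_fc (hp : IsSmall ρ hm hD p) (ht : p.1 ≠ 0) (i k : Fin 2) (n : ℤ) :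
    (fc (entry i k (logMon ρ hm hD p)) n).im = 0 :=
  Complex.conj_eq_iff_im.mp (hp.conj_fc ht i k n)

lemma IsSmall.re_eq_re_iff (hp : IsSmall ρ hm hD p) (ht : p.1 ≠ 0) (i k i' k' : Fin 2) (n n' : ℤ)
    (j : ℤ) : (fc (entry i k (logMon ρ hm hD p)) n).re * weight ρ j -
      (fc (entry i' k' (logMon ρ hm hD p)) n').re * weight ρ j = 0 ↔
    fc (entry i k (logMon ρ hm hD p)) n = fc (entry i' k' (logMon ρ hm hD p)) n' := by
  rw [← sub_mul, mul_eq_zero, or_iff_left (weight_pos j).ne', sub_eq_zero, Complex.ext_iff,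
    hp.im_fc ht, hp.im_fc ht]
  simp

/-- The system is equivalent to the equation in the Banach space. -/
lemma IsSmall.solvesSystem_iff (hp : IsSmall ρ hm hD p) (ht : p.1 ≠ 0) :
    SolvesSystem m p.1 (toParam ρ p.2) ↔ sys ρ hm hD p = 0 := by
  have hF : (∀ lam : ℂ, ‖lam‖ = 1 → eqF m p.1 (toParam ρ p.2) lam = 0) ↔
      (posC ρ 1 0 0 - negC ρ 1 0 0) (logMon ρ hm hD p) = 0 := by
    rw [forall₂_congr fun lam h => by rw [hp.eqF_eq ht h],
      LoopAlg.forall_sub_conj_ev_eq_zero_iff (hp.conj_fc ht 0 0), L1.ext_iff]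
    simp only [_root_.sub_apply, lp.coeFn_sub, Pi.sub_apply, posC_apply, negC_apply, lp.coeFn_zero,
      Pi.zero_apply, hp.re_eq_re_iff ht]
    constructor
    · intro h n
      exact h _
    · intro h k
      rcases lt_trichotomy k 0 with hk | rfl | hk
      · obtain ⟨n, rfl⟩ : ∃ n : ℕ, k = -((n : ℤ) + 1) := ⟨(-k - 1).toNat, by omega⟩
        rw [neg_neg]
        exact (h n).symm
      · rw [neg_zero]
      · obtain ⟨n, rfl⟩ : ∃ n : ℕ, k = (n : ℤ) + 1 := ⟨(k - 1).toNat, by omega⟩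
        exact h n
  have hG : (∀ lam : ℂ, ‖lam‖ = 1 → eqG m p.1 (toParam ρ p.2) lam = 0) ↔
      (posC ρ 0 1 0 - negC ρ 0 0 1) (logMon ρ hm hD p) = 0 ∧
      (negC ρ 1 1 0 - posC ρ 1 0 1) (logMon ρ hm hD p) = 0 := by
    rw [forall₂_congr fun lam h => by rw [hp.eqG_eq ht h],
      LoopAlg.forall_sub_conj_ev_eq_zero_iff (hp.conj_fc ht 0 1), L1.ext_iff, L1.ext_iff]
    simp only [_root_.sub_apply, lp.coeFn_sub, Pi.sub_apply, posC_apply, negC_apply, lp.coeFn_zero,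
      Pi.zero_apply, hp.re_eq_re_iff ht]
    constructor
    · intro h
      exact ⟨fun n => h _, fun n => by rw [h, neg_neg]⟩
    · rintro ⟨h1, h2⟩ k
      rcases lt_or_ge k 0 with hk | hk
      · obtain ⟨n, rfl⟩ : ∃ n : ℕ, k = -((n : ℤ) + 1) := ⟨(-k - 1).toNat, by omega⟩
        rw [h2 n, neg_neg]
      · obtain ⟨n, rfl⟩ : ∃ n : ℕ, k = (n : ℤ) + 0 := ⟨k.toNat, by omega⟩
        exact h1 n
  have hH : ∀ lam : ℂ, ‖lam‖ = 1 → conj lam = lam → (eqH m p.1 (toParam ρ p.2) lam = 0 ↔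
      (ev lam (entry 0 1 (logMon ρ hm hD p))).re = 0) := by
    intro lam h hc
    have h1 := hp.conj_logMon ht h (norm_conj_eq_one h) 0 1
    rw [evalHom_apply, evalHom_apply, hc, Complex.conj_eq_iff_im] at h1
    rw [hp.eqH_eq ht h, Complex.ext_iff, h1]
    simp
  have hK : eqK (toParam ρ p.2) = 1 ↔ sysK p.2 = 0 := by
    simp [eqK, sysK, toParam, sub_eq_zero]
  rw [SolvesSystem, hF, hG, hH 1 (by simp) (by simp), hH (-1) (by simp) (by simp), hK, sys,
    Prod.mk_eq_zero]
  simp only [sysL, ContinuousLinearMap.prod_apply, Prod.mk_eq_zero, and_assoc]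
  rfl

end System

/-! ### Consequences of the system -/

section Consequences

lemma summable_abs_of_summable {f : ℕ → ℝ} (hf : Summable fun k => |f k|) {lam : ℂ}
    (h : ‖lam‖ = 1) : Summable fun k => ‖(f k : ℂ) * lam ^ k‖ := by
  simpa [h] using hf

/-- A power series with real coefficients whose values `a^2 + b c` on the unit circle are real is
constant. -/
lemma evalLoop_sq_add_mul_eq {a b c : ℕ → ℝ} (ha : Summable fun k => |a k|)
    (hb : Summable fun k => |b k|) (hc : Summable fun k => |c k|)
    (hreal : ∀ lam : ℂ, ‖lam‖ = 1 →
      conj (evalLoop a lam ^ 2 + evalLoop b lam * evalLoop c lam) =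
        evalLoop a lam ^ 2 + evalLoop b lam * evalLoop c lam) {lam : ℂ} (h : ‖lam‖ = 1) :
    evalLoop a lam ^ 2 + evalLoop b lam * evalLoop c lam = (a 0 ^ 2 + b 0 * c 0 : ℝ) := by
  obtain ⟨cv, hcv⟩ : ∃ cv : (ℕ → ℝ) → (ℕ → ℝ) → ℕ → ℝ, ∀ f g n,
      cv f g n = ∑ x ∈ Finset.HasAntidiagonal.antidiagonal n, f x.1 * g x.2 := ⟨_, fun _ _ _ => rfl⟩
  have hcvs : ∀ f g : ℕ → ℝ, (Summable fun k => |f k|) → (Summable fun k => |g k|) →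
      Summable fun n => |cv f g n| := by
    intro f g hf hg
    simp only [hcv]
    exact summable_norm_sum_mul_antidiagonal_of_summable_norm (f := f) (g := g) hf hg
  have hcvsum : ∀ f g : ℕ → ℝ, (Summable fun k => |f k|) → (Summable fun k => |g k|) →
      ∀ lam : ℂ, ‖lam‖ = 1 → evalLoop f lam * evalLoop g lam = evalLoop (cv f g) lam := by
    intro f g hf hg lam hl
    rw [evalLoop, evalLoop, evalLoop, tsum_mul_tsum_eq_tsum_sum_antidiagonal_of_summable_norm
      (summable_abs_of_summable hf hl) (summable_abs_of_summable hg hl)]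
    refine tsum_congr fun n => ?_
    rw [hcv, Complex.ofReal_sum, Finset.sum_mul]
    refine Finset.sum_congr rfl fun x hx => ?_
    rw [← Finset.HasAntidiagonal.mem_antidiagonal.mp hx, pow_add]
    push_cast
    ring
  obtain ⟨s, hs⟩ : ∃ s : ℕ → ℝ, s = cv a a + cv b c := ⟨_, rfl⟩
  have hss : Summable fun n => |s n| := by
    rw [hs]
    exact .of_nonneg_of_le (fun _ => abs_nonneg _) (fun n => abs_add_le _ _)
      ((hcvs a a ha ha).add (hcvs b c hb hc))
  have hval : ∀ lam : ℂ, ‖lam‖ = 1 →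
      HasSum (fun n => (s n : ℂ) * lam ^ n)
        (evalLoop a lam ^ 2 + evalLoop b lam * evalLoop c lam) := by
    intro lam hl
    rw [pow_two, hcvsum a a ha ha lam hl, hcvsum b c hb hc lam hl]
    have h1 := ((summable_abs_of_summable (hcvs a a ha ha) hl).of_norm.hasSum).add
      ((summable_abs_of_summable (hcvs b c hb hc) hl).of_norm.hasSum)
    rw [evalLoop, evalLoop]
    convert! h1 using 2 with n
    simp only [hs, Pi.add_apply]
    push_cast
    ring
  obtain ⟨f, hf⟩ : ∃ f : ℤ → ℂ, ∀ k, f k = if 0 ≤ k then (s k.toNat : ℂ) else 0 := ⟨_, fun _ => rfl⟩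
  have hfn : ∀ n : ℕ, f n = s n := fun n => by simp [hf]
  have hf0 : ∀ k ∉ Set.range ((↑) : ℕ → ℤ), f k = 0 := by
    intro k hk
    rw [hf, if_neg]
    intro h0
    exact hk ⟨k.toNat, by omega⟩
  have hfs : Summable fun k => ‖f k‖ := by
    rw [← Nat.cast_injective.summable_iff (f := fun k : ℤ => ‖f k‖) (g := ((↑) : ℕ → ℤ))
      (fun k hk => by rw [hf0 k hk, norm_zero])]
    simpa [Function.comp_def, hfn] using hss
  have hfval : ∀ lam : ℂ, ‖lam‖ = 1 → HasSum (fun k : ℤ => f k * lam ^ k)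
      (evalLoop a lam ^ 2 + evalLoop b lam * evalLoop c lam) := by
    intro lam hl
    rw [← Nat.cast_injective.hasSum_iff (f := fun k : ℤ => f k * lam ^ k) (g := ((↑) : ℕ → ℤ))
      (fun k hk => by rw [hf0 k hk, zero_mul])]
    convert! hval lam hl using 2 with n
    simp [hfn]
  have hconj : ∀ k, conj (f k) = f k := by
    intro k
    rw [hf]
    split_ifs <;> simp
  -- Real values together with real coefficients force `f k = f (-k)`. The negative modes vanish, so
  -- only `f 0` survives.
  have hzero : ∀ k, f k - f (-k) = 0 := by
    refine eq_zero_of_forall_hasSum_circle ?_ ?_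
    · refine .of_nonneg_of_le (fun _ => norm_nonneg _) (fun n => norm_sub_le _ _) ?_
      exact hfs.add ((Equiv.neg ℤ).summable_iff.mpr hfs)
    · intro lam hl
      have h1 := (hfval lam hl).mapL (Complex.conjCLE.toContinuousLinearMap)
      rw [← (Equiv.neg ℤ).hasSum_iff] at h1
      have h2 := (hfval lam hl).sub h1
      simp only [ContinuousLinearEquiv.coe_coe, Complex.conjCLE_apply] at h2
      rw [hreal lam hl, sub_self] at h2
      convert! h2 using 2 with k
      simp only [Function.comp_apply, Equiv.neg_apply, map_mul, hconj, map_zpow₀, conj_eq_inv hl, _root_.inv_zpow, _root_.zpow_neg,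
        inv_inv]
      ring
  have hsn : ∀ n : ℕ, n ≠ 0 → s n = 0 := by
    intro n hn
    have h1 := hzero n
    rw [hf0 (-n) (by rintro ⟨j, hj⟩; omega), sub_zero, hfn] at h1
    exact_mod_cast h1
  refine (hval lam h).unique ?_
  have := hasSum_single (f := fun n => (s n : ℂ) * lam ^ n) 0 (fun n hn => by simp [hsn n hn])
  convert! this using 1
  simp [hs, hcv, pow_two]

open LoopAlg LoopMat

variable {ρ : ℝ} [Fact (1 < ρ)] {m : ℕ} {r d : ℝ} {hm : 1 ≤ m} {hD : IsDisc m r d}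
  {p : ℝ × ParamSpace}

lemma summable_toParam (v : L1 ℕ ℝ) : Summable fun k => |v k / ρ ^ k| := by
  refine .of_nonneg_of_le (fun _ => abs_nonneg _) (fun k => ?_) (L1.summable v)
  have h1 : 1 ≤ ρ ^ k := one_le_pow₀ (Fact.out : 1 < ρ).le
  rw [abs_div, abs_of_pos (zero_lt_one.trans_le h1)]
  exact div_le_self (abs_nonneg _) h1

/-- For solutions of the system, `a^2 + b c = 1` on the unit circle. -/
lemma IsSmall.sq_add_mul_eq_one (hp : IsSmall ρ hm hD p) (ht : p.1 ≠ 0)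
    (hs : SolvesSystem m p.1 (toParam ρ p.2)) {lam : ℂ} (h : ‖lam‖ = 1) :
    evalLoop (toParam ρ p.2).a lam ^ 2 +
      evalLoop (toParam ρ p.2).b lam * evalLoop (toParam ρ p.2).c lam = 1 := by
  obtain ⟨hF, hG, -, -, hK⟩ := hs
  rw [evalLoop_sq_add_mul_eq (a := (toParam ρ p.2).a) (b := (toParam ρ p.2).b)
    (c := (toParam ρ p.2).c) (summable_toParam _) (summable_toParam _) (summable_toParam _) ?_ h]
  · exact_mod_cast hK
  · intro lam hl
    have h0 : lam ≠ 0 := norm_ne_zero_iff.mp (by rw [hl]; exact one_ne_zero)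
    have h1 := det_logMon (ρ := ρ) hp.unit hl
    have htr := trace_logMon (ρ := ρ) hp.unit hl
    rw [det_matA _ _ _ _ h0, pow_zero, one_mul, Matrix.det_fin_two] at h1
    rw [Matrix.trace_fin_two] at htr
    have h2 := hF lam hl
    have h3 := hG lam hl
    rw [hp.eqF_eq ht hl] at h2
    rw [hp.eqG_eq ht hl] at h3
    simp only [evalHom_apply] at h1 htr
    -- `a² + b c = -det L = L_11² + L_12 L_21`, in which `L_21` is the conjugate of `L_12`; as
    -- `L_11` is real, so is the sum.
    have h4 : evalLoop (toParam ρ p.2).a lam ^ 2 +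
        evalLoop (toParam ρ p.2).b lam * evalLoop (toParam ρ p.2).c lam =
        ev lam (entry 0 0 (logMon ρ hm hD p)) ^ 2 + ev lam (entry 0 1 (logMon ρ hm hD p)) *
          conj (ev lam (entry 0 1 (logMon ρ hm hD p))) := by
      linear_combination h1 - ev lam (entry 0 0 (logMon ρ hm hD p)) * htr +
        ev lam (entry 0 1 (logMon ρ hm hD p)) * h3
    rw [h4, map_add, map_pow, map_mul, Complex.conj_conj, ← sub_eq_zero.mp h2, mul_comm (conj _)]

lemma IsSmall.det_matA_eq (hp : IsSmall ρ hm hD p) (ht : p.1 ≠ 0)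
    (hs : SolvesSystem m p.1 (toParam ρ p.2)) {lam : ℂ} (h : ‖lam‖ = 1) (j : ℕ) :
    (matA m (toParam ρ p.2) j lam).det = -1 := by
  have h0 : lam ≠ 0 := norm_ne_zero_iff.mp (by rw [h]; exact one_ne_zero)
  rw [det_matA _ _ _ _ h0, hp.sq_add_mul_eq_one ht hs (by simp [h])]

/-- For solutions of the system, the monodromy at `λ = ± 1` is diagonal with the given sign. -/
lemma IsSmall.matM_zero_eq_diagExp (hp : IsSmall ρ hm hD p) (ht : p.1 ≠ 0)
    (hs : SolvesSystem m p.1 (toParam ρ p.2)) {lam : ℂ} (h : ‖lam‖ = 1)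
    (hH : eqH m p.1 (toParam ρ p.2) lam = 0) {e : ℝ} (he : e ^ 2 = 1)
    (hclose : ‖ev lam (entry 0 0 (logMon ρ hm hD p)) - e‖ < 1) :
    matM m 0 p.1 (toParam ρ p.2) lam = diagExp (e * p.1) := by
  have h1 := det_logMon (ρ := ρ) hp.unit h
  have htr := trace_logMon (ρ := ρ) hp.unit h
  rw [hp.det_matA_eq ht hs h, Matrix.det_fin_two] at h1
  rw [Matrix.trace_fin_two] at htr
  have h01 : evalHom h (logMon ρ hm hD p) 0 1 = 0 := by
    rw [evalHom_apply, ← hp.eqH_eq ht h, hH]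
  have h10 : evalHom h (logMon ρ hm hD p) 1 0 = 0 := by
    have h3 := hs.2.1 lam h
    rw [hp.eqG_eq ht h, ← evalHom_apply h _ 0 1, h01, map_zero, sub_zero] at h3
    rw [evalHom_apply, h3]
  rw [← evalHom_apply h] at hclose
  have he' : (e : ℂ) ^ 2 = 1 := by exact_mod_cast he
  -- With `L_12 = 0` and trace zero, `det L = -1` reads `L_11² = 1 = e²`. The root `-e` is at
  -- distance `2` from `e`, which `hclose` excludes.
  have hsq : (evalHom h (logMon ρ hm hD p) 0 0 - e) * (evalHom h (logMon ρ hm hD p) 0 0 + e) = 0 := by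
    rw [h01] at h1
    linear_combination -h1 + evalHom h (logMon ρ hm hD p) 0 0 * htr - he'
  have h00 : evalHom h (logMon ρ hm hD p) 0 0 = e := by
    rcases mul_eq_zero.mp hsq with h5 | h5
    · exact sub_eq_zero.mp h5
    · exfalso
      rw [eq_neg_of_add_eq_zero_left h5] at hclose
      have : (-(e : ℂ) - e) = ((-2 * e : ℝ) : ℂ) := by push_cast; ring
      rw [this, Complex.norm_real, norm_mul] at hclose
      have he1 : ‖e‖ = 1 := by
        rw [← sq_eq_sq₀ (norm_nonneg _) zero_le_one, one_pow, Real.norm_eq_abs, sq_abs, he]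
      rw [he1] at hclose
      norm_num at hclose
  have hdiag : (2 * Real.pi * I * p.1 : ℂ) • evalHom h (logMon ρ hm hD p) =
      Matrix.diagonal ![(2 * Real.pi * I * (e * p.1 : ℝ) : ℂ), -(2 * Real.pi * I * (e * p.1 : ℝ))] := by
    have h11 : evalHom h (logMon ρ hm hD p) 1 1 = -e := by
      rw [← h00]; linear_combination htr
    ext i k
    fin_cases i <;> fin_cases k <;> simp [h00, h01, h10, h11] <;> ring
  rw [matM_zero_eq hp.regular hp.unit h, hdiag, Matrix.exp_diagonal, diagExp]
  ext i k
  fin_cases i <;> fin_cases k <;> simp [Matrix.diagonal, ← Complex.exp_eq_exp_ℂ, Pi.coe_exp]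

end Consequences

end DPW

namespace DPW

/-! ### The system at `t = 0` in coordinates. -/

section Linearization

open LoopAlg LoopMat

variable {ρ : ℝ} {m : ℕ}

/-- The coefficients of a power series, in unweighted form and extended by zero to `ℤ`. -/
noncomputable def coef (ρ : ℝ) (v : L1 ℕ ℝ) (k : ℤ) : ℝ :=
  if 0 ≤ k then v k.toNat / ρ ^ k.toNat else 0

lemma coef_natCast (v : L1 ℕ ℝ) (n : ℕ) : coef ρ v n = v n / ρ ^ n := by
  simp [coef]

lemma coef_of_neg (v : L1 ℕ ℝ) {k : ℤ} (hk : k < 0) : coef ρ v k = 0 := if_neg (by omega)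

lemma coef_add_smul (v w : L1 ℕ ℝ) (s : ℝ) (k : ℤ) :
    coef ρ (v + s • w) k = coef ρ v k + s * coef ρ w k := by
  unfold coef
  split_ifs
  · simp only [lp.coeFn_add, lp.coeFn_smul, Pi.add_apply, Pi.smul_apply, smul_eq_mul]
    ring
  · ring

lemma coef_eq_of_toParam {v : L1 ℕ ℝ} {f : ℕ → ℝ} (h : (fun k => v k / ρ ^ k) = f) (k : ℤ) :
    coef ρ v k = if 0 ≤ k then f k.toNat else 0 := by
  rw [coef, ← h]

lemma sysK_eq (v : ParamSpace) :
    sysK v = coef ρ v.2.1 0 ^ 2 + coef ρ v.2.2.1 0 * coef ρ v.2.2.2 0 - 1 := by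
  simp [sysK, coef]

variable [Fact (1 < ρ)]

lemma fc_ofSeq_eq (v : L1 ℕ ℝ) (k : ℤ) : fc (ofSeq (ρ := ρ) 1 v) k = (coef ρ v k : ℂ) := by
  rw [fc_ofSeq, coef]
  split_ifs <;> simp

lemma entry_nil (i k : Fin 2) : entry i k (nil ρ) = if 1 = i ∧ 0 = k then 1 else 0 :=
  entry_single ..

lemma entry_loopA_zero (v : ParamSpace) :
    entry 0 0 (loopA ρ m 0 v) = ofSeq 1 v.2.1 ∧
    entry 0 1 (loopA ρ m 0 v) = shift ρ (-1) * ofSeq 1 v.2.2.1 ∧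
    entry 1 0 (loopA ρ m 0 v) = shift ρ 1 * ofSeq 1 v.2.2.2 ∧
    entry 1 1 (loopA ρ m 0 v) = -ofSeq 1 v.2.1 := by
  simp [loopA_apply, entry_single]

lemma entry_loopR_zero_zero (v : ParamSpace) : entry 0 0 (loopR ρ m v) =
    ofSeq 1 v.2.1 - (v.1 : ℂ) • (shift ρ (-1) * ofSeq 1 v.2.2.1) := by
  obtain ⟨h1, h2, h3, h4⟩ := entry_loopA_zero (ρ := ρ) (m := m) v
  simp only [loopR, conjNil, one_smul, map_add, map_sub, map_smul, entry_mul, entry_nil, h1, h2, h3,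
    h4]
  simp [sub_eq_add_neg]

lemma entry_loopR_zero_one (v : ParamSpace) : entry 0 1 (loopR ρ m v) =
    shift ρ (-1) * ofSeq 1 v.2.2.1 := by
  obtain ⟨h1, h2, h3, h4⟩ := entry_loopA_zero (ρ := ρ) (m := m) v
  simp only [loopR, conjNil, one_smul, map_add, map_sub, map_smul, entry_mul, entry_nil, h1, h2, h3,
    h4]
  simp

lemma entry_loopR_one_zero (v : ParamSpace) : entry 1 0 (loopR ρ m v) =
    shift ρ 1 * ofSeq 1 v.2.2.2 + (2 * v.1 : ℂ) • ofSeq 1 v.2.1 -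
      (v.1 : ℂ) ^ 2 • (shift ρ (-1) * ofSeq 1 v.2.2.1) := by
  obtain ⟨h1, h2, h3, h4⟩ := entry_loopA_zero (ρ := ρ) (m := m) v
  simp only [loopR, conjNil, one_smul, map_add, map_sub, map_smul, entry_mul, entry_nil, h1, h2, h3,
    h4]
  simp
  module

lemma fc_entry_loopR_zero_zero (v : ParamSpace) (k : ℤ) :
    (fc (entry 0 0 (loopR ρ m v)) k).re = coef ρ v.2.1 k - v.1 * coef ρ v.2.2.1 (k + 1) := by
  rw [entry_loopR_zero_zero, ← fcL_apply, map_sub, map_smul, fcL_apply, fcL_apply, fc_shift_mul,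
    fc_ofSeq_eq, fc_ofSeq_eq, sub_neg_eq_add, smul_eq_mul]
  simp

lemma fc_entry_loopR_zero_one (v : ParamSpace) (k : ℤ) :
    (fc (entry 0 1 (loopR ρ m v)) k).re = coef ρ v.2.2.1 (k + 1) := by
  rw [entry_loopR_zero_one, fc_shift_mul, fc_ofSeq_eq, sub_neg_eq_add, Complex.ofReal_re]

lemma fc_entry_loopR_one_zero (v : ParamSpace) (k : ℤ) :
    (fc (entry 1 0 (loopR ρ m v)) k).re = coef ρ v.2.2.2 (k - 1) + 2 * v.1 * coef ρ v.2.1 k -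
      v.1 ^ 2 * coef ρ v.2.2.1 (k + 1) := by
  rw [entry_loopR_one_zero, ← fcL_apply, map_sub, map_add, map_smul, map_smul, fcL_apply, fcL_apply,
    fcL_apply, fc_shift_mul, fc_shift_mul, fc_ofSeq_eq, fc_ofSeq_eq, fc_ofSeq_eq, sub_neg_eq_add,
    smul_eq_mul, smul_eq_mul]
  norm_cast

/-- The real part of `λ⁻¹ b(λ)`. -/
noncomputable def reEv (ρ : ℝ) [Fact (1 < ρ)] (lam : ℂ) : L1 ℕ ℝ →L[ℝ] ℝ :=
  Complex.reCLM.comp (((lam⁻¹ • ev (ρ := ρ) lam).restrictScalars ℝ).comp (ofSeq 1))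

lemma ev_entry_loopR_zero_one {lam : ℂ} (h : ‖lam‖ = 1) (v : ParamSpace) :
    (ev lam (entry 0 1 (loopR ρ m v))).re = reEv ρ lam v.2.2.1 := by
  rw [entry_loopR_zero_one, ev_mul h, ev_shift h, _root_.zpow_neg_one]
  rfl

lemma hasSum_reEv {e : ℝ} (he : e ^ 2 = 1) (v : L1 ℕ ℝ) :
    HasSum (fun k => v k / ρ ^ k * e ^ (k + 1)) (reEv ρ e v) := by
  have hn : ‖(e : ℂ)‖ = 1 := by
    rw [Complex.norm_real, ← sq_eq_sq₀ (norm_nonneg _) zero_le_one, one_pow, Real.norm_eq_abs,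
      sq_abs, he]
  have h1 := ((hasSum_ofSeq (ρ := ρ) 1 v (ev e)).mul_left (e : ℂ)⁻¹).mapL Complex.reCLM
  have hinv : (e : ℂ)⁻¹ = e := by
    refine inv_eq_of_mul_eq_one_left ?_
    rw [← pow_two]; exact_mod_cast he
  convert! h1 using 2 with k
  rw [ev_shift hn, hinv, zpow_natCast, Complex.reCLM_apply]
  simp only [Units.val_one, Int.cast_one, one_pow, one_mul]
  norm_cast
  ring

/-- The coefficients `b_0`, `b_1`, `b_2` are split off because they belong to the finite block of
the linearized system; the tail is determined separately. In it `e^(k+4) = e^k`. -/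
lemma reEv_eq {e : ℝ} (he : e ^ 2 = 1) (v : L1 ℕ ℝ) :
    reEv ρ e v = coef ρ v 0 * e + coef ρ v 1 + coef ρ v 2 * e +
      ∑' k : ℕ, coef ρ v (k + 3 : ℕ) * e ^ k := by
  have h := hasSum_reEv (ρ := ρ) he v
  have h3 : e ^ 3 = e := by rw [pow_succ, he, one_mul]
  have h0 := coef_natCast (ρ := ρ) v 0
  have h1 := coef_natCast (ρ := ρ) v 1
  have h2 := coef_natCast (ρ := ρ) v 2
  simp only [Nat.cast_zero, Nat.cast_one, Nat.cast_ofNat] at h0 h1 h2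
  rw [← h.tsum_eq, ← h.summable.sum_add_tsum_nat_add 3, Finset.sum_range_succ,
    Finset.sum_range_succ, Finset.sum_range_one, h0, h1, h2, he, h3]
  congr 1
  · ring
  · refine tsum_congr fun k => ?_
    rw [coef_natCast, show k + 3 + 1 = k + 2 * 2 by ring, pow_add e, pow_mul, he, one_pow, mul_one]

/-- The weighted coordinates of the central value. -/
noncomputable def centreV (ρ : ℝ) : ParamSpace :=
  (1, lp.single 1 1 ρ, lp.single 1 0 (-1 / 2 : ℝ) + lp.single 1 2 (ρ ^ 2 / 2 : ℝ), lp.single 1 0 (-2))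

lemma lp_single_apply (i : ℕ) (c : ℝ) (k : ℕ) :
    (lp.single 1 i c : L1 ℕ ℝ) k = if k = i then c else 0 := by
  split_ifs with h
  · subst h; exact lp.single_apply_self ..
  · exact lp.single_apply_ne _ _ _ h

lemma toParam_centreV : toParam ρ (centreV ρ) = centre := by
  have hρ : ρ ≠ 0 := (zero_lt_one.trans (Fact.out : 1 < ρ)).ne'
  ext k
  · rfl
  · change (lp.single 1 1 ρ : L1 ℕ ℝ) k / ρ ^ k = if k = 1 then 1 else 0
    rw [lp_single_apply]
    split_ifs with h
    · rw [h, pow_one, div_self hρ]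
    · simp
  · change ((lp.single 1 0 (-1 / 2 : ℝ) + lp.single 1 2 (ρ ^ 2 / 2 : ℝ) : L1 ℕ ℝ)) k / ρ ^ k = _
    rw [lp.coeFn_add, Pi.add_apply, lp_single_apply, lp_single_apply]
    simp only [centre]
    split_ifs with h h' h'
    · omega
    · simp [h]
    · rw [h', zero_add]; field_simp
    · simp
  · change (lp.single 1 0 (-2) : L1 ℕ ℝ) k / ρ ^ k = if k = 0 then -2 else 0
    rw [lp_single_apply]
    split_ifs with h
    · simp [h]
    · simp

lemma coef_centreV_a (k : ℤ) : coef ρ (centreV ρ).2.1 k = if k = 1 then 1 else 0 := by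
  rw [coef_eq_of_toParam (congrArg Param.a (toParam_centreV (ρ := ρ)))]
  simp only [centre]
  split_ifs <;> first | rfl | omega

lemma coef_centreV_b (k : ℤ) :
    coef ρ (centreV ρ).2.2.1 k = if k = 0 then -1 / 2 else if k = 2 then 1 / 2 else 0 := by
  rw [coef_eq_of_toParam (congrArg Param.b (toParam_centreV (ρ := ρ)))]
  simp only [centre]
  split_ifs <;> first | rfl | omega

lemma coef_centreV_c (k : ℤ) : coef ρ (centreV ρ).2.2.2 k = if k = 0 then -2 else 0 := by
  rw [coef_eq_of_toParam (congrArg Param.c (toParam_centreV (ρ := ρ)))]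
  simp only [centre]
  split_ifs <;> first | rfl | omega

lemma sysL_loopR_one (v : ParamSpace) (n : ℕ) : (sysL ρ (loopR ρ m v)).1 n =
    (coef ρ v.2.1 (n + 1) - v.1 * coef ρ v.2.2.1 (n + 2) + v.1 * coef ρ v.2.2.1 (-n)) *
      weight ρ (n + 1) := by
  change (posC ρ 1 0 0 (loopR ρ m v) - negC ρ 1 0 0 (loopR ρ m v) : L1 ℕ ℝ) n = _
  rw [lp.coeFn_sub, Pi.sub_apply, posC_apply, negC_apply, fc_entry_loopR_zero_zero,
    fc_entry_loopR_zero_zero, coef_of_neg v.2.1 (k := -((n : ℤ) + 1)) (by omega),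
    show (n : ℤ) + 1 + 1 = n + 2 by ring, show -((n : ℤ) + 1) + 1 = -n by ring]
  ring

lemma sysL_loopR_two (v : ParamSpace) (n : ℕ) : (sysL ρ (loopR ρ m v)).2.1 n =
    (coef ρ v.2.2.2 (n - 1) + 2 * v.1 * coef ρ v.2.1 n - v.1 ^ 2 * coef ρ v.2.2.1 (n + 1) -
      coef ρ v.2.2.1 (1 - n)) * weight ρ n := by
  change (posC ρ 0 1 0 (loopR ρ m v) - negC ρ 0 0 1 (loopR ρ m v) : L1 ℕ ℝ) n = _
  rw [lp.coeFn_sub, Pi.sub_apply, posC_apply, negC_apply, fc_entry_loopR_one_zero,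
    fc_entry_loopR_zero_one, add_zero, show -(n : ℤ) + 1 = 1 - n by ring]
  ring

lemma sysL_loopR_three (v : ParamSpace) (n : ℕ) : (sysL ρ (loopR ρ m v)).2.2.1 n =
    (-(v.1 ^ 2 * coef ρ v.2.2.1 (-n)) - coef ρ v.2.2.1 (n + 2)) * weight ρ (n + 1) := by
  change (negC ρ 1 1 0 (loopR ρ m v) - posC ρ 1 0 1 (loopR ρ m v) : L1 ℕ ℝ) n = _
  rw [lp.coeFn_sub, Pi.sub_apply, posC_apply, negC_apply, fc_entry_loopR_one_zero,
    fc_entry_loopR_zero_one, coef_of_neg v.2.1 (k := -((n : ℤ) + 1)) (by omega),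
    coef_of_neg v.2.2.2 (k := -((n : ℤ) + 1) - 1) (by omega),
    show (n : ℤ) + 1 + 1 = n + 2 by ring, show -((n : ℤ) + 1) + 1 = -n by ring]
  ring

lemma sysL_loopR_four (v : ParamSpace) :
    (sysL ρ (loopR ρ m v)).2.2.2 = (reEv ρ 1 v.2.2.1, reEv ρ (-1) v.2.2.1) := by
  rw [← ev_entry_loopR_zero_one (m := m) (by simp) v, ← ev_entry_loopR_zero_one (m := m) (by simp) v]
  rfl

lemma reEv_centreV {e : ℝ} (he : e ^ 2 = 1) : reEv ρ e (centreV ρ).2.2.1 = 0 := by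
  rw [reEv_eq he, coef_centreV_b, coef_centreV_b, coef_centreV_b]
  have : ∀ k : ℕ, coef ρ (centreV ρ).2.2.1 (k + 3 : ℕ) = 0 := fun k => by
    rw [coef_centreV_b, if_neg (by omega), if_neg (by omega)]
  simp only [this, zero_mul, tsum_zero]
  norm_num

variable {r d : ℝ} (hm : 1 ≤ m) (hD : IsDisc m r d)

lemma sys_zero (v : ParamSpace) : sys ρ hm hD (0, v) = (sysL ρ (loopR ρ m v), sysK v) := by
  rw [sys, logMon_zero]

lemma sys_centreV : sys ρ hm hD (0, centreV ρ) = 0 := by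
  rw [sys_zero]
  refine Prod.ext (Prod.ext ?_ (Prod.ext ?_ (Prod.ext ?_ ?_))) ?_
  · refine lp.ext (funext fun n => ?_)
    rw [sysL_loopR_one, coef_centreV_a, coef_centreV_b, coef_centreV_b]
    rcases n with _ | n
    · norm_num [centreV]
    · rw [if_neg (by omega), if_neg (by omega), if_neg (by omega), if_neg (by omega),
        if_neg (by omega)]
      simp
  · refine lp.ext (funext fun n => ?_)
    rw [sysL_loopR_two, coef_centreV_a, coef_centreV_b, coef_centreV_b, coef_centreV_c]
    rcases n with _ | _ | n
    · norm_num [centreV]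
    · norm_num [centreV]
    · rw [if_neg (by omega), if_neg (by omega), if_neg (by omega), if_neg (by omega),
        if_neg (by omega), if_neg (by omega)]
      simp
  · refine lp.ext (funext fun n => ?_)
    rw [sysL_loopR_three, coef_centreV_b, coef_centreV_b]
    rcases n with _ | n
    · norm_num [centreV]
    · rw [if_neg (by omega), if_neg (by omega), if_neg (by omega), if_neg (by omega)]
      simp
  · rw [sysL_loopR_four]
    have h1 := reEv_centreV (ρ := ρ) (e := 1) (by norm_num)
    have h2 := reEv_centreV (ρ := ρ) (e := -1) (by norm_num)
    push_cast at h1 h2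
    rw [h1, h2]
    rfl
  · rw [sysK_eq (ρ := ρ), coef_centreV_a, coef_centreV_b, coef_centreV_c]
    norm_num

lemma contDiffAt_sys {n : WithTop ℕ∞} (v : ParamSpace) :
    ContDiffAt ℝ n (sys ρ hm hD) (0, v) := by
  have h1 : ContDiffAt ℝ n (fun p => sysL ρ (logMon ρ hm hD p)) (0, v) :=
    (sysL ρ).contDiff.contDiffAt.comp _ (contDiffAt_logMon hm hD v)
  have e : ∀ k, ContDiff ℝ n fun f : L1 ℕ ℝ => f k := fun k =>
    (lp.evalCLM ℝ (fun _ : ℕ => ℝ) 1 k).contDiff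
  have h2 : ContDiff ℝ n sysK :=
    ((((e 0).comp contDiff_snd.fst).pow 2).add
      (((e 0).comp contDiff_snd.snd.fst).mul ((e 0).comp contDiff_snd.snd.snd))).sub contDiff_const
  exact h1.prodMk (h2.comp contDiff_snd).contDiffAt

end Linearization

end DPW

namespace DPW

/-! ### Bijectivity of the linearization. -/

section Inverse

open LoopAlg LoopMat

variable {ρ : ℝ}

/-- The linearization of the system at the central value maps `w` to `y`. -/
structure IsLinSys (ρ : ℝ) [Fact (1 < ρ)] (w : ParamSpace) (y : SysSpace × ℝ) : Prop where
  one : ∀ n : ℕ, y.1.1 n = (coef ρ w.2.1 (n + 1) - coef ρ w.2.2.1 (n + 2) + coef ρ w.2.2.1 (-n) -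
    if n = 0 then w.1 else 0) * weight ρ (n + 1)
  two : ∀ n : ℕ, y.1.2.1 n = (coef ρ w.2.2.2 (n - 1) + 2 * coef ρ w.2.1 n -
    coef ρ w.2.2.1 (n + 1) - coef ρ w.2.2.1 (1 - n) + if n = 1 then w.1 else 0) * weight ρ n
  three : ∀ n : ℕ, y.1.2.2.1 n = (-coef ρ w.2.2.1 (-n) - coef ρ w.2.2.1 (n + 2) +
    if n = 0 then w.1 else 0) * weight ρ (n + 1)
  four : y.1.2.2.2 = (reEv ρ 1 w.2.2.1, reEv ρ (-1) w.2.2.1)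
  five : y.2 = -(coef ρ w.2.2.2 0 / 2) - 2 * coef ρ w.2.2.1 0

lemma hasDerivAt_zero_of_eq_cubic {f : ℝ → ℝ} (c₀ c₁ c₂ c₃ : ℝ)
    (h : ∀ s, f s = c₀ + s * c₁ + s ^ 2 * c₂ + s ^ 3 * c₃) : HasDerivAt f c₁ 0 := by
  have h0 : f = fun s => c₀ + s * c₁ + s ^ 2 * c₂ + s ^ 3 * c₃ := funext h
  rw [h0]
  have h1 := ((((hasDerivAt_id (0 : ℝ)).mul_const c₁).const_add c₀).add
    ((hasDerivAt_pow 2 (0 : ℝ)).mul_const c₂)).add ((hasDerivAt_pow 3 (0 : ℝ)).mul_const c₃)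
  convert! h1 using 1
  norm_num

lemma MemLoop.const_mul {f : ℕ → ℝ} (hf : MemLoop ρ f) (c : ℝ) :
    MemLoop ρ (fun k => c * f k) := by
  have := Summable.mul_left |c| hf
  refine this.congr fun k => ?_
  rw [abs_mul, mul_assoc]

lemma memLoop_of_tail {f : ℕ → ℝ} (j : ℕ) (hf : MemLoop ρ fun k => f (k + j)) : MemLoop ρ f := by
  refine (summable_nat_add_iff j).mp ((Summable.mul_right (ρ ^ j) hf).congr fun k => ?_)
  rw [pow_add, mul_assoc]

variable [Fact (1 < ρ)] {m : ℕ} {r d : ℝ} {hm : 1 ≤ m} {hD : IsDisc m r d}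

/-- At `t = 0`, along a line through the centre, each coordinate of the system is a polynomial of
degree at most three in `s`, the term `r² b` being the worst. The derivative is the coefficient of
`s`. -/
lemma apply_fderiv_sys_eq {f' : ℝ × ParamSpace →L[ℝ] SysSpace × ℝ}
    (hf : HasFDerivAt (sys ρ hm hD) f' (0, centreV ρ)) (w : ParamSpace)
    (φ : SysSpace × ℝ →L[ℝ] ℝ) (c₀ c₁ c₂ c₃ : ℝ)
    (h : ∀ s : ℝ, φ (sysL ρ (loopR ρ m (centreV ρ + s • w)), sysK (centreV ρ + s • w)) =
      c₀ + s * c₁ + s ^ 2 * c₂ + s ^ 3 * c₃) : φ (f' (0, w)) = c₁ := by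
  have hl : HasDerivAt (fun s : ℝ => ((0 : ℝ), centreV ρ + s • w)) (0, w) 0 := by
    have h1 := ((hasDerivAt_id (0 : ℝ)).smul_const w).const_add (centreV ρ)
    rw [one_smul] at h1
    exact (hasDerivAt_const (0 : ℝ) (0 : ℝ)).prodMk h1
  have hf' : HasFDerivAt (sys ρ hm hD) f' ((0 : ℝ), centreV ρ + (0 : ℝ) • w) := by
    rwa [zero_smul, add_zero]
  have h2 := φ.hasFDerivAt.comp_hasDerivAt (0 : ℝ) (hf'.comp_hasDerivAt (0 : ℝ) hl)
  refine h2.unique (hasDerivAt_zero_of_eq_cubic c₀ c₁ c₂ c₃ fun s => ?_)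
  rw [← h s, ← sys_zero hm hD]
  rfl

/-- The isolated terms `w.1` come from varying `r` in `r a`, `r b` and `r² b`. At the centre only
`a_1`, `b_0` and `b_2` are nonzero among the coefficients of `a` and `b`, and their contributions
cancel except for `n = 0` or `n = 1`. -/
lemma isLinSys_fderiv {f' : ℝ × ParamSpace →L[ℝ] SysSpace × ℝ}
    (hf : HasFDerivAt (sys ρ hm hD) f' (0, centreV ρ)) (w : ParamSpace) :
    IsLinSys ρ w (f' (0, w)) := by
  let e (n : ℕ) : L1 ℕ ℝ →L[ℝ] ℝ := lp.evalCLM ℝ (fun _ : ℕ => ℝ) 1 n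
  have e1 : ∀ s : ℝ, (centreV ρ + s • w).1 = 1 + s * w.1 := fun s => rfl
  have e2 : ∀ s : ℝ, (centreV ρ + s • w).2.1 = (centreV ρ).2.1 + s • w.2.1 := fun s => rfl
  have e3 : ∀ s : ℝ, (centreV ρ + s • w).2.2.1 = (centreV ρ).2.2.1 + s • w.2.2.1 := fun s => rfl
  have e4 : ∀ s : ℝ, (centreV ρ + s • w).2.2.2 = (centreV ρ).2.2.2 + s • w.2.2.2 := fun s => rfl
  have e5 : ∀ (lam : ℂ) (s : ℝ), reEv ρ lam ((centreV ρ).2.2.1 + s • w.2.2.1) =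
      reEv ρ lam (centreV ρ).2.2.1 + s * reEv ρ lam w.2.2.1 := fun lam s => by
    rw [map_add, map_smul, smul_eq_mul]
  refine ⟨fun n => ?_, fun n => ?_, fun n => ?_, Prod.ext ?_ ?_, ?_⟩
  · have key := apply_fderiv_sys_eq hf w ((e n).comp ((ContinuousLinearMap.fst ℝ _ _).comp
      (ContinuousLinearMap.fst ℝ _ _)))
      ((coef ρ (centreV ρ).2.1 (n + 1) - coef ρ (centreV ρ).2.2.1 (n + 2) +
        coef ρ (centreV ρ).2.2.1 (-n)) * weight ρ (n + 1))
      ((coef ρ w.2.1 (n + 1) - coef ρ w.2.2.1 (n + 2) - w.1 * coef ρ (centreV ρ).2.2.1 (n + 2) +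
        coef ρ w.2.2.1 (-n) + w.1 * coef ρ (centreV ρ).2.2.1 (-n)) * weight ρ (n + 1))
      ((-w.1 * coef ρ w.2.2.1 (n + 2) + w.1 * coef ρ w.2.2.1 (-n)) * weight ρ (n + 1)) 0
      (fun s => by
        refine (sysL_loopR_one _ n).trans ?_
        rw [e1, e2, e3, coef_add_smul, coef_add_smul, coef_add_smul]
        ring)
    refine key.trans ?_
    rw [coef_centreV_b, coef_centreV_b]
    rcases n with _ | n
    · norm_num
      exact Or.inl (by ring)
    · rw [if_neg (by omega), if_neg (by omega), if_neg (by omega), if_neg (by omega),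
        if_neg (by omega)]
      ring
  · have key := apply_fderiv_sys_eq hf w ((e n).comp ((ContinuousLinearMap.fst ℝ _ _).comp
      ((ContinuousLinearMap.snd ℝ _ _).comp (ContinuousLinearMap.fst ℝ _ _))))
      ((coef ρ (centreV ρ).2.2.2 (n - 1) + 2 * coef ρ (centreV ρ).2.1 n -
        coef ρ (centreV ρ).2.2.1 (n + 1) - coef ρ (centreV ρ).2.2.1 (1 - n)) * weight ρ n)
      ((coef ρ w.2.2.2 (n - 1) + 2 * coef ρ w.2.1 n + 2 * w.1 * coef ρ (centreV ρ).2.1 n -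
        coef ρ w.2.2.1 (n + 1) - 2 * w.1 * coef ρ (centreV ρ).2.2.1 (n + 1) -
        coef ρ w.2.2.1 (1 - n)) * weight ρ n)
      ((2 * w.1 * coef ρ w.2.1 n - 2 * w.1 * coef ρ w.2.2.1 (n + 1) -
        w.1 ^ 2 * coef ρ (centreV ρ).2.2.1 (n + 1)) * weight ρ n)
      (-w.1 ^ 2 * coef ρ w.2.2.1 (n + 1) * weight ρ n)
      (fun s => by
        refine (sysL_loopR_two _ n).trans ?_
        rw [e1, e2, e3, e4, coef_add_smul, coef_add_smul, coef_add_smul, coef_add_smul]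
        ring)
    refine key.trans ?_
    rw [coef_centreV_a, coef_centreV_b]
    rcases n with _ | _ | n
    · norm_num
    · norm_num
      exact Or.inl (by ring)
    · rw [if_neg (by omega), if_neg (by omega), if_neg (by omega), if_neg (by omega)]
      ring
  · have key := apply_fderiv_sys_eq hf w ((e n).comp ((ContinuousLinearMap.fst ℝ _ _).comp
      ((ContinuousLinearMap.snd ℝ _ _).comp ((ContinuousLinearMap.snd ℝ _ _).comp
        (ContinuousLinearMap.fst ℝ _ _)))))
      ((-coef ρ (centreV ρ).2.2.1 (-n) - coef ρ (centreV ρ).2.2.1 (n + 2)) * weight ρ (n + 1))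
      ((-coef ρ w.2.2.1 (-n) - 2 * w.1 * coef ρ (centreV ρ).2.2.1 (-n) -
        coef ρ w.2.2.1 (n + 2)) * weight ρ (n + 1))
      ((-2 * w.1 * coef ρ w.2.2.1 (-n) - w.1 ^ 2 * coef ρ (centreV ρ).2.2.1 (-n)) *
        weight ρ (n + 1))
      (-w.1 ^ 2 * coef ρ w.2.2.1 (-n) * weight ρ (n + 1))
      (fun s => by
        refine (sysL_loopR_three _ n).trans ?_
        rw [e1, e3, coef_add_smul, coef_add_smul]
        ring)
    refine key.trans ?_
    rw [coef_centreV_b]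
    rcases n with _ | n
    · norm_num
      exact Or.inl (by ring)
    · rw [if_neg (by omega), if_neg (by omega), if_neg (by omega)]
      ring
  · refine apply_fderiv_sys_eq hf w ((ContinuousLinearMap.fst ℝ _ _).comp
      ((ContinuousLinearMap.snd ℝ _ _).comp ((ContinuousLinearMap.snd ℝ _ _).comp
      ((ContinuousLinearMap.snd ℝ _ _).comp (ContinuousLinearMap.fst ℝ _ _)))))
      (reEv ρ 1 (centreV ρ).2.2.1) _ 0 0 (fun s => ?_)
    refine (congrArg Prod.fst (sysL_loopR_four _)).trans ?_
    rw [e3, e5]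
    ring
  · refine apply_fderiv_sys_eq hf w ((ContinuousLinearMap.snd ℝ _ _).comp
      ((ContinuousLinearMap.snd ℝ _ _).comp ((ContinuousLinearMap.snd ℝ _ _).comp
      ((ContinuousLinearMap.snd ℝ _ _).comp (ContinuousLinearMap.fst ℝ _ _)))))
      (reEv ρ (-1) (centreV ρ).2.2.1) _ 0 0 (fun s => ?_)
    refine (congrArg Prod.snd (sysL_loopR_four _)).trans ?_
    rw [e3, e5 (-1)]
    ring
  · refine apply_fderiv_sys_eq hf w (ContinuousLinearMap.snd ℝ _ _) 0 _
      (coef ρ w.2.1 0 ^ 2 + coef ρ w.2.2.1 0 * coef ρ w.2.2.2 0) 0 (fun s => ?_)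
    refine (sysK_eq (ρ := ρ) _).trans ?_
    rw [e2, e3, e4, coef_add_smul, coef_add_smul, coef_add_smul, coef_centreV_a, coef_centreV_b,
      coef_centreV_c]
    norm_num
    ring

lemma L1.eq_zero_of_coef {v : L1 ℕ ℝ} (h : ∀ n : ℕ, coef ρ v n = 0) : v = 0 := by
  have hρ : ρ ≠ 0 := (zero_lt_one.trans (Fact.out : 1 < ρ)).ne'
  refine lp.ext (funext fun n => ?_)
  have := h n
  rw [coef_natCast, div_eq_zero_iff, or_iff_left (pow_ne_zero n hρ)] at this
  exact this

/-- The third family kills `b_k` for `k ≥ 3`. The values at `±1`, the lowest equations and the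
scalar one then form a finite system for `r, a_0, a_1, b_0, b_1, b_2, c_0` with only the zero
solution. The first and second families finally give the tails of `a` and `c`. -/
lemma IsLinSys.eq_zero {w : ParamSpace} (h : IsLinSys ρ w 0) : w = 0 := by
  obtain ⟨r, α, β, γ⟩ := w
  have hw : ∀ j : ℤ, weight ρ j ≠ 0 := fun j => (weight_pos j).ne'
  obtain ⟨h1, h2, h3, h4, h5⟩ := h
  have h1' : ∀ n : ℕ, coef ρ α (n + 1) - coef ρ β (n + 2) + coef ρ β (-n) -
      (if n = 0 then r else 0) = 0 := fun n =>
    (mul_eq_zero.mp (h1 n).symm).resolve_right (hw _)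
  have h2' : ∀ n : ℕ, coef ρ γ (n - 1) + 2 * coef ρ α n - coef ρ β (n + 1) - coef ρ β (1 - n) +
      (if n = 1 then r else 0) = 0 := fun n =>
    (mul_eq_zero.mp (h2 n).symm).resolve_right (hw _)
  have h3' : ∀ n : ℕ, -coef ρ β (-n) - coef ρ β (n + 2) + (if n = 0 then r else 0) = 0 := fun n =>
    (mul_eq_zero.mp (h3 n).symm).resolve_right (hw _)
  have hB : ∀ k : ℕ, coef ρ β (k + 3 : ℕ) = 0 := by
    intro k
    have := h3' (k + 1)
    rw [coef_of_neg β (k := -((k + 1 : ℕ) : ℤ)) (by omega), if_neg (by omega)] at this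
    have e : ((k + 1 : ℕ) : ℤ) + 2 = (k + 3 : ℕ) := by push_cast; ring
    rw [e] at this
    linarith
  have hp := reEv_eq (ρ := ρ) (e := 1) (by norm_num) β
  have hn := reEv_eq (ρ := ρ) (e := -1) (by norm_num) β
  simp only [hB, zero_mul, tsum_zero] at hp hn
  push_cast at hp hn
  have hp0 : 0 = reEv ρ 1 β := congrArg Prod.fst h4
  have hn0 : 0 = reEv ρ (-1) β := congrArg Prod.snd h4
  have hk : 0 = -(coef ρ γ 0 / 2) - 2 * coef ρ β 0 := h5
  have q0 := h3' 0
  have f0 := h1' 0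
  have g0 := h2' 0
  have g1 := h2' 1
  norm_num at q0 f0 g0 g1
  rw [coef_of_neg γ (by norm_num)] at g0
  have hb0 : coef ρ β 0 = 0 := by linarith
  have hb1 : coef ρ β 1 = 0 := by linarith
  have hb2 : coef ρ β 2 = 0 := by linarith
  have hr : r = 0 := by linarith
  have ha0 : coef ρ α 0 = 0 := by linarith
  have ha1 : coef ρ α 1 = 0 := by linarith
  have hc0 : coef ρ γ 0 = 0 := by linarith
  have ha2 : ∀ n : ℕ, coef ρ α (n + 2 : ℕ) = 0 := by
    intro n
    have := h1' (n + 1)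
    rw [coef_of_neg β (k := -((n + 1 : ℕ) : ℤ)) (by omega), if_neg (by omega)] at this
    have e : ((n + 1 : ℕ) : ℤ) + 2 = (n + 3 : ℕ) := by push_cast; ring
    have e' : ((n + 1 : ℕ) : ℤ) + 1 = (n + 2 : ℕ) := by push_cast; ring
    rw [e, e', hB] at this
    linarith
  have hc1 : ∀ n : ℕ, coef ρ γ (n + 1 : ℕ) = 0 := by
    intro n
    have := h2' (n + 2)
    rw [coef_of_neg β (k := 1 - ((n + 2 : ℕ) : ℤ)) (by omega), if_neg (by omega)] at this
    have e : ((n + 2 : ℕ) : ℤ) + 1 = (n + 3 : ℕ) := by push_cast; ring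
    have e' : ((n + 2 : ℕ) : ℤ) - 1 = (n + 1 : ℕ) := by push_cast; ring
    rw [e, e', hB, ha2] at this
    linarith
  refine Prod.ext hr (Prod.ext (L1.eq_zero_of_coef (ρ := ρ) ?_) (Prod.ext
    (L1.eq_zero_of_coef (ρ := ρ) ?_) (L1.eq_zero_of_coef (ρ := ρ) ?_)))
  · rintro (_ | _ | n)
    · exact ha0
    · exact ha1
    · exact ha2 n
  · rintro (_ | _ | _ | n)
    · exact hb0
    · exact hb1
    · exact hb2
    · exact hB n
  · rintro (_ | n)
    · exact hc0
    · exact hc1 n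

lemma MemLoop.add {f g : ℕ → ℝ} (hf : MemLoop ρ f) (hg : MemLoop ρ g) : MemLoop ρ (f + g) := by
  have hρ : 0 < ρ := zero_lt_one.trans (Fact.out : 1 < ρ)
  refine .of_nonneg_of_le (fun k => by positivity) (fun k => ?_) (Summable.add hf hg)
  rw [← add_mul]
  exact mul_le_mul_of_nonneg_right (abs_add_le _ _) (by positivity)

lemma memLoop_div (v : L1 ℕ ℝ) (i j : ℕ) : MemLoop ρ fun k => v (k + j) / ρ ^ (k + i) := by
  have hρ : 0 < ρ := zero_lt_one.trans (Fact.out : 1 < ρ)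
  have h := ((summable_nat_add_iff j).mpr (L1.summable v)).mul_right (ρ ^ i)⁻¹
  refine h.congr fun k => ?_
  rw [abs_div, abs_of_pos (pow_pos hρ _), pow_add, Real.norm_eq_abs]
  field_simp

lemma MemLoop.exists_eq {f : ℕ → ℝ} (hf : MemLoop ρ f) :
    ∃ v : L1 ℕ ℝ, ∀ n : ℕ, v n / ρ ^ n = f n := by
  have hρ : 0 < ρ := zero_lt_one.trans (Fact.out : 1 < ρ)
  refine ⟨L1.mk (fun k => f k * ρ ^ k) ?_, fun n => ?_⟩
  · refine Summable.congr hf fun k => ?_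
    rw [Real.norm_eq_abs, abs_mul, abs_of_pos (pow_pos hρ k)]
  · rw [L1.mk_apply, mul_div_cancel_right₀ _ (pow_pos hρ n).ne']

lemma exists_isLinSys (y : SysSpace × ℝ) : ∃ w : ParamSpace, IsLinSys ρ w y := by
  obtain ⟨⟨f, g, q, hp, hn⟩, κ⟩ := y
  have hρ : ρ ≠ 0 := (zero_lt_one.trans (Fact.out : 1 < ρ)).ne'
  -- The tails `b_{k+3}`, `a_{k+2}`, `c_{k+1}` are forced, in this order, by the third, first and
  -- second family of equations.
  obtain ⟨bT, hbT⟩ : ∃ bT : ℕ → ℝ, bT = fun k => -1 * (q (k + 1) / ρ ^ (k + 2)) := ⟨_, rfl⟩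
  obtain ⟨aT, haT⟩ : ∃ aT : ℕ → ℝ, aT = (fun k => f (k + 1) / ρ ^ (k + 2)) + bT := ⟨_, rfl⟩
  obtain ⟨cT, hcT⟩ : ∃ cT : ℕ → ℝ,
      cT = (fun k => g (k + 2) / ρ ^ (k + 2)) + (fun k => -2 * aT k) + bT := ⟨_, rfl⟩
  have mb : MemLoop ρ bT := hbT ▸ (memLoop_div q 2 1).const_mul (-1)
  have ma : MemLoop ρ aT := haT ▸ (memLoop_div f 2 1).add mb
  have mc : MemLoop ρ cT := hcT ▸ ((memLoop_div g 2 2).add (ma.const_mul (-2))).add mb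
  obtain ⟨T, hT⟩ : ∃ T : ℝ → ℝ, ∀ e, T e = ∑' k, bT k * e ^ k := ⟨_, fun _ => rfl⟩
  -- `s` is `b_0 + b_2`, half the difference of the prescribed values at `1` and `-1` after the
  -- tails are removed; `b_1` below is half their sum.
  obtain ⟨s, hs⟩ : ∃ s : ℝ, s = (hp - hn - T 1 + T (-1)) / 2 := ⟨_, rfl⟩
  obtain ⟨r, hr⟩ : ∃ r : ℝ, r = q 0 / ρ + s := ⟨_, rfl⟩
  -- After elimination of `a_1` and `b_2`, the second family at `n = 1` prescribes `c_0 - 4 b_0 =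
  -- E`. The scalar equation prescribes `c_0 + 4 b_0 = -2κ`, and together they give `b_0` and `c_0`.
  obtain ⟨E, hE⟩ : ∃ E : ℝ, E = g 1 / ρ - 2 * (f 0 / ρ) - 3 * r - s := ⟨_, rfl⟩
  obtain ⟨b₀, hb₀⟩ : ∃ b₀ : ℝ, b₀ = (-2 * κ - E) / 8 := ⟨_, rfl⟩
  obtain ⟨b₁, hb₁⟩ : ∃ b₁ : ℝ, b₁ = (hp + hn - T 1 - T (-1)) / 2 := ⟨_, rfl⟩
  obtain ⟨bs, hbs⟩ : ∃ bs : ℕ → ℝ, bs 0 = b₀ ∧ bs 1 = b₁ ∧ bs 2 = s - b₀ ∧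
      ∀ k, bs (k + 3) = bT k :=
    ⟨fun | 0 => b₀ | 1 => b₁ | 2 => s - b₀ | k + 3 => bT k, rfl, rfl, rfl, fun _ => rfl⟩
  obtain ⟨as, has⟩ : ∃ as : ℕ → ℝ, as 0 = g 0 / 2 + b₁ ∧ as 1 = f 0 / ρ + r + s - 2 * b₀ ∧
      ∀ k, as (k + 2) = aT k :=
    ⟨fun | 0 => g 0 / 2 + b₁ | 1 => f 0 / ρ + r + s - 2 * b₀ | k + 2 => aT k, rfl, rfl, fun _ => rfl⟩
  obtain ⟨cs, hcs⟩ : ∃ cs : ℕ → ℝ, cs 0 = (E - 2 * κ) / 2 ∧ ∀ k, cs (k + 1) = cT k :=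
    ⟨fun | 0 => (E - 2 * κ) / 2 | k + 1 => cT k, rfl, fun _ => rfl⟩
  obtain ⟨α, hα⟩ := (memLoop_of_tail (ρ := ρ) (f := as) 2
    ((funext has.2.2 : (fun k => as (k + 2)) = aT) ▸ ma)).exists_eq
  obtain ⟨β, hβ⟩ := (memLoop_of_tail (ρ := ρ) (f := bs) 3
    ((funext hbs.2.2.2 : (fun k => bs (k + 3)) = bT) ▸ mb)).exists_eq
  obtain ⟨γ, hγ⟩ := (memLoop_of_tail (ρ := ρ) (f := cs) 1
    ((funext hcs.2 : (fun k => cs (k + 1)) = cT) ▸ mc)).exists_eq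
  have Ca : ∀ n : ℕ, coef ρ α n = as n := fun n => (coef_natCast α n).trans (hα n)
  have Cb : ∀ n : ℕ, coef ρ β n = bs n := fun n => (coef_natCast β n).trans (hβ n)
  have Cc : ∀ n : ℕ, coef ρ γ n = cs n := fun n => (coef_natCast γ n).trans (hγ n)
  have a0 : coef ρ α 0 = g 0 / 2 + b₁ := (Ca 0).trans has.1
  have a1 : coef ρ α 1 = f 0 / ρ + r + s - 2 * b₀ := (Ca 1).trans has.2.1
  have a2 : ∀ k : ℕ, coef ρ α (k + 2 : ℕ) = aT k := fun k => (Ca _).trans (has.2.2 k)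
  have b0 : coef ρ β 0 = b₀ := (Cb 0).trans hbs.1
  have b1 : coef ρ β 1 = b₁ := (Cb 1).trans hbs.2.1
  have b2 : coef ρ β 2 = s - b₀ := (Cb 2).trans hbs.2.2.1
  have b3 : ∀ k : ℕ, coef ρ β (k + 3 : ℕ) = bT k := fun k => (Cb _).trans (hbs.2.2.2 k)
  have c0 : coef ρ γ 0 = (E - 2 * κ) / 2 := (Cc 0).trans hcs.1
  have c1 : ∀ k : ℕ, coef ρ γ (k + 1 : ℕ) = cT k := fun k => (Cc _).trans (hcs.2 k)
  have w0 : ∀ n : ℕ, weight ρ (n : ℤ) = ρ ^ n := fun n => by simp [weight]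
  have w1 : ∀ n : ℕ, weight ρ ((n : ℤ) + 1) = ρ ^ (n + 1) := fun n => w0 (n + 1)
  refine ⟨(r, α, β, γ), fun n => ?_, fun n => ?_, fun n => ?_, Prod.ext ?_ ?_, ?_⟩
  · change f n = (coef ρ α (n + 1) - coef ρ β (n + 2) + coef ρ β (-n) - if n = 0 then r else 0) * _
    rw [w1]
    rcases n with _ | n
    · norm_num
      rw [a1, b2, b0]
      field_simp
      ring
    · have e : ((n + 1 : ℕ) : ℤ) + 2 = (n + 3 : ℕ) := by push_cast; ring
      have e' : ((n + 1 : ℕ) : ℤ) + 1 = (n + 2 : ℕ) := by push_cast; ring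
      rw [coef_of_neg β (k := -((n + 1 : ℕ) : ℤ)) (by omega), if_neg (by omega), e, e', a2, b3, haT,
        Pi.add_apply]
      field_simp
      ring
  · change g n = (coef ρ γ (n - 1) + 2 * coef ρ α n - coef ρ β (n + 1) - coef ρ β (1 - n) +
      if n = 1 then r else 0) * _
    rw [w0]
    rcases n with _ | _ | n
    · rw [coef_of_neg γ (by norm_num)]
      norm_num
      rw [a0, b1]
      ring
    · norm_num
      rw [a1, b2, b0, c0, hb₀, hE]
      field_simp
      ring
    · have e : ((n + 1 + 1 : ℕ) : ℤ) + 1 = (n + 3 : ℕ) := by push_cast; ring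
      have e' : ((n + 1 + 1 : ℕ) : ℤ) - 1 = (n + 1 : ℕ) := by push_cast; ring
      rw [coef_of_neg β (k := 1 - ((n + 1 + 1 : ℕ) : ℤ)) (by omega), if_neg (by omega), e, e', a2,
        b3, c1, hcT, Pi.add_apply, Pi.add_apply]
      field_simp
      ring
  · change q n = (-coef ρ β (-n) - coef ρ β (n + 2) + if n = 0 then r else 0) * _
    rw [w1]
    rcases n with _ | n
    · norm_num
      rw [b0, b2, hr]
      field_simp
      ring
    · have e : ((n + 1 : ℕ) : ℤ) + 2 = (n + 3 : ℕ) := by push_cast; ring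
      rw [coef_of_neg β (k := -((n + 1 : ℕ) : ℤ)) (by omega), if_neg (by omega), e, b3, hbT]
      field_simp
      ring
  · have h := reEv_eq (ρ := ρ) (e := 1) (by norm_num) β
    simp only [b3, b0, b1, b2, ← hT] at h
    push_cast at h
    change hp = reEv ρ 1 β
    rw [h, hb₁, hs]
    ring
  · have h := reEv_eq (ρ := ρ) (e := -1) (by norm_num) β
    simp only [b3, b0, b1, b2, ← hT] at h
    push_cast at h
    change hn = reEv ρ (-1) β
    rw [h, hb₁, hs]
    ring
  · change κ = -(coef ρ γ 0 / 2) - 2 * coef ρ β 0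
    rw [c0, b0, hb₀]
    ring

lemma IsLinSys.unique {w : ParamSpace} {y y' : SysSpace × ℝ} (h : IsLinSys ρ w y)
    (h' : IsLinSys ρ w y') : y = y' := by
  refine Prod.ext (Prod.ext ?_ (Prod.ext ?_ (Prod.ext ?_ (h.four.trans h'.four.symm))))
    (h.five.trans h'.five.symm)
  · exact lp.ext (funext fun n => (h.one n).trans (h'.one n).symm)
  · exact lp.ext (funext fun n => (h.two n).trans (h'.two n).symm)
  · exact lp.ext (funext fun n => (h.three n).trans (h'.three n).symm)

/-- A continuous linear bijection between Banach spaces has a continuous inverse. -/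
lemma isInvertible_fderiv_sys {f' : ℝ × ParamSpace →L[ℝ] SysSpace × ℝ}
    (hf : HasFDerivAt (sys ρ hm hD) f' (0, centreV ρ)) :
    (f' ∘L .inr ℝ ℝ ParamSpace).IsInvertible := by
  have h : ∀ w, IsLinSys ρ w ((f' ∘L .inr ℝ ℝ ParamSpace) w) := fun w => isLinSys_fderiv hf w
  refine ⟨ContinuousLinearEquiv.ofBijective (f' ∘L .inr ℝ ℝ ParamSpace) ?_ ?_, ?_⟩
  · refine LinearMap.ker_eq_bot'.mpr fun w hw => ?_
    have := h w
    rw [show (f' ∘L .inr ℝ ℝ ParamSpace) w = 0 from hw] at this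
    exact this.eq_zero
  · refine LinearMap.range_eq_top.mpr fun y => ?_
    obtain ⟨w, hw⟩ := exists_isLinSys (ρ := ρ) y
    exact ⟨w, (h w).unique hw⟩
  · rfl

end Inverse

end DPW

namespace DPW

/-! ### The implicit function and the theorem. -/

section Main

open LoopAlg LoopMat

variable {ρ : ℝ} [Fact (1 < ρ)]

lemma loopNorm_sub (v w : L1 ℕ ℝ) :
    loopNorm ρ ((fun k => v k / ρ ^ k) - fun k => w k / ρ ^ k) = ‖v - w‖ := by
  have hρ : 0 < ρ := zero_lt_one.trans (Fact.out : 1 < ρ)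
  rw [loopNorm, L1.norm_eq]
  refine tsum_congr fun k => ?_
  rw [Pi.sub_apply, ← sub_div, abs_div, abs_of_pos (pow_pos hρ k),
    div_mul_cancel₀ _ (pow_pos hρ k).ne']
  rfl

/-- Weighted coordinates make the four conditions exactly those of the maximum norm on the product.
-/
lemma toParam_mem_paramBall {δ : ℝ} {v : ParamSpace} :
    toParam ρ v ∈ paramBall ρ δ ↔ ‖v - centreV ρ‖ < δ := by
  have hm : ∀ v : L1 ℕ ℝ, MemLoop ρ fun k => v k / ρ ^ k := fun v => memLoop_div v 0 0
  rw [Prod.norm_def, Prod.norm_def, Prod.norm_def, max_lt_iff, max_lt_iff, max_lt_iff, paramBall,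
    ← toParam_centreV (ρ := ρ)]
  simp only [Set.mem_ofPred_eq, toParam, hm, true_and, loopNorm_sub, Prod.fst_sub, Prod.snd_sub,
    Real.norm_eq_abs]

lemma exists_toParam_eq {δ : ℝ} {x : Param} (hx : x ∈ paramBall ρ δ) :
    ∃ v, toParam ρ v = x := by
  obtain ⟨ha, hb, hc, -⟩ := hx
  obtain ⟨α, hα⟩ := ha.exists_eq
  obtain ⟨β, hβ⟩ := hb.exists_eq
  obtain ⟨γ, hγ⟩ := hc.exists_eq
  exact ⟨(x.r, α, β, γ), Param.ext rfl (funext hα) (funext hβ) (funext hγ)⟩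

lemma evalLoop_centre_a (lam : ℂ) : evalLoop centre.a lam = lam := by
  rw [evalLoop, tsum_eq_single 1]
  · simp [centre]
  · intro k hk
    simp [centre, hk]

lemma evalLoop_centre_b (lam : ℂ) : evalLoop centre.b lam = (lam ^ 2 - 1) / 2 := by
  rw [evalLoop, tsum_eq_sum (s := {0, 2})]
  · rw [Finset.sum_pair (by norm_num)]
    simp [centre]
    ring
  · intro k hk
    simp only [Finset.mem_insert, Finset.mem_singleton, not_or] at hk
    simp [centre, hk.1, hk.2]

variable {m : ℕ} {r d : ℝ}

/-- At `λ = ±1` the central `b` vanishes, so the entry `a - r λ⁻¹ b` reduces to `a = λ`. This fixes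
the sign of the monodromy eigenvalues. -/
lemma ev_entry_loopR_centreV {lam : ℂ} (h : ‖lam‖ = 1) (h2 : lam ^ 2 = 1) :
    ev lam (entry 0 0 (loopR ρ m (centreV ρ))) = lam := by
  have ha := congrArg Param.a (toParam_centreV (ρ := ρ))
  have hb := congrArg Param.b (toParam_centreV (ρ := ρ))
  simp only [toParam] at ha hb
  rw [entry_loopR_zero_zero, map_sub, map_smul, ev_mul h, ev_ofSeq h, ev_ofSeq h, ha, hb,
    evalLoop_centre_a, evalLoop_centre_b]
  simp [h2]

lemma eventually_norm_ev_sub_lt (hm : 1 ≤ m) (hD : IsDisc m r d) {lam : ℂ} (h : ‖lam‖ = 1)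
    (h2 : lam ^ 2 = 1) : ∀ᶠ p in nhds ((0 : ℝ), centreV ρ),
      ‖ev lam (entry 0 0 (logMon ρ hm hD p)) - lam‖ < 1 := by
  have hc : ContinuousAt (fun p => ev lam (entry 0 0 (logMon ρ hm hD p))) (0, centreV ρ) :=
    ContinuousAt.comp (g := fun M => ev lam (entry 0 0 M))
      ((ev (ρ := ρ) lam).continuous.comp (entry 0 0).continuous).continuousAt
      (contDiffAt_logMon (ρ := ρ) hm hD (n := 0) _).continuousAt
  refine (hc.sub continuousAt_const).norm.eventually_lt_const ?_
  change ‖ev lam (entry 0 0 (logMon ρ hm hD (0, centreV ρ))) - lam‖ < 1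
  rw [logMon_zero, ev_entry_loopR_centreV h h2, sub_self, norm_zero]
  exact zero_lt_one

/-- The implicit function that solves the system. -/
lemma exists_implicit (hm : 1 ≤ m) (hD : IsDisc m r d) : ∃ ψ : ℝ → ParamSpace,
    Filter.Tendsto ψ (nhds 0) (nhds (centreV ρ)) ∧
    (∀ᶠ p in nhds ((0 : ℝ), centreV ρ), sys ρ hm hD p = 0 ↔ ψ p.1 = p.2) := by
  have hf : HasStrictFDerivAt (sys ρ hm hD) (fderiv ℝ (sys ρ hm hD) (0, centreV ρ))
      (0, centreV ρ) :=
    (contDiffAt_sys (ρ := ρ) hm hD (n := 1) (centreV ρ)).hasStrictFDerivAt one_ne_zero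
  have hi := isInvertible_fderiv_sys hf.hasFDerivAt
  refine ⟨hf.implicitFunctionOfProdDomain hi, hf.tendsto_implicitFunctionOfProdDomain hi, ?_⟩
  have h := hf.eventually_apply_eq_iff_implicitFunctionOfProdDomain hi
  rwa [sys_centreV] at h

end Main

end DPW

theorem mainTheorem6 (m : ℕ) (hm : 1 ≤ m) (ρ : ℝ) (hρ : 1 < ρ) :
    ∃ δ : ℝ, 0 < δ ∧ ∃ ε : ℝ, 0 < ε ∧ ∀ t : ℝ, t ≠ 0 → |t| < ε →
      ∃ x : DPW.Param, x ∈ DPW.paramBall ρ δ ∧ DPW.SolvesSystem m t x ∧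
        (∀ y : DPW.Param, y ∈ DPW.paramBall ρ δ → DPW.SolvesSystem m t y → y = x) ∧
        (∀ j : ℕ, j < DPW.nSing m →
          DPW.matM m j t x 1 = DPW.diagExp t ^ ((-1 : ℤ) ^ j) ∧
          DPW.matM m j t x (-1) = DPW.diagExp (-t) ^ ((-1 : ℤ) ^ j)) ∧
        (∀ j : ℕ, j < DPW.nSing m → ∀ lam : ℂ, ‖lam‖ = 1 →
          (DPW.matA m x j lam).det = -1) := by
  open DPW in
  have : Fact (1 < ρ) := ⟨hρ⟩
  obtain ⟨r, d, hlt, hpos, hle⟩ := exists_disc hm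
  have hD : IsDisc m r d := ⟨hlt, hpos, hle⟩
  obtain ⟨ψ, hψ, hiff⟩ := exists_implicit (ρ := ρ) hm hD
  -- One radius serves the smallness of the data, the description of the zero set by `ψ`, and the
  -- closeness of `L_11` to `±1`.
  obtain ⟨δ, hδ, hgood⟩ := Metric.eventually_nhds_iff.mp
    (((eventually_isSmall (ρ := ρ) hm hD (centreV ρ)).and hiff).and
      ((eventually_norm_ev_sub_lt (ρ := ρ) hm hD (lam := 1) (by simp) (by simp)).and
        (eventually_norm_ev_sub_lt (ρ := ρ) hm hD (lam := -1) (by simp) (by simp))))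
  obtain ⟨ε, hε, hψε⟩ := Metric.eventually_nhds_iff.mp (Metric.tendsto_nhds.mp hψ δ hδ)
  -- The product distance is a maximum, so `|t| < δ` keeps all of the parameter ball in the good
  -- neighbourhood, which gives uniqueness; `|t| < ε` keeps `ψ t` in that ball, which gives
  -- existence.
  refine ⟨δ, hδ, min δ ε, lt_min hδ hε, fun t ht htε => ?_⟩
  have hdist : ∀ v : ParamSpace, ‖v - centreV ρ‖ < δ → dist (t, v) (0, centreV ρ) < δ := by
    intro v hv
    rw [Prod.dist_eq, max_lt_iff, Real.dist_eq, sub_zero, dist_eq_norm]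
    exact ⟨htε.trans_le (min_le_left _ _), hv⟩
  have hv : ‖ψ t - centreV ρ‖ < δ := by
    rw [← dist_eq_norm]
    exact hψε (by rw [Real.dist_eq, sub_zero]; exact htε.trans_le (min_le_right _ _))
  obtain ⟨⟨hp, hsys⟩, h1, h2⟩ := hgood (hdist _ hv)
  have hs : SolvesSystem m t (toParam ρ (ψ t)) := (hp.solvesSystem_iff ht).mpr (hsys.mpr rfl)
  refine ⟨toParam ρ (ψ t), toParam_mem_paramBall.mpr hv, hs, fun y hy hys => ?_, fun j _ => ?_,
    fun j _ lam hl => hp.det_matA_eq ht hs hl j⟩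
  · obtain ⟨v, rfl⟩ := exists_toParam_eq hy
    obtain ⟨⟨hp', hsys'⟩, -⟩ := hgood (hdist _ (toParam_mem_paramBall.mp hy))
    rw [hsys'.mp ((hp'.solvesSystem_iff ht).mp hys)]
  · refine matM_of_matM_zero m _ hm
      (fun lam hl => ⟨_, isContinuation_loopSol hp.regular hp.unit hl⟩) ?_ ?_ j
    · have := hp.matM_zero_eq_diagExp ht hs (lam := 1) (by simp) hs.2.2.1 (e := 1) (by simp)
        (by simpa using h1)
      rwa [one_mul] at this
    · have := hp.matM_zero_eq_diagExp ht hs (lam := -1) (by simp) hs.2.2.2.1 (e := -1) (by simp)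
        (by simpa using h2)
      rwa [neg_one_mul] at this
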